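/- **Setting.** Let $\Lambda=\Lambda_0\oplus\Lambda_1$ be a Grassmann algebra over $\mathbb C$ (the exterior algebra of a complex vector space $V$). A (smooth) superfunction is $a(x,\theta)=a^0(x)+\theta a^1(x)$, where $x\in\mathbb R/2\pi\mathbb Z$, $\theta$ is an odd variable, $\theta^2=0$, and $a^0,a^1\in C^\infty(\mathbb S^1)\otimes\Lambda$. Let $\partial=\partial/\partial x$ and $D_\theta=\partial/\partial\theta+\theta\,\partial/\partial x$, so that $D_\theta^2=\partial$ and $D_\theta(uv)=(D_\theta u)v+(-1)^{p(u)}u\,D_\theta v$. Consider formal operators $a=\sum_{j\le J}a_jD_\theta^j$ ($J\in\mathbb Z$) with superfunction coefficients and their associative product $\circ$. Such an operator is even if each $a_j$ has parity $j\bmod 2$. Put $[a,b]=a\circ b-b\circ a$, $a_+=\sum_{j\ge0}a_jD_\theta^j$, $a_-=a-a_+$, $\mathcal R a=(a_+-a_-)/2$, $\operatorname{res}a=a_{-1}$ and $$(a,b)=\int_0^{2\pi}\!dx\int d\theta\ \operatorname{res}(a\circ b)\in\Lambda .$$ For differential operators the formal adjoint is given by $(aD_\theta^j)^*=(-1)^{p(a)j}(-1)^{j(j+1)/2}D_\theta^j\circ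 a$; below, $P_+^*$ means $(P_+)^*$. For superfunctions $u,v$ of opposite parities, where $u$ is of the type of an eigenfunction ($f_i$ or $\Phi_i$, or a gradient with respect to a starred variable) and $v$ of the type of an adjoint eigenfunction, put $\langle u,v\rangle=\int dx\int d\theta\ \operatorname{res}(uD_\theta^{-1}v)$. Fix $m\ge1$ and $N$. The phase space $\mathcal G^*\oplus W^{2N|2N}$ consists of the tuples $(l,f_i,\Phi_i^*,f_i^*,\Phi_i)_{i=1,\dots,N}$, where $l=\partial^m+\sum_{j<2m}a_jD_\theta^j$ is an even operator, $f_i,\Phi_i^*$ are even and $f_i^*,\Phi_i$ are odd superfunctions. Tangent vectors $(\delta l,\delta f_i,\delta\Phi_i^*,\delta f_i^*,\delta\Phi_i)$ have the same parities, with $\delta l$ even of the form $\sum_{j<2m}b_jD_\theta^j$. The left gradient $\nabla\gamma=(\frac{\delta\gamma}{\delta l},\frac{\delta\gamma}{\delta f_i},\frac{\delta\gamma}{\delta\Phi_i^*},\frac{\delta\gamma}{\delta f_i^*},\frac{\delta\gamma}{\delta\Phi_i})$ of an even $\Lambda$-valued functional $\gamma$ is defined by $$\delta\gamma=\Big(\frac{\delta\gamma}{\delta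 l},\delta l\Big)+\sum_{i=1}^N\Big(\Big\langle\delta f_i,\frac{\delta\gamma}{\delta f_i}\Big\rangle+\Big\langle\frac{\delta\gamma}{\delta\Phi_i^*},\delta\Phi_i^*\Big\rangle+\Big\langle\frac{\delta\gamma}{\delta f_i^*},\delta f_i^*\Big\rangle+\Big\langle\delta\Phi_i,\frac{\delta\gamma}{\delta\Phi_i}\Big\rangle\Big);$$ its first component is an even operator, $\frac{\delta\gamma}{\delta f_i},\frac{\delta\gamma}{\delta\Phi_i^*}$ are odd and $\frac{\delta\gamma}{\delta f_i^*},\frac{\delta\gamma}{\delta\Phi_i}$ are even. Covectors are tuples of this kind. **Poisson structure.** In the variables $(\tilde l,f_i,\Phi_i^*,f_i^*,\Phi_i)$ let $$\tilde{\mathcal L}:(P,p_i,q_i,r_i,s_i)\mapsto\big([\tilde l,P_+]-[\tilde l,P]_+,\,-r_i,\,s_i,\,p_i,\,-q_i\big).$$ Let $B$ be the Bäcklund transformation $(\tilde l,f_i,\Phi_i^*,f_i^*,\Phi_i)\mapsto(l,f_i,\Phi_i^*,f_i^*,\Phi_i)$ with $$l=\tilde l+\sum_{i=1}^N\big(f_iD_\theta^{-1}f_i^*+\Phi_iD_\theta^{-1}\Phi_i^*\big),$$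 let $B'$ be its derivative, $B'^*$ the adjoint of $B'$ for the above pairing of covectors and tangent vectors, and $\mathcal L=B'\tilde{\mathcal L}B'^*$, a field of maps from covectors to tangent vectors in the variables $(l,f_i,\Phi_i^*,f_i^*,\Phi_i)$. **Casimir functionals.** For $n\in\mathbb Z_+=\{0,1,2,\dots\}$ let $\gamma_n(l)=\frac1{n+1}\big(l^{1/m},l^{n/m}\big)$, where $l^{1/m}$ is the even $m$-th root of the form $\partial+\sum_{j<2}c_jD_\theta^j$ and $l^{n/m}=(l^{1/m})^n$. **Theorem.** The root $l^{1/m}$ exists and is unique, and $B$ is a bijection of the phase space. (a) For a point $(l,f_i,\Phi_i^*,f_i^*,\Phi_i)$ and a covector $g=(P,p_i,q_i,r_i,s_i)$, $$B'^*g=(P,\ p_i+P_+^*f_i^*,\ q_i+P_+\Phi_i,\ r_i+P_+f_i,\ s_i+P_+^*\Phi_i^*)=:(P,\tilde p_i,\tilde q_i,\tilde r_i,\tilde s_i),$$ $$\mathcal L\,g=\begin{pmatrix}[\tilde l,P_+]-[\tilde l,P]_++\sum_i\big(f_iD_\theta^{-1}\tilde p_i-\tilde r_iD_\theta^{-1}f_i^*+\Phi_iD_\theta^{-1}\tilde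 s_i-\tilde q_iD_\theta^{-1}\Phi_i^*\big)\\-r_i-P_+f_i\\ s_i+P_+^*\Phi_i^*\\ p_i+P_+^*f_i^*\\-q_i-P_+\Phi_i\end{pmatrix},$$ and the first row also equals $[l,P_+]-[l,P]_++\sum_i\big(f_iD_\theta^{-1}p_i-r_iD_\theta^{-1}f_i^*+\Phi_iD_\theta^{-1}s_i-q_iD_\theta^{-1}\Phi_i^*\big)$. Moreover $\mathcal L$ is a Poisson structure: it is linear and skew, and satisfies the Jacobi identity (its Schouten bracket with itself vanishes). (b) For every $n\in\mathbb Z_+$ the functional $\gamma_n$ has at every $l$ a gradient $\nabla\gamma_n(l)$ with $[l,\nabla\gamma_n(l)]=0$, and the coupled system $$\frac{dl}{dt_n}=[\mathcal R\nabla\gamma_n(l),l]=[(\nabla\gamma_n(l))_+,l],$$ $$\frac{df_i}{dt_n}=(\nabla\gamma_n(l))_+f_i,\qquad\frac{d\Phi_i}{dt_n}=(\nabla\gamma_n(l))_+\Phi_i,$$ $$\frac{df_i^*}{dt_n}=-(\nabla\gamma_n(l))_+^*f_i^*,\qquad\frac{d\Phi_i^*}{dt_n}=-(\nabla\gamma_n(l))_+^*\Phi_i^*,\qquad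 i=1,\dots,N,$$ is Hamiltonian on the whole phase space with respect to $\mathcal L$ and $\gamma_n$ (regarded as a functional that does not depend on $f_i,\Phi_i^*,f_i^*,\Phi_i$), that is, its vector field equals $$-\mathcal L\,\nabla\gamma_n(l,f_i,\Phi_i^*,f_i^*,\Phi_i),\qquad \nabla\gamma_n(l,f_i,\Phi_i^*,f_i^*,\Phi_i)=(\nabla\gamma_n(l),0,0,0,0).$$ If $V$ is infinite-dimensional, the vector field $-\mathcal L\nabla\gamma_n$ and the field $dl/dt_n=[(\nabla\gamma_n(l))_+,l]$, $df_i/dt_n=(\nabla\gamma_n(l))_+f_i,\dots$ of the system do not depend on the choice of the gradients, so that the same equality holds for any gradient $\nabla\gamma_n(l)$ of $\gamma_n$ at $l$ and any gradient of $\gamma_n$ on the extended phase space. -/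

import Mathlib

open scoped TensorProduct ContDiff

noncomputable section

namespace SuperLax

/-! ### Superfunctions on the supercircle -/

/-- Smooth complex functions on the circle `ℝ / 2πℤ`, as `2π`-periodic functions of `x`. -/
def CircleFun : Subalgebra ℂ (ℝ → ℂ) where
  carrier := {f | ContDiff ℝ ∞ f ∧ Function.Periodic f (2 * Real.pi)}
  mul_mem' ha hb := ⟨ha.1.mul hb.1, ha.2.mul hb.2⟩
  add_mem' ha hb := ⟨ha.1.add hb.1, ha.2.add hb.2⟩
  algebraMap_mem' _ := ⟨contDiff_const, fun _ => rfl⟩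

/-- `d/dx` on smooth functions on the circle. -/
def circleDeriv : CircleFun →ₗ[ℂ] CircleFun where
  toFun f := ⟨deriv f.1, (contDiff_infty_iff_deriv.1 f.2.1).2, fun x => by
    have h : (fun y => f.1 (y + 2 * Real.pi)) = f.1 := funext f.2.2
    rw [← deriv_comp_add_const, h]⟩
  map_add' f g := by
    ext x
    exact deriv_add ((contDiff_infty_iff_deriv.1 f.2.1).1 x)
      ((contDiff_infty_iff_deriv.1 g.2.1).1 x)
  map_smul' c f := by
    ext x
    exact deriv_const_smul c ((contDiff_infty_iff_deriv.1 f.2.1).1 x)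

/-- `∫₀^{2π} f dx`. -/
def circleInt : CircleFun →ₗ[ℂ] ℂ where
  toFun f := ∫ x in (0 : ℝ)..(2 * Real.pi), f.1 x
  map_add' f g := intervalIntegral.integral_add
    (f.2.1.continuous.intervalIntegrable _ _) (g.2.1.continuous.intervalIntegrable _ _)
  map_smul' c f := intervalIntegral.integral_smul c f.1

/-- The Grassmann algebra `Λ = Λ₀ ⊕ Λ₁` over `ℂ` generated by the vector space `V`. -/
abbrev Grassmann (V : Type*) [AddCommGroup V] [Module ℂ V] := ExteriorAlgebra ℂ V

/-- `C^∞(𝕊¹) ⊗ Λ`: smooth `Λ`-valued functions on the circle (each one takes its values in a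
finite-dimensional subspace of `Λ`). -/
def GrFun (V : Type*) [AddCommGroup V] [Module ℂ V] : Type _ := CircleFun ⊗[ℂ] Grassmann V

instance (V : Type*) [AddCommGroup V] [Module ℂ V] : Ring (GrFun V) :=
  inferInstanceAs (Ring (CircleFun ⊗[ℂ] Grassmann V))

instance (V : Type*) [AddCommGroup V] [Module ℂ V] : Algebra ℂ (GrFun V) :=
  inferInstanceAs (Algebra ℂ (CircleFun ⊗[ℂ] Grassmann V))

variable {V : Type*} [AddCommGroup V] [Module ℂ V] {N : ℕ}

/-- The grade involution of `C^∞(𝕊¹) ⊗ Λ`: `+1` on the even part and `-1` on the odd part. -/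
def grInvol : GrFun V →ₐ[ℂ] GrFun V :=
  Algebra.TensorProduct.map (AlgHom.id ℂ CircleFun) CliffordAlgebra.involute

/-- `∂/∂x` on `Λ`-valued functions. -/
def grDeriv : GrFun V →ₗ[ℂ] GrFun V := LinearMap.rTensor (Grassmann V) circleDeriv

/-- `∫₀^{2π} · dx` on `Λ`-valued functions. -/
def grInt : GrFun V →ₗ[ℂ] Grassmann V :=
  (TensorProduct.lid ℂ (Grassmann V)).toLinearMap ∘ₗ LinearMap.rTensor (Grassmann V) circleInt

/-- Smooth superfunctions `a(x, θ) = a⁰(x) + θ a¹(x)`. -/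
@[ext]
structure SFun (V : Type*) [AddCommGroup V] [Module ℂ V] where
  /-- the component `a⁰` -/
  c0 : GrFun V
  /-- the component `a¹` -/
  c1 : GrFun V

instance : Add (SFun V) := ⟨fun a b => ⟨a.c0 + b.c0, a.c1 + b.c1⟩⟩
instance : Zero (SFun V) := ⟨⟨0, 0⟩⟩
instance : Neg (SFun V) := ⟨fun a => ⟨-a.c0, -a.c1⟩⟩
instance : SMul ℂ (SFun V) := ⟨fun c a => ⟨c • a.c0, c • a.c1⟩⟩
instance : One (SFun V) := ⟨⟨1, 0⟩⟩

/-- `(a⁰ + θ a¹)(b⁰ + θ b¹) = a⁰ b⁰ + θ (a¹ b⁰ + ι(a⁰) b¹)`, since `θ² = 0` and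
`a⁰ θ = θ ι(a⁰)`, where `ι` is the grade involution. -/
instance : Mul (SFun V) := ⟨fun a b => ⟨a.c0 * b.c0, a.c1 * b.c0 + grInvol a.c0 * b.c1⟩⟩

@[simp] theorem SFun.add_c0 (a b : SFun V) : (a + b).c0 = a.c0 + b.c0 := rfl
@[simp] theorem SFun.add_c1 (a b : SFun V) : (a + b).c1 = a.c1 + b.c1 := rfl
@[simp] theorem SFun.zero_c0 : (0 : SFun V).c0 = 0 := rfl
@[simp] theorem SFun.zero_c1 : (0 : SFun V).c1 = 0 := rfl
@[simp] theorem SFun.neg_c0 (a : SFun V) : (-a).c0 = -a.c0 := rfl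
@[simp] theorem SFun.neg_c1 (a : SFun V) : (-a).c1 = -a.c1 := rfl
@[simp] theorem SFun.smul_c0 (c : ℂ) (a : SFun V) : (c • a).c0 = c • a.c0 := rfl
@[simp] theorem SFun.smul_c1 (c : ℂ) (a : SFun V) : (c • a).c1 = c • a.c1 := rfl
@[simp] theorem SFun.one_c0 : (1 : SFun V).c0 = 1 := rfl
@[simp] theorem SFun.one_c1 : (1 : SFun V).c1 = 0 := rfl
@[simp] theorem SFun.mul_c0 (a b : SFun V) : (a * b).c0 = a.c0 * b.c0 := rfl
@[simp] theorem SFun.mul_c1 (a b : SFun V) :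
    (a * b).c1 = a.c1 * b.c0 + grInvol a.c0 * b.c1 := rfl

instance : Ring (SFun V) where
  add_assoc a b c := by ext <;> simp only [SFun.add_c0, SFun.add_c1, add_assoc]
  zero_add a := by ext <;> simp only [SFun.add_c0, SFun.add_c1, SFun.zero_c0, SFun.zero_c1, zero_add]
  add_zero a := by ext <;> simp only [SFun.add_c0, SFun.add_c1, SFun.zero_c0, SFun.zero_c1, add_zero]
  add_comm a b := by
    ext
    · exact add_comm a.c0 b.c0
    · exact add_comm a.c1 b.c1
  neg_add_cancel a := by
    ext
    · exact neg_add_cancel a.c0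
    · exact neg_add_cancel a.c1
  nsmul := nsmulRec
  zsmul := zsmulRec
  mul_assoc a b c := by
    ext
    · exact mul_assoc a.c0 b.c0 c.c0
    · simp only [SFun.mul_c0, SFun.mul_c1, map_mul, add_mul, mul_add, mul_assoc, add_assoc]
  one_mul a := by
    ext
    · exact one_mul a.c0
    · simp only [SFun.mul_c1, SFun.one_c0, SFun.one_c1, map_one, one_mul, zero_mul, zero_add]
  mul_one a := by
    ext
    · exact mul_one a.c0
    · simp only [SFun.mul_c1, SFun.one_c0, SFun.one_c1, mul_one, mul_zero, add_zero]
  left_distrib a b c := by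
    ext
    · exact mul_add a.c0 b.c0 c.c0
    · simp only [SFun.mul_c1, SFun.add_c0, SFun.add_c1, mul_add]
      exact add_add_add_comm _ _ _ _
  right_distrib a b c := by
    ext
    · exact add_mul a.c0 b.c0 c.c0
    · simp only [SFun.mul_c1, SFun.add_c0, SFun.add_c1, map_add, add_mul]
      exact add_add_add_comm _ _ _ _
  zero_mul a := by
    ext
    · exact zero_mul a.c0
    · simp only [SFun.mul_c1, SFun.zero_c0, SFun.zero_c1, map_zero, zero_mul, add_zero]
  mul_zero a := by
    ext
    · exact mul_zero a.c0
    · simp only [SFun.mul_c1, SFun.zero_c0, SFun.zero_c1, mul_zero, add_zero]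

instance : Module ℂ (SFun V) where
  one_smul a := by ext <;> simp only [SFun.smul_c0, SFun.smul_c1, one_smul]
  mul_smul c d a := by ext <;> simp only [SFun.smul_c0, SFun.smul_c1, mul_smul]
  smul_zero c := by
    ext <;> simp only [SFun.smul_c0, SFun.smul_c1, SFun.zero_c0, SFun.zero_c1, smul_zero]
  smul_add c a b := by
    ext <;> simp only [SFun.smul_c0, SFun.smul_c1, SFun.add_c0, SFun.add_c1, smul_add]
  add_smul c d a := by
    ext <;> simp only [SFun.smul_c0, SFun.smul_c1, SFun.add_c0, SFun.add_c1, add_smul]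
  zero_smul a := by
    ext <;> simp only [SFun.smul_c0, SFun.smul_c1, SFun.zero_c0, SFun.zero_c1, zero_smul]

/-- The grade involution of superfunctions (`θ` is odd). -/
def invol : SFun V →ₗ[ℂ] SFun V where
  toFun a := ⟨grInvol a.c0, -grInvol a.c1⟩
  map_add' a b := by
    ext
    · exact map_add grInvol a.c0 b.c0
    · exact (congrArg Neg.neg (map_add grInvol a.c1 b.c1)).trans (neg_add _ _)
  map_smul' c a := by
    ext
    · exact map_smul grInvol c a.c0
    · exact (congrArg Neg.neg (map_smul grInvol c a.c1)).trans (smul_neg c _).symm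

/-- The superderivative `D_θ = ∂/∂θ + θ ∂/∂x`, that is `a⁰ + θ a¹ ↦ a¹ + θ ∂a⁰/∂x`. -/
def superD : SFun V →ₗ[ℂ] SFun V where
  toFun a := ⟨a.c1, grDeriv a.c0⟩
  map_add' a b := by
    ext
    · rfl
    · exact map_add grDeriv a.c0 b.c0
  map_smul' c a := by
    ext
    · rfl
    · exact map_smul grDeriv c a.c0

/-- The Berezin integral `∫₀^{2π} dx ∫ dθ (a⁰ + θ a¹) = ∫₀^{2π} a¹ dx`, with values in `Λ`. -/
def berezin : SFun V →ₗ[ℂ] Grassmann V where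
  toFun a := grInt a.c1
  map_add' a b := map_add grInt a.c1 b.c1
  map_smul' c a := map_smul grInt c a.c1

/-- `ι ^ k`, for an integer `k`, where `ι` is the grade involution. -/
def twist (k : ℤ) : SFun V →ₗ[ℂ] SFun V := if Even k then LinearMap.id else invol

/-- `a` is homogeneous of parity `k mod 2`. -/
def HasParity (k : ℤ) (a : SFun V) : Prop := invol a = if Even k then a else -a

/-! ### Super-integro-differential operators -/

/-- Sequences `(a_j)`, `j ∈ ℤ`, of superfunctions with `a_j = 0` for all large `j`. -/
def opCoeffs (V : Type*) [AddCommGroup V] [Module ℂ V] : Submodule ℂ (ℤ → SFun V) where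
  carrier := {a | ∃ J : ℤ, ∀ j, J < j → a j = 0}
  zero_mem' := ⟨0, fun _ _ => rfl⟩
  add_mem' := by
    rintro a b ⟨J, hJ⟩ ⟨K, hK⟩
    refine ⟨max J K, fun j hj => ?_⟩
    rw [Pi.add_apply, hJ j (lt_of_le_of_lt (le_max_left _ _) hj),
      hK j (lt_of_le_of_lt (le_max_right _ _) hj), add_zero]
  smul_mem' := by
    rintro c a ⟨J, hJ⟩
    exact ⟨J, fun j hj => by rw [Pi.smul_apply, hJ j hj, smul_zero]⟩

/-- Formal operators `∑_{j ≤ J} a_j D_θ^j`, given by their coefficients `j ↦ a_j`. -/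
def Op (V : Type*) [AddCommGroup V] [Module ℂ V] : Type _ := opCoeffs V

instance : AddCommGroup (Op V) := inferInstanceAs (AddCommGroup (opCoeffs V))

instance : Module ℂ (Op V) := inferInstanceAs (Module ℂ (opCoeffs V))

/-- The coefficient `a_j` of `D_θ^j`. -/
def Op.coeff (P : Op V) (j : ℤ) : SFun V := P.1 j

/-- The operator `a D_θ^j`. -/
def Op.mono (a : SFun V) (j : ℤ) : Op V :=
  ⟨fun k => if k = j then a else 0, j, fun _ hk => if_neg (ne_of_gt hk)⟩

/-- Super-binomial coefficients: `D_θ^i ∘ b = ∑_r [i, r] (-1)^{p(b)(i - r)} (D_θ^r b) D_θ^{i-r}`. -/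
def superChoose (i : ℤ) (r : ℕ) : ℤ :=
  if Even i ∧ Odd r then 0 else Ring.choose (i / 2) (r / 2)

/-- The coefficient of `D_θ^k` in `a ∘ b`; the sum has finitely many nonzero terms. -/
def compCoeff (a b : Op V) (k : ℤ) : SFun V :=
  ∑ᶠ p : ℤ × ℕ, superChoose p.1 p.2 •
    (a.coeff p.1 * (superD ^ p.2) (twist (p.1 - p.2) (b.coeff (k - p.1 + p.2))))

/-- The associative product `a ∘ b` of super-integro-differential operators. -/
def Op.comp (a b : Op V) : Op V := ⟨compCoeff a b, by
  obtain ⟨I, hI⟩ := a.2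
  obtain ⟨J, hJ⟩ := b.2
  refine ⟨I + J, fun k hk => ?_⟩
  have h : ∀ p : ℤ × ℕ, superChoose p.1 p.2 •
      (a.coeff p.1 * (superD ^ p.2) (twist (p.1 - p.2) (b.coeff (k - p.1 + p.2)))) = 0 := by
    intro p
    rcases lt_or_ge I p.1 with h1 | h1
    · rw [show a.coeff p.1 = 0 from hI _ h1, zero_mul, smul_zero]
    · rw [show b.coeff (k - p.1 + p.2) = 0 from hJ _ (by omega), map_zero, map_zero, mul_zero,
        smul_zero]
  simp only [compCoeff, h, finsum_zero]⟩

/-- Powers `P^n` with respect to `∘`. -/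
def Op.pow (P : Op V) : ℕ → Op V
  | 0 => Op.mono 1 0
  | n + 1 => Op.comp (Op.pow P n) P

/-- The commutator `[a, b] = a ∘ b - b ∘ a`. -/
def comm (a b : Op V) : Op V := a.comp b - b.comp a

/-- The projection `P₊` onto differential operators. -/
def Op.plus (P : Op V) : Op V := ⟨fun j => if 0 ≤ j then P.coeff j else 0, by
  obtain ⟨J, hJ⟩ := P.2
  refine ⟨J, fun j hj => ?_⟩
  have h : P.coeff j = 0 := hJ j hj
  simp only [h, ite_self]⟩

/-- `R = (P₊ - P₋) / 2`, where `P₋` is the projection onto the part of negative order. -/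
def Op.R (P : Op V) : Op V := (2⁻¹ : ℂ) • (P.plus - (P - P.plus))

/-- `∫ dx dθ res P`, where `res (∑ a_j D_θ^j) = a_{-1}`. -/
def trace (P : Op V) : Grassmann V := berezin (P.coeff (-1))

/-- The bilinear form `(a, b) = ∫ res (a ∘ b)`. -/
def form (a b : Op V) : Grassmann V := trace (a.comp b)

/-- The operator `u D_θ⁻¹ v`. -/
def rankOne (u v : SFun V) : Op V := (Op.mono u (-1)).comp (Op.mono v 0)

/-- The pairing `⟨u, v⟩ = ∫ res (u D_θ⁻¹ v)` of a function `u` of the type of an eigenfunction with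
a function `v` of the type of an adjoint eigenfunction, of opposite parities. -/
def pair (u v : SFun V) : Grassmann V := trace (rankOne u v)

/-- The action `P₊ f` of the differential part of `P` on a superfunction. -/
def act (P : Op V) (f : SFun V) : SFun V := ∑ᶠ j : ℕ, P.coeff j * (superD ^ j) f

/-- The action `P₊^* f` of the formal adjoint of the differential part of `P`:
`(a D_θ^j)^* = (-1)^{p(a) j} (D_θ^j)^* ∘ a` and `(D_θ^j)^* = (-1)^{j(j+1)/2} D_θ^j`. -/
def adjAct (P : Op V) (f : SFun V) : SFun V :=
  ∑ᶠ j : ℕ, ((-1 : ℤ) ^ (j * (j + 1) / 2)) • (superD ^ j) (twist j (P.coeff j) * f)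

/-- `P` is even: the coefficient of `D_θ^j` has parity `j`. -/
def Op.IsEven (P : Op V) : Prop := ∀ j, HasParity j (P.coeff j)

/-- `l = ∂^m + ∑_{j < 2m} a_j D_θ^j`, an even operator. -/
def IsLax (m : ℕ) (l : Op V) : Prop :=
  l.IsEven ∧ l.coeff (2 * m) = 1 ∧ ∀ j : ℤ, 2 * (m : ℤ) < j → l.coeff j = 0

/-- Admissible variations `δl = ∑_{j < 2m} b_j D_θ^j` of such `l`. -/
def IsLaxVar (m : ℕ) (v : Op V) : Prop := v.IsEven ∧ ∀ j : ℤ, 2 * (m : ℤ) ≤ j → v.coeff j = 0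

/-- `r = ∂ + …` is an `m`-th root of `l`. -/
def IsRoot (m : ℕ) (l r : Op V) : Prop := IsLax 1 r ∧ r.pow m = l

open Classical in
/-- `l^{1/m}`, the root of the form `∂ + …`. -/
def root (m : ℕ) (l : Op V) : Op V := if h : ∃ r, IsRoot m l r then h.choose else 0

/-- `γ_n(l) = (l^{1/m}, l^{n/m}) / (n + 1)`. -/
def casimir (m n : ℕ) (l : Op V) : Grassmann V :=
  ((n : ℂ) + 1)⁻¹ • form (root m l) ((root m l).pow n)

/-! ### Variations and gradients -/

/-- `d` is the derivative `d/dt F(u + t v)` at `t = 0`. The derivative of a curve in the complex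
vector space `Y` is tested on the linear functionals on `Y`. -/
def HasVariation {X Y : Type*} [AddCommGroup X] [Module ℂ X] [AddCommGroup Y] [Module ℂ Y]
    (F : X → Y) (u v : X) (d : Y) : Prop :=
  ∀ φ : Y →ₗ[ℂ] ℂ, HasDerivAt (fun t : ℝ => φ (F (u + (t : ℂ) • v))) (φ d) 0

/-- `P` is a gradient at `l` of the functional `F` of `l`: `δF(l) = (P, δl)`. -/
def IsLaxGradient (m : ℕ) (F : Op V → Grassmann V) (l P : Op V) : Prop :=
  P.IsEven ∧ ∀ v, IsLaxVar m v → HasVariation F l v (form P v)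

/-! ### The extended phase space -/

/-- Tuples `(l, f_i, Φ_i^*, f_i^*, Φ_i)`, `i = 1, …, N`. Points, tangent vectors and covectors
(left gradients) are all written in this order of the components. -/
abbrev Phase (V : Type*) [AddCommGroup V] [Module ℂ V] (N : ℕ) :=
  Op V × (Fin N → SFun V) × (Fin N → SFun V) × (Fin N → SFun V) × (Fin N → SFun V)

/-- The component `l`. -/
def Phase.l (u : Phase V N) : Op V := u.1

/-- The components `f_i`. -/
def Phase.f (u : Phase V N) : Fin N → SFun V := u.2.1

/-- The components `Φ_i^*`. -/
def Phase.Φs (u : Phase V N) : Fin N → SFun V := u.2.2.1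

/-- The components `f_i^*`. -/
def Phase.fs (u : Phase V N) : Fin N → SFun V := u.2.2.2.1

/-- The components `Φ_i`. -/
def Phase.Φ (u : Phase V N) : Fin N → SFun V := u.2.2.2.2

/-- `f_i, Φ_i^*` are even and `f_i^*, Φ_i` are odd. -/
def IsEvenOddTuple (u : Phase V N) : Prop :=
  ∀ i, HasParity 0 (u.f i) ∧ HasParity 0 (u.Φs i) ∧ HasParity 1 (u.fs i) ∧ HasParity 1 (u.Φ i)

/-- Points of the extended phase space. -/
def IsPoint (m : ℕ) (u : Phase V N) : Prop := IsLax m u.l ∧ IsEvenOddTuple u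

/-- Tangent vectors. -/
def IsTangent (m : ℕ) (v : Phase V N) : Prop := IsLaxVar m v.l ∧ IsEvenOddTuple v

/-- Covectors `(δγ/δl, δγ/δf_i, δγ/δΦ_i^*, δγ/δf_i^*, δγ/δΦ_i)` of even functionals. As the pairing
is odd, each function component is of the parity opposite to that of its variable. -/
def IsCovector (g : Phase V N) : Prop :=
  g.l.IsEven ∧
    ∀ i, HasParity 1 (g.f i) ∧ HasParity 1 (g.Φs i) ∧ HasParity 0 (g.fs i) ∧ HasParity 0 (g.Φ i)

/-- The value of the covector `g` on the tangent vector `v`. In each pairing the function of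
eigenfunction type stands first. -/
def pairing (g v : Phase V N) : Grassmann V :=
  form g.l v.l +
    ∑ i, (pair (v.f i) (g.f i) + pair (g.Φs i) (v.Φs i) + pair (g.fs i) (v.fs i)
      + pair (v.Φ i) (g.Φ i))

/-- `g` is a gradient of the functional `F` at `u`. -/
def IsGradient (m : ℕ) (F : Phase V N → Grassmann V) (u g : Phase V N) : Prop :=
  IsCovector g ∧ ∀ v, IsTangent m v → HasVariation F u v (pairing g v)

/-- A Poisson structure: a field of linear maps from covectors to tangent vectors which is skew
and satisfies the Jacobi identity
`⟨a, L'[L c] b⟩ + ⟨b, L'[L a] c⟩ + ⟨c, L'[L b] a⟩ = 0`, where `L'` is the derivative of `L`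
with respect to the point (the vanishing of the Schouten bracket of `L` with itself). -/
def IsPoisson (m : ℕ) (L : Phase V N → Phase V N → Phase V N) : Prop :=
  ∀ u, IsPoint m u →
    (∀ a, IsCovector a → IsTangent m (L u a)) ∧
    (∀ a b, IsCovector a → IsCovector b → ∀ c : ℂ, L u (a + c • b) = L u a + c • L u b) ∧
    (∀ a b, IsCovector a → IsCovector b → pairing a (L u b) = -pairing b (L u a)) ∧
    ∀ a b c, IsCovector a → IsCovector b → IsCovector c →
      ∃ d₁ d₂ d₃ : Grassmann V,
        HasVariation (fun w => pairing a (L w b)) u (L u c) d₁ ∧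
        HasVariation (fun w => pairing b (L w c)) u (L u a) d₂ ∧
        HasVariation (fun w => pairing c (L w a)) u (L u b) d₃ ∧
        d₁ + d₂ + d₃ = 0

/-! ### The Poisson structures and the Bäcklund transformation -/

/-- `Θ̃ : P ↦ [l, P₊] - [l, P]₊`. -/
def theta (l P : Op V) : Op V := comm l P.plus - (comm l P).plus

/-- The Poisson structure `L̃ = Θ̃ ⊗ J̃` in the variables `(l̃, f̃_i, Φ̃_i^*, f̃_i^*, Φ̃_i)`. -/
def tensorL (w g : Phase V N) : Phase V N := (theta w.l g.l, -g.fs, g.Φ, g.f, -g.Φs)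

/-- `∑_i (f_i D_θ⁻¹ f_i^* + Φ_i D_θ⁻¹ Φ_i^*)`. -/
def dressing (u : Phase V N) : Op V :=
  ∑ i, (rankOne (u.f i) (u.fs i) + rankOne (u.Φ i) (u.Φs i))

/-- The Bäcklund transformation
`(l̃, f_i, …) ↦ (l̃ + ∑_i (f_i D_θ⁻¹ f_i^* + Φ_i D_θ⁻¹ Φ_i^*), f_i, …)`. -/
def backlund (w : Phase V N) : Phase V N := (w.l + dressing w, w.f, w.Φs, w.fs, w.Φ)

/-- Its inverse. -/
def backlundInv (u : Phase V N) : Phase V N := (u.l - dressing u, u.f, u.Φs, u.fs, u.Φ)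

/-- The derivative `B'` of the Bäcklund transformation at `w`, on the tangent vector `v`. -/
def backlundDeriv (w v : Phase V N) : Phase V N :=
  (v.l + ∑ i, (rankOne (v.f i) (w.fs i) + rankOne (w.f i) (v.fs i)
      + rankOne (v.Φ i) (w.Φs i) + rankOne (w.Φ i) (v.Φs i)),
    v.f, v.Φs, v.fs, v.Φ)

/-- The adjoint `B'^*` at `w`, on the covector `g`. -/
def backlundAdj (w g : Phase V N) : Phase V N :=
  (g.l, fun i => g.f i + adjAct g.l (w.fs i), fun i => g.Φs i + act g.l (w.Φ i),
    fun i => g.fs i + act g.l (w.f i), fun i => g.Φ i + adjAct g.l (w.Φs i))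

/-- The Poisson structure `L = B' L̃ B'^*` in the variables `u = (l, f_i, Φ_i^*, f_i^*, Φ_i)`. -/
def extendedL (u g : Phase V N) : Phase V N :=
  backlundDeriv (backlundInv u) (tensorL (backlundInv u) (backlundAdj (backlundInv u) g))

/-- The explicit form of `L`. The first row is written in the variables with a tilde: it contains
`l̃` and the covector `h = B'^* g`, while the other rows contain `g`. -/
def explicitL (u g : Phase V N) : Phase V N :=
  let w := backlundInv u
  let h := backlundAdj w g
  (comm w.l h.l.plus - (comm w.l h.l).plus
      + ∑ i, (rankOne (u.f i) (h.f i) - rankOne (h.fs i) (u.fs i)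
        + rankOne (u.Φ i) (h.Φ i) - rankOne (h.Φs i) (u.Φs i)),
    fun i => -g.fs i - act g.l (u.f i),
    fun i => g.Φ i + adjAct g.l (u.Φs i),
    fun i => g.f i + adjAct g.l (u.fs i),
    fun i => -g.Φs i - act g.l (u.Φ i))

/-- The first row of `L`, written in the variables without a tilde. -/
def explicitFirstRow (u g : Phase V N) : Op V :=
  comm u.l g.l.plus - (comm u.l g.l).plus
    + ∑ i, (rankOne (u.f i) (g.f i) - rankOne (g.fs i) (u.fs i)
      + rankOne (u.Φ i) (g.Φ i) - rankOne (g.Φs i) (u.Φs i))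

/-- The vector field of the coupled system, for `P = ∇γ_n(l)`:
`dl/dt = [P₊, l]`, `df_i/dt = P₊ f_i`, `dΦ_i/dt = P₊ Φ_i`, `df_i^*/dt = -P₊^* f_i^*`,
`dΦ_i^*/dt = -P₊^* Φ_i^*`. -/
def laxField (P : Op V) (u : Phase V N) : Phase V N :=
  (comm P.plus u.l, fun i => act P (u.f i), fun i => -adjAct P (u.Φs i),
    fun i => -adjAct P (u.fs i), fun i => act P (u.Φ i))

end SuperLax

end

/-!
The proof turns the symbol calculus of `Defs.lean` into a ring and then runs the R-matrix
argument.

*The algebra of operators.* Left multiplication by `D_θ^i` is the operator `leftPow i`. The Pascal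
rule for super-binomial coefficients says that `leftPow (i + 1)` is `leftPow i` followed by the
injective map `leftD`, and `leftD` commutes with right multiplications because `D_θ` is an odd
derivation. Hence all `leftPow i` commute with right multiplications, and associativity is an
exchange of finite sums (`comp_assoc`). The functional `trace = ∫ res` is cyclic on even operators
(`trace_mul_comm`): this is checked for functions, by supercommutativity, and for powers of `D_θ`,
by periodicity.

*The Poisson structure.* Division with remainder by `D_θ` on either side shows that
`(P₊ ∘ u D_θ⁻¹ v)₋ = (P₊ u) D_θ⁻¹ v` and `(u D_θ⁻¹ v ∘ P₊)₋ = u D_θ⁻¹ (P₊^* v)`. These two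
identities yield the formula for `B'^*` and both forms of the first row of `L`, and say that `P₊`
and `P₊^*` are adjoint for `⟨·, ·⟩`. By `form_theta`, `Θ̃` is the Lie–Poisson structure of the
R-matrix bracket `[a₊, b₊] - [a₋, b₋]`, so that it is skew and satisfies the Jacobi identity. Since
`L = B' L̃ B'^*`, the derivative of `⟨a, L b⟩` consists of the one for `Θ̃` and of terms with the
second derivative of `B`. The latter is symmetric, so these terms cancel in the cyclic sum
(`functionVariation_jacobi`).

*The Casimir functionals.* A map that lowers the order of differences of operators has a unique
fixed point (`exists_fixedPoint`, `fixedPoint_unique`). This gives `m`-th roots and inverses of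
monic operators. The coefficients of the root of `l + t v` are coefficients of iterates, hence
polynomials in `t`, and variations may be computed with first-order jets and the Leibniz rule.
Differentiating `r^m = l` gives the gradient `r^{n+1} l⁻¹ / m` of `γ_n`, which commutes with `l`;
so the first row of `L` reduces to `[l, P₊]`.

*Independence of the gradient.* If `V` is infinite-dimensional, then the form determines an even
operator up to order less than `-2m` by its values on variations of `l`
(`ordLE_of_form_eq_zero`). Here an odd variable outside of any given finite-dimensional subspace of
`V` is needed. Operators of such low order have no effect on either side.
-/

open scoped TensorProduct ContDiff

noncomputable section

namespace SuperLax

variable {V : Type*} [AddCommGroup V] [Module ℂ V] {N : ℕ}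

/-! ### The Grassmann algebra and `Λ`-valued functions -/

theorem ι_mul_eq_involute_mul_ι (v : V) (x : Grassmann V) :
    ExteriorAlgebra.ι ℂ v * x = CliffordAlgebra.involute x * ExteriorAlgebra.ι ℂ v := by
  induction x using ExteriorAlgebra.induction with
  | algebraMap r => rw [AlgHom.commutes, Algebra.commutes]
  | ι w =>
    have h1 : (CliffordAlgebra.involute (ExteriorAlgebra.ι ℂ w) : Grassmann V)
        = -ExteriorAlgebra.ι ℂ w := CliffordAlgebra.involute_ι w
    rw [h1, neg_mul]
    exact eq_neg_of_add_eq_zero_left (ExteriorAlgebra.ι_add_mul_swap v w)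
  | mul a b ha hb => rw [← mul_assoc, ha, mul_assoc, hb, map_mul, mul_assoc]
  | add a b ha hb => rw [mul_add, ha, hb, map_add, add_mul]

/-- Supercommutativity without homogeneity: the even part of `v` commutes with everything, and the
odd part of `v` commutes up to the grade involution. -/
theorem grassmann_supercomm (u v : Grassmann V) :
    (2 : ℂ) • (u * v) = (v + CliffordAlgebra.involute v) * u
      + (v - CliffordAlgebra.involute v) * CliffordAlgebra.involute u := by
  induction v using ExteriorAlgebra.induction generalizing u with
  | algebraMap r =>
    rw [AlgHom.commutes, sub_self, zero_mul, add_zero, ← two_smul ℂ, smul_mul_assoc,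
      Algebra.commutes]
  | ι w =>
    have h1 : (CliffordAlgebra.involute (ExteriorAlgebra.ι ℂ w) : Grassmann V)
        = -ExteriorAlgebra.ι ℂ w := CliffordAlgebra.involute_ι w
    have h2 := ι_mul_eq_involute_mul_ι w (CliffordAlgebra.involute u)
    rw [CliffordAlgebra.involute_involute] at h2
    rw [h1, add_neg_cancel, zero_mul, zero_add, sub_neg_eq_add, ← two_smul ℂ, smul_mul_assoc, h2]
  | mul a b ha hb =>
    have h1 : (2 : ℂ) • ((2 : ℂ) • (u * (a * b)))
        = (a + CliffordAlgebra.involute a) * ((2 : ℂ) • (u * b))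
          + (a - CliffordAlgebra.involute a) * ((2 : ℂ) • (CliffordAlgebra.involute u * b)) := by
      rw [← mul_assoc, ← smul_mul_assoc, ha u, add_mul, smul_add, mul_assoc, mul_assoc,
        mul_smul_comm, mul_smul_comm]
    rw [hb, hb, CliffordAlgebra.involute_involute] at h1
    refine smul_right_injective _ (two_ne_zero (α := ℂ)) ?_
    refine h1.trans ?_
    simp only [two_smul, map_mul]
    noncomm_ring
  | add a b ha hb =>
    rw [mul_add, smul_add, ha, hb, map_add]
    noncomm_ring

/-- The function `f ⊗ x`. -/
def GrFun.tmul (f : CircleFun) (x : Grassmann V) : GrFun V :=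
  (f ⊗ₜ[ℂ] x : CircleFun ⊗[ℂ] Grassmann V)

theorem GrFun.induction {p : GrFun V → Prop} (h0 : p 0) (ht : ∀ f x, p (GrFun.tmul f x))
    (ha : ∀ a b, p a → p b → p (a + b)) (a : GrFun V) : p a :=
  TensorProduct.induction_on (motive := p) a h0 ht ha

theorem GrFun.tmul_mul_tmul (f g : CircleFun) (x y : Grassmann V) :
    GrFun.tmul f x * GrFun.tmul g y = GrFun.tmul (f * g) (x * y) :=
  Algebra.TensorProduct.tmul_mul_tmul f g x y

theorem grInvol_tmul (f : CircleFun) (x : Grassmann V) :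
    grInvol (GrFun.tmul f x) = GrFun.tmul f (CliffordAlgebra.involute x) :=
  Algebra.TensorProduct.map_tmul _ _ f x

theorem grDeriv_tmul (f : CircleFun) (x : Grassmann V) :
    grDeriv (GrFun.tmul f x) = GrFun.tmul (circleDeriv f) x :=
  LinearMap.rTensor_tmul _ _ x f

theorem grInt_tmul (f : CircleFun) (x : Grassmann V) :
    grInt (GrFun.tmul f x) = circleInt f • x := by
  refine (congrArg (TensorProduct.lid ℂ (Grassmann V))
    (LinearMap.rTensor_tmul (Grassmann V) circleInt x f)).trans ?_
  exact TensorProduct.lid_tmul _ _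

theorem GrFun.tmul_add (f : CircleFun) (x y : Grassmann V) :
    GrFun.tmul f (x + y) = GrFun.tmul f x + GrFun.tmul f y := TensorProduct.tmul_add f x y

theorem GrFun.add_tmul (f g : CircleFun) (x : Grassmann V) :
    GrFun.tmul (f + g) x = GrFun.tmul f x + GrFun.tmul g x := TensorProduct.add_tmul f g x

theorem GrFun.tmul_sub (f : CircleFun) (x y : Grassmann V) :
    GrFun.tmul f (x - y) = GrFun.tmul f x - GrFun.tmul f y := TensorProduct.tmul_sub f x y

theorem GrFun.tmul_smul (c : ℂ) (f : CircleFun) (x : Grassmann V) :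
    GrFun.tmul f (c • x) = c • GrFun.tmul f x := TensorProduct.tmul_smul c f x

theorem grInvol_grInvol (a : GrFun V) : grInvol (grInvol a) = a := by
  induction a using GrFun.induction with
  | h0 => rw [map_zero, map_zero]
  | ht f x => rw [grInvol_tmul, grInvol_tmul, CliffordAlgebra.involute_involute]
  | ha a b ha hb => rw [map_add, map_add, ha, hb]

theorem grInvol_grDeriv (a : GrFun V) : grInvol (grDeriv a) = grDeriv (grInvol a) := by
  induction a using GrFun.induction with
  | h0 => simp only [map_zero]
  | ht f x => rw [grInvol_tmul, grDeriv_tmul, grDeriv_tmul, grInvol_tmul]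
  | ha a b ha hb => simp only [map_add, ha, hb]

theorem circleDeriv_mul (f g : CircleFun) :
    circleDeriv (f * g) = circleDeriv f * g + f * circleDeriv g := by
  ext x
  exact deriv_mul ((contDiff_infty_iff_deriv.1 f.2.1).1 x) ((contDiff_infty_iff_deriv.1 g.2.1).1 x)

theorem grDeriv_mul (a b : GrFun V) : grDeriv (a * b) = grDeriv a * b + a * grDeriv b := by
  induction a using GrFun.induction with
  | h0 => simp only [map_zero, zero_mul, add_zero]
  | ht f x =>
    induction b using GrFun.induction with
    | h0 => simp only [map_zero, mul_zero, add_zero]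
    | ht g y =>
      simp only [grDeriv_tmul, GrFun.tmul_mul_tmul, circleDeriv_mul, GrFun.add_tmul]
    | ha a b ha hb =>
      simp only [map_add, mul_add, ha, hb]
      abel
  | ha a b ha hb =>
    simp only [map_add, add_mul, ha, hb]
    abel

theorem grFun_supercomm (u v : GrFun V) :
    (2 : ℂ) • (u * v) = (v + grInvol v) * u + (v - grInvol v) * grInvol u := by
  induction u using GrFun.induction with
  | h0 => simp only [map_zero, mul_zero, zero_mul, smul_zero, add_zero]
  | ht f x =>
    induction v using GrFun.induction with
    | h0 => simp only [map_zero, mul_zero, zero_mul, smul_zero, add_zero, sub_zero]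
    | ht g y =>
      simp only [grInvol_tmul, GrFun.tmul_mul_tmul, ← GrFun.tmul_add, ← GrFun.tmul_sub,
        ← GrFun.tmul_smul, grassmann_supercomm x y, mul_comm f g]
    | ha a b ha hb =>
      rw [mul_add, smul_add, ha, hb, map_add]
      noncomm_ring
  | ha a b ha hb =>
    rw [add_mul, smul_add, ha, hb, map_add]
    noncomm_ring

theorem GrFun.mul_comm_of_even {v : GrFun V} (hv : grInvol v = v) (u : GrFun V) :
    u * v = v * u := by
  have h := grFun_supercomm u v
  rw [hv, sub_self, zero_mul, add_zero, ← two_smul ℂ v, smul_mul_assoc] at h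
  exact smul_right_injective _ (two_ne_zero (α := ℂ)) h

theorem GrFun.mul_comm_of_odd {v : GrFun V} (hv : grInvol v = -v) (u : GrFun V) :
    u * v = v * grInvol u := by
  have h := grFun_supercomm u v
  rw [hv, add_neg_cancel, zero_mul, zero_add, sub_neg_eq_add, ← two_smul ℂ v,
    smul_mul_assoc] at h
  exact smul_right_injective _ (two_ne_zero (α := ℂ)) h

theorem circleInt_circleDeriv (f : CircleFun) : circleInt (circleDeriv f) = 0 := by
  have h : ∫ x in (0 : ℝ)..(2 * Real.pi), deriv f.1 x = f.1 (2 * Real.pi) - f.1 0 :=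
    intervalIntegral.integral_deriv_eq_sub
      (fun x _ => (contDiff_infty_iff_deriv.1 f.2.1).1 x)
      ((circleDeriv f).2.1.continuous.intervalIntegrable _ _)
  refine h.trans ?_
  have h2 := f.2.2 0
  rw [zero_add] at h2
  rw [h2, sub_self]

theorem grInt_grDeriv (a : GrFun V) : grInt (grDeriv a) = 0 := by
  induction a using GrFun.induction with
  | h0 => simp only [map_zero]
  | ht f x => rw [grDeriv_tmul, grInt_tmul, circleInt_circleDeriv, zero_smul]
  | ha a b ha hb => simp only [map_add, ha, hb, add_zero]

/-! ### Superfunctions -/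

/-- The algebra structure of superfunctions. -/
scoped instance : Algebra ℂ (SFun V) := Algebra.ofModule
  (fun c a b => by
    ext
    · exact smul_mul_assoc c a.c0 b.c0
    · simp only [SFun.mul_c1, SFun.smul_c0, SFun.smul_c1, smul_mul_assoc, map_smul, smul_add])
  (fun c a b => by
    ext
    · exact mul_smul_comm c a.c0 b.c0
    · simp only [SFun.mul_c1, SFun.smul_c0, SFun.smul_c1, mul_smul_comm, smul_add])

@[simp] theorem invol_c0 (a : SFun V) : (invol a).c0 = grInvol a.c0 := rfl
@[simp] theorem invol_c1 (a : SFun V) : (invol a).c1 = -grInvol a.c1 := rfl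
@[simp] theorem superD_c0 (a : SFun V) : (superD a).c0 = a.c1 := rfl
@[simp] theorem superD_c1 (a : SFun V) : (superD a).c1 = grDeriv a.c0 := rfl

@[simp] theorem invol_invol (a : SFun V) : invol (invol a) = a := by
  ext
  · exact grInvol_grInvol _
  · simp only [invol_c1, map_neg, neg_neg, grInvol_grInvol]

theorem invol_mul (a b : SFun V) : invol (a * b) = invol a * invol b := by
  ext
  · exact map_mul _ _ _
  · simp only [invol_c0, invol_c1, SFun.mul_c1, map_add, map_mul, mul_neg, neg_mul, neg_add]

@[simp] theorem invol_one : invol (1 : SFun V) = 1 := by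
  ext
  · exact map_one _
  · simp only [invol_c1, SFun.one_c1, map_zero, neg_zero]

theorem superD_invol (a : SFun V) : superD (invol a) = -invol (superD a) := by
  ext
  · rfl
  · simp only [superD_c1, invol_c0, invol_c1, SFun.neg_c1, neg_neg, grInvol_grDeriv]

/-- `D_θ` is an odd derivation. -/
theorem superD_mul (a b : SFun V) : superD (a * b) = superD a * b + invol a * superD b := by
  ext
  · rfl
  · simp only [superD_c0, superD_c1, invol_c0, invol_c1, SFun.add_c1, SFun.mul_c0, SFun.mul_c1,
      grDeriv_mul, neg_mul, grInvol_grInvol]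
    abel

@[simp] theorem superD_one : superD (1 : SFun V) = 0 := by
  have h := superD_mul (1 : SFun V) 1
  rw [invol_one, one_mul, mul_one, one_mul] at h
  exact left_eq_add.mp h

theorem berezin_superD (a : SFun V) : berezin (superD a) = 0 := grInt_grDeriv a.c0

theorem SFun.mul_comm_of_even {v : SFun V} (hv : invol v = v) (u : SFun V) : u * v = v * u := by
  have h0 : grInvol v.c0 = v.c0 := congrArg SFun.c0 hv
  have h1 : grInvol v.c1 = -v.c1 := neg_eq_iff_eq_neg.1 (congrArg SFun.c1 hv)
  ext
  · exact GrFun.mul_comm_of_even h0 _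
  · rw [SFun.mul_c1, SFun.mul_c1, h0, GrFun.mul_comm_of_even h0, GrFun.mul_comm_of_odd h1,
      grInvol_grInvol, add_comm]

theorem SFun.mul_comm_of_odd {v : SFun V} (hv : invol v = -v) (u : SFun V) :
    u * v = v * invol u := by
  have h0 : grInvol v.c0 = -v.c0 := congrArg SFun.c0 hv
  have h1 : grInvol v.c1 = v.c1 := neg_injective (congrArg SFun.c1 hv)
  ext
  · exact GrFun.mul_comm_of_odd h0 _
  · rw [SFun.mul_c1, SFun.mul_c1, h0, GrFun.mul_comm_of_odd h0, GrFun.mul_comm_of_even h1,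
      invol_c0, invol_c1, neg_mul_neg, add_comm]

/-! ### Signs and parities -/

/-- The sign `(-1)^k`. -/
def sgn (k : ℤ) : ℤ := if Even k then 1 else -1

theorem sgn_even {k : ℤ} (h : Even k) : sgn k = 1 := if_pos h
theorem sgn_odd {k : ℤ} (h : Odd k) : sgn k = -1 := if_neg (Int.not_even_iff_odd.2 h)

@[simp] theorem sgn_zero : sgn 0 = 1 := sgn_even Even.zero
@[simp] theorem sgn_one : sgn 1 = -1 := sgn_odd odd_one

theorem sgn_add (j k : ℤ) : sgn (j + k) = sgn j * sgn k := by
  unfold sgn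
  by_cases hj : Even j <;> by_cases hk : Even k <;> simp [Int.even_add, hj, hk]

@[simp] theorem sgn_mul_self (k : ℤ) : sgn k * sgn k = 1 := by
  unfold sgn
  split_ifs <;> norm_num

theorem sgn_smul_sgn_smul {M : Type*} [AddCommGroup M] (k : ℤ) (x : M) :
    sgn k • sgn k • x = x := by rw [smul_smul, sgn_mul_self, one_smul]

theorem hasParity_iff {k : ℤ} {a : SFun V} : HasParity k a ↔ invol a = sgn k • a := by
  unfold HasParity sgn
  split_ifs <;> simp

theorem hasParity_congr {j k : ℤ} (h : Even (j - k)) {a : SFun V} :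
    HasParity j a ↔ HasParity k a := by
  have : Even j ↔ Even k := Int.even_sub.1 h
  simp only [HasParity, this]

theorem HasParity.zero (k : ℤ) : HasParity k (0 : SFun V) := by
  rw [hasParity_iff, map_zero, smul_zero]

theorem HasParity.one : HasParity 0 (1 : SFun V) := by
  rw [hasParity_iff, invol_one, sgn_zero, one_smul]

theorem HasParity.add {k : ℤ} {a b : SFun V} (ha : HasParity k a) (hb : HasParity k b) :
    HasParity k (a + b) := by
  rw [hasParity_iff] at *
  rw [map_add, ha, hb, smul_add]

theorem HasParity.neg {k : ℤ} {a : SFun V} (ha : HasParity k a) : HasParity k (-a) := by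
  rw [hasParity_iff] at *
  rw [map_neg, ha, smul_neg]

theorem HasParity.sub {k : ℤ} {a b : SFun V} (ha : HasParity k a) (hb : HasParity k b) :
    HasParity k (a - b) := by
  rw [sub_eq_add_neg]
  exact ha.add hb.neg

theorem HasParity.smul {k : ℤ} {a : SFun V} (c : ℂ) (ha : HasParity k a) :
    HasParity k (c • a) := by
  rw [hasParity_iff] at *
  rw [map_smul, ha, smul_comm]

theorem HasParity.zsmul {k : ℤ} {a : SFun V} (c : ℤ) (ha : HasParity k a) :
    HasParity k (c • a) := by
  rw [hasParity_iff] at *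
  rw [map_zsmul, ha, smul_comm]

theorem HasParity.sum {ι : Type*} {k : ℤ} {s : Finset ι} {f : ι → SFun V}
    (h : ∀ i ∈ s, HasParity k (f i)) : HasParity k (∑ i ∈ s, f i) := by
  rw [hasParity_iff, map_sum, Finset.smul_sum]
  exact Finset.sum_congr rfl fun i hi => hasParity_iff.1 (h i hi)

theorem HasParity.mul {j k : ℤ} {a b : SFun V} (ha : HasParity j a) (hb : HasParity k b) :
    HasParity (j + k) (a * b) := by
  rw [hasParity_iff] at *
  rw [invol_mul, ha, hb, smul_mul_assoc, mul_smul_comm, smul_smul, sgn_add]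

theorem HasParity.superD {k : ℤ} {a : SFun V} (ha : HasParity k a) :
    HasParity (k + 1) (superD a) := by
  rw [hasParity_iff] at *
  rw [← neg_eq_iff_eq_neg.2 (superD_invol a), ha, map_zsmul, sgn_add, sgn_one, mul_neg_one,
    neg_smul]

theorem HasParity.superD_pow {k : ℤ} {a : SFun V} (ha : HasParity k a) (r : ℕ) :
    HasParity (k + r) ((SuperLax.superD ^ r) a) := by
  induction r with
  | zero => simpa using ha
  | succ r ih =>
    rw [pow_succ', Module.End.mul_apply]
    have := ih.superD
    rwa [add_assoc] at this

/-- Supercommutativity of superfunctions. -/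
theorem HasParity.mul_comm {j k : ℤ} {a b : SFun V} (ha : HasParity j a) (hb : HasParity k b) :
    a * b = sgn (j * k) • (b * a) := by
  rcases Int.even_or_odd k with hk | hk
  · have hb' : invol b = b := by rw [hasParity_iff.1 hb, sgn_even hk, one_smul]
    rw [sgn_even (hk.mul_left j), one_smul, SFun.mul_comm_of_even hb']
  · have hb' : invol b = -b := by rw [hasParity_iff.1 hb, sgn_odd hk, neg_one_smul]
    rw [SFun.mul_comm_of_odd hb', hasParity_iff.1 ha, mul_smul_comm]
    congr 1
    unfold sgn
    simp [Int.even_mul, Int.not_even_iff_odd.2 hk]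

theorem twist_of_even {k : ℤ} (h : Even k) (a : SFun V) : twist k a = a := by
  rw [twist, if_pos h]; rfl

theorem twist_of_odd {k : ℤ} (h : Odd k) (a : SFun V) : twist k a = invol a := by
  rw [twist, if_neg (Int.not_even_iff_odd.2 h)]

@[simp] theorem twist_zero (a : SFun V) : twist 0 a = a := twist_of_even Even.zero a

theorem twist_add_one (k : ℤ) (a : SFun V) : twist (k + 1) a = invol (twist k a) := by
  rcases Int.even_or_odd k with h | h
  · rw [twist_of_even h, twist_of_odd h.add_one]
  · rw [twist_of_odd h, twist_of_even h.add_one, invol_invol]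

theorem twist_mul (k : ℤ) (a b : SFun V) : twist k (a * b) = twist k a * twist k b := by
  rcases Int.even_or_odd k with h | h
  · simp only [twist_of_even h]
  · simp only [twist_of_odd h, invol_mul]

theorem invol_twist (k : ℤ) (a : SFun V) : invol (twist k a) = twist k (invol a) := by
  rcases Int.even_or_odd k with h | h
  · simp only [twist_of_even h]
  · simp only [twist_of_odd h]

theorem twist_twist (k : ℤ) (a : SFun V) : twist k (twist k a) = a := by
  rcases Int.even_or_odd k with h | h
  · simp only [twist_of_even h]
  · simp only [twist_of_odd h, invol_invol]

@[simp] theorem twist_one (k : ℤ) : twist k (1 : SFun V) = 1 := by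
  rcases Int.even_or_odd k with h | h
  · simp only [twist_of_even h]
  · simp only [twist_of_odd h, invol_one]

theorem HasParity.twist {j : ℤ} {a : SFun V} (ha : HasParity j a) (k : ℤ) :
    twist k a = sgn (k * j) • a := by
  rcases Int.even_or_odd k with h | h
  · rw [twist_of_even h, sgn_even (h.mul_right j), one_smul]
  · rw [twist_of_odd h, hasParity_iff.1 ha]
    congr 1
    unfold sgn
    simp [Int.even_mul, Int.not_even_iff_odd.2 h]

theorem invol_superD_pow (r : ℕ) (a : SFun V) :
    invol ((superD ^ r) a) = sgn r • (superD ^ r) (invol a) := by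
  induction r with
  | zero => simp
  | succ r ih =>
    rw [pow_succ', Module.End.mul_apply, Module.End.mul_apply,
      ← neg_eq_iff_eq_neg.2 (superD_invol ((superD ^ r) a)), ih, map_zsmul, Nat.cast_succ, sgn_add,
      sgn_one, mul_neg_one, neg_smul]

/-! ### Orders and coefficients of operators -/

@[ext]
theorem Op.ext {P Q : Op V} (h : ∀ k, P.coeff k = Q.coeff k) : P = Q :=
  Subtype.ext (funext h)

@[simp] theorem Op.coeff_add (P Q : Op V) (k : ℤ) : (P + Q).coeff k = P.coeff k + Q.coeff k := rfl
@[simp] theorem Op.coeff_sub (P Q : Op V) (k : ℤ) : (P - Q).coeff k = P.coeff k - Q.coeff k := rfl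
@[simp] theorem Op.coeff_neg (P : Op V) (k : ℤ) : (-P).coeff k = -P.coeff k := rfl
@[simp] theorem Op.coeff_smul (c : ℂ) (P : Op V) (k : ℤ) : (c • P).coeff k = c • P.coeff k := rfl

/-- The coefficient of `D_θ^k` as a linear map. -/
def Op.coeffL (k : ℤ) : Op V →ₗ[ℂ] SFun V where
  toFun P := P.coeff k
  map_add' _ _ := rfl
  map_smul' _ _ := rfl

@[simp] theorem Op.coeff_sum {ι : Type*} (s : Finset ι) (f : ι → Op V) (k : ℤ) :
    (∑ i ∈ s, f i).coeff k = ∑ i ∈ s, (f i).coeff k := map_sum (Op.coeffL k) f s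

theorem Op.coeff_mono (a : SFun V) (j k : ℤ) :
    (Op.mono a j).coeff k = if k = j then a else 0 := rfl

/-- `P` has order at most `J` in `D_θ`. -/
def OrdLE (P : Op V) (J : ℤ) : Prop := ∀ j, J < j → P.coeff j = 0

theorem Op.exists_ordLE (P : Op V) : ∃ J, OrdLE P J := P.2

theorem OrdLE.of_le {P : Op V} {J K : ℤ} (h : OrdLE P J) (hJK : J ≤ K) : OrdLE P K :=
  fun j hj => h j (lt_of_le_of_lt hJK hj)

theorem OrdLE.zero (J : ℤ) : OrdLE (0 : Op V) J := fun _ _ => rfl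

theorem OrdLE.add {P Q : Op V} {J : ℤ} (hP : OrdLE P J) (hQ : OrdLE Q J) : OrdLE (P + Q) J :=
  fun j hj => by rw [Op.coeff_add, hP j hj, hQ j hj, add_zero]

theorem OrdLE.sub {P Q : Op V} {J : ℤ} (hP : OrdLE P J) (hQ : OrdLE Q J) : OrdLE (P - Q) J :=
  fun j hj => by rw [Op.coeff_sub, hP j hj, hQ j hj, sub_zero]

theorem OrdLE.smul {P : Op V} {J : ℤ} (c : ℂ) (hP : OrdLE P J) : OrdLE (c • P) J :=
  fun j hj => by rw [Op.coeff_smul, hP j hj, smul_zero]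

theorem OrdLE.sum {ι : Type*} {s : Finset ι} {f : ι → Op V} {J : ℤ}
    (h : ∀ i ∈ s, OrdLE (f i) J) : OrdLE (∑ i ∈ s, f i) J :=
  fun j hj => by rw [Op.coeff_sum]; exact Finset.sum_eq_zero fun i hi => h i hi j hj

theorem OrdLE.mono (a : SFun V) (j : ℤ) : OrdLE (Op.mono a j) j :=
  fun k hk => by rw [Op.coeff_mono, if_neg (ne_of_gt hk)]

theorem Op.eq_zero_of_ordLE {P : Op V} (h : ∀ J, OrdLE P J) : P = 0 :=
  Op.ext fun k => h (k - 1) k (by omega)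

/-! ### Left multiplication by powers of the superderivative -/

theorem superChoose_zero (i : ℤ) : superChoose i 0 = 1 := by
  simp [superChoose]

theorem superChoose_zero_succ (r : ℕ) : superChoose 0 (r + 1) = 0 := by
  unfold superChoose
  split_ifs with h
  · rfl
  · have h1 : ¬ Odd (r + 1) := fun h' => h ⟨Even.zero, h'⟩
    rw [Nat.not_odd_iff_even] at h1
    obtain ⟨q, hq⟩ := h1
    have h2 : (r + 1) / 2 = (q - 1) + 1 := by omega
    rw [h2]
    exact Ring.choose_zero_succ ℤ _

/-- The Pascal rule for super-binomial coefficients. -/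
theorem superChoose_succ_succ (i : ℤ) (r : ℕ) :
    superChoose (i + 1) (r + 1) = superChoose i r + sgn (r + 1) * superChoose i (r + 1) := by
  unfold superChoose
  rcases Int.even_or_odd' i with ⟨s, rfl | rfl⟩ <;> rcases Nat.even_or_odd' r with ⟨q, rfl | rfl⟩
  · have h1 : (2 * s + 1) / 2 = s := by omega
    have h2 : 2 * s / 2 = s := by omega
    have h3 : (2 * q + 1) / 2 = q := by omega
    have h4 : 2 * q / 2 = q := by omega
    have h5 : ¬ Odd (2 * s) := Int.not_odd_iff_even.2 (even_two_mul s)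
    have h6 : ¬ Odd (2 * q) := Nat.not_odd_iff_even.2 (even_two_mul q)
    rw [h1, h2, h3, h4]
    simp [parity_simps, h5, h6]
  · have h1 : (2 * s + 1) / 2 = s := by omega
    have h2 : 2 * s / 2 = s := by omega
    have h3 : (2 * q + 1) / 2 = q := by omega
    have h4 : (2 * q + 1 + 1) / 2 = q + 1 := by omega
    have h5 : sgn (((2 * q + 1 : ℕ) : ℤ) + 1) = 1 := sgn_even ⟨q + 1, by push_cast; ring⟩
    rw [h1, h2, h3, h4, h5]
    simp [parity_simps]
  · have h1 : (2 * s + 1 + 1) / 2 = s + 1 := by omega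
    have h2 : (2 * s + 1) / 2 = s := by omega
    have h3 : (2 * q + 1) / 2 = q := by omega
    have h4 : 2 * q / 2 = q := by omega
    have h5 : sgn (((2 * q : ℕ) : ℤ) + 1) = -1 := sgn_odd ⟨q, by push_cast; ring⟩
    have h6 : ¬ Odd (2 * s) := Int.not_odd_iff_even.2 (even_two_mul s)
    have h7 : ¬ Odd (2 * q) := Nat.not_odd_iff_even.2 (even_two_mul q)
    rw [h1, h2, h3, h4, h5]
    simp [parity_simps, h6, h7]
  · have h1 : (2 * s + 1 + 1) / 2 = s + 1 := by omega
    have h2 : (2 * s + 1) / 2 = s := by omega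
    have h3 : (2 * q + 1) / 2 = q := by omega
    have h4 : (2 * q + 1 + 1) / 2 = q + 1 := by omega
    have h5 : sgn (((2 * q + 1 : ℕ) : ℤ) + 1) = 1 := sgn_even ⟨q + 1, by push_cast; ring⟩
    rw [h1, h2, h3, h4, h5]
    simp [parity_simps, Ring.choose_succ_succ]

/-- The operator `D_θ^i ∘ b`. -/
def leftPow (i : ℤ) (b : Op V) : Op V :=
  ⟨fun k => ∑ᶠ r : ℕ, superChoose i r • (superD ^ r) (twist (i - r) (b.coeff (k - i + r))), by
    obtain ⟨J, hJ⟩ := b.exists_ordLE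
    refine ⟨J + i, fun k hk => ?_⟩
    have h : ∀ r : ℕ, superChoose i r • (superD ^ r) (twist (i - r) (b.coeff (k - i + r))) = 0 :=
      fun r => by rw [hJ _ (by omega), map_zero, map_zero, smul_zero]
    simp only [h, finsum_zero]⟩

theorem leftPow_coeff {b : Op V} {J : ℤ} (hb : OrdLE b J) {i k : ℤ} {n : ℕ} (hn : J + i - k < n) :
    (leftPow i b).coeff k =
      ∑ r ∈ Finset.range n, superChoose i r • (superD ^ r) (twist (i - r) (b.coeff (k - i + r))) := by
  refine finsum_eq_sum_of_support_subset _ fun r hr => ?_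
  rw [Finset.coe_range, Set.mem_Iio]
  by_contra hrn
  refine hr ?_
  change superChoose i r • (superD ^ r) (twist (i - r) (b.coeff (k - i + r))) = 0
  rw [hb _ (by omega), map_zero, map_zero, smul_zero]

theorem OrdLE.leftPow {b : Op V} {J : ℤ} (hb : OrdLE b J) (i : ℤ) : OrdLE (leftPow i b) (J + i) :=
  fun k hk => by
    rw [leftPow_coeff hb (n := 0) (by push_cast; omega), Finset.sum_range_zero]

/-- The top coefficient of `D_θ^i ∘ b`. -/
theorem leftPow_coeff_top {b : Op V} {J : ℤ} (hb : OrdLE b J) (i : ℤ) :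
    (leftPow i b).coeff (J + i) = twist i (b.coeff J) := by
  rw [leftPow_coeff hb (n := 1) (by push_cast; omega), Finset.sum_range_one, superChoose_zero]
  simp

theorem leftPow_zero (b : Op V) : leftPow 0 b = b := by
  obtain ⟨J, hJ⟩ := b.exists_ordLE
  ext1 k
  rw [leftPow_coeff hJ (n := (J - k).toNat + 1) (by omega), Finset.sum_range_succ']
  simp [superChoose_zero_succ, superChoose_zero]

theorem leftPow_add (i : ℤ) (a b : Op V) : leftPow i (a + b) = leftPow i a + leftPow i b := by
  obtain ⟨J, hJ⟩ := a.exists_ordLE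
  obtain ⟨K, hK⟩ := b.exists_ordLE
  have hJ' := hJ.of_le (le_max_left J K)
  have hK' := hK.of_le (le_max_right J K)
  ext1 k
  have hn : max J K + i - k < ((max J K + i - k).toNat + 1 : ℕ) := by omega
  rw [Op.coeff_add, leftPow_coeff hJ' hn, leftPow_coeff hK' hn, leftPow_coeff (hJ'.add hK') hn,
    ← Finset.sum_add_distrib]
  simp only [Op.coeff_add, map_add, smul_add]

theorem leftPow_smul (i : ℤ) (c : ℂ) (a : Op V) : leftPow i (c • a) = c • leftPow i a := by
  obtain ⟨J, hJ⟩ := a.exists_ordLE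
  ext1 k
  have hn : J + i - k < ((J + i - k).toNat + 1 : ℕ) := by omega
  rw [Op.coeff_smul, leftPow_coeff hJ hn, leftPow_coeff (hJ.smul c) hn, Finset.smul_sum]
  simp only [Op.coeff_smul, map_smul, smul_comm c]

/-- The operator `D_θ ∘ b`: `D_θ ∘ (b_k D_θ^k) = (D_θ b_k) D_θ^k + ι(b_k) D_θ^{k+1}`. -/
def leftD (b : Op V) : Op V :=
  ⟨fun k => superD (b.coeff k) + invol (b.coeff (k - 1)), by
    obtain ⟨J, hJ⟩ := b.exists_ordLE
    refine ⟨J + 1, fun k hk => ?_⟩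
    change superD (b.coeff k) + invol (b.coeff (k - 1)) = 0
    rw [hJ _ (by omega), hJ _ (by omega), map_zero, map_zero, add_zero]⟩

theorem leftD_coeff (b : Op V) (k : ℤ) :
    (leftD b).coeff k = superD (b.coeff k) + invol (b.coeff (k - 1)) := rfl

theorem leftD_leftPow (i : ℤ) (b : Op V) : leftD (leftPow i b) = leftPow (i + 1) b := by
  obtain ⟨J, hJ⟩ := b.exists_ordLE
  ext1 k
  obtain ⟨n, hn⟩ : ∃ n : ℕ, J + i - k < n := ⟨(J + i - k).toNat + 1, by omega⟩
  rw [leftD_coeff, leftPow_coeff hJ (n := n) (by omega), leftPow_coeff hJ (n := n + 1) (by omega),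
    leftPow_coeff hJ (n := n + 1) (by omega), Finset.sum_range_succ', Finset.sum_range_succ',
    map_sum, map_add, map_sum, ← add_assoc, ← Finset.sum_add_distrib]
  congr 1
  · refine Finset.sum_congr rfl fun r _ => ?_
    have e1 : i + 1 - ((r + 1 : ℕ) : ℤ) = i - r := by push_cast; ring
    have e2 : k - (i + 1) + ((r + 1 : ℕ) : ℤ) = k - i + r := by push_cast; ring
    have e3 : k - 1 - i + ((r + 1 : ℕ) : ℤ) = k - i + r := by push_cast; ring
    have e4 : i - r = (i - ((r + 1 : ℕ) : ℤ)) + 1 := by push_cast; ring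
    rw [e1, e2, e3, map_zsmul, map_zsmul, invol_superD_pow, ← twist_add_one, ← e4,
      superChoose_succ_succ, add_smul, smul_smul, pow_succ', Module.End.mul_apply, Nat.cast_succ,
      mul_comm (sgn _)]
  · have e1 : k - 1 - i = k - (i + 1) := by ring
    simp only [superChoose_zero, pow_zero, Module.End.one_apply, one_smul, Nat.cast_zero, sub_zero,
      add_zero, twist_add_one, e1]

theorem leftPow_one (b : Op V) : leftPow 1 b = leftD b := by
  rw [← zero_add (1 : ℤ), ← leftD_leftPow, leftPow_zero]

theorem leftD_injective : Function.Injective (leftD : Op V → Op V) := by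
  intro a b hab
  obtain ⟨J, hJ⟩ := a.exists_ordLE
  obtain ⟨K, hK⟩ := b.exists_ordLE
  have key : ∀ n : ℕ, ∀ k, max J K - n < k → a.coeff k = b.coeff k := by
    intro n
    induction n with
    | zero =>
      intro k hk
      rw [hJ k (by omega), hK k (by omega)]
    | succ n ih =>
      intro k hk
      have h := congrArg (fun P => Op.coeff P (k + 1)) hab
      simp only [leftD_coeff, add_sub_cancel_right] at h
      rw [ih (k + 1) (by push_cast at hk; omega)] at h
      simpa using congrArg invol (add_left_cancel h)
  exact Op.ext fun k => key ((max J K - k).toNat + 1) k (by omega)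

/-! ### Associativity of the product -/

theorem comp_coeff {a b : Op V} {I J : ℤ} (ha : OrdLE a I) (hb : OrdLE b J) {k lo hi : ℤ}
    (hlo : lo ≤ k - J) (hhi : I ≤ hi) :
    (a.comp b).coeff k = ∑ i ∈ Finset.Icc lo hi, a.coeff i * (leftPow i b).coeff k := by
  set n : ℕ := (J + hi - k).toNat + 1 with hn
  have h1 : (a.comp b).coeff k = ∑ p ∈ Finset.Icc lo hi ×ˢ Finset.range n, superChoose p.1 p.2 •
      (a.coeff p.1 * (superD ^ p.2) (twist (p.1 - p.2) (b.coeff (k - p.1 + p.2)))) := by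
    refine finsum_eq_sum_of_support_subset _ fun p hp => ?_
    rw [Finset.mem_coe, Finset.mem_product, Finset.mem_Icc, Finset.mem_range]
    by_contra h
    refine hp ?_
    change superChoose p.1 p.2 •
      (a.coeff p.1 * (superD ^ p.2) (twist (p.1 - p.2) (b.coeff (k - p.1 + p.2)))) = 0
    rcases lt_or_ge I p.1 with h1 | h1
    · rw [ha _ h1, zero_mul, smul_zero]
    · rw [hb _ (by omega), map_zero, map_zero, mul_zero, smul_zero]
  rw [h1, Finset.sum_product]
  refine Finset.sum_congr rfl fun i hi => ?_
  rw [Finset.mem_Icc] at hi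
  rw [leftPow_coeff hb (n := n) (by omega), Finset.mul_sum]
  exact Finset.sum_congr rfl fun r _ => (mul_smul_comm _ _ _).symm

theorem OrdLE.comp {a b : Op V} {I J : ℤ} (ha : OrdLE a I) (hb : OrdLE b J) :
    OrdLE (a.comp b) (I + J) := fun k hk => by
  rw [comp_coeff ha hb (le_refl _) (le_refl _), Finset.Icc_eq_empty (by omega), Finset.sum_empty]

theorem coeff_comp_top {a b : Op V} {I J : ℤ} (ha : OrdLE a I) (hb : OrdLE b J) :
    (a.comp b).coeff (I + J) = a.coeff I * twist I (b.coeff J) := by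
  rw [comp_coeff ha hb (le_refl _) (le_refl _), show I + J - J = I by ring, Finset.Icc_self,
    Finset.sum_singleton, add_comm, leftPow_coeff_top hb]

theorem mono_comp_coeff (a : SFun V) (i : ℤ) (b : Op V) (k : ℤ) :
    ((Op.mono a i).comp b).coeff k = a * (leftPow i b).coeff k := by
  obtain ⟨J, hJ⟩ := b.exists_ordLE
  rw [comp_coeff (OrdLE.mono a i) hJ (lo := min i (k - J)) (hi := i) (min_le_right _ _) le_rfl,
    Finset.sum_eq_single i]
  · rw [Op.coeff_mono, if_pos rfl]
  · intro j _ hj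
    rw [Op.coeff_mono, if_neg hj, zero_mul]
  · intro h
    exact absurd (Finset.mem_Icc.2 ⟨min_le_left _ _, le_rfl⟩) h

theorem mono_one_comp (i : ℤ) (b : Op V) : (Op.mono 1 i).comp b = leftPow i b :=
  Op.ext fun k => by rw [mono_comp_coeff, one_mul]

theorem superD_pow_one {r : ℕ} (hr : r ≠ 0) : (superD ^ r) (1 : SFun V) = 0 := by
  obtain ⟨s, rfl⟩ := Nat.exists_eq_succ_of_ne_zero hr
  rw [pow_succ, Module.End.mul_apply, superD_one, map_zero]

theorem leftPow_mono_one (i j : ℤ) : leftPow i (Op.mono (1 : SFun V) j) = Op.mono 1 (i + j) := by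
  ext1 k
  refine (finsum_eq_single _ 0 fun r hr => ?_).trans ?_
  · rw [Op.coeff_mono]
    split_ifs
    · rw [twist_one, superD_pow_one hr, smul_zero]
    · rw [map_zero, map_zero, smul_zero]
  · rw [superChoose_zero, Op.coeff_mono, Op.coeff_mono]
    by_cases h : k = i + j
    · rw [if_pos (by rw [h]; push_cast; ring), if_pos h]
      simp
    · rw [if_neg (by push_cast; omega), if_neg h]
      simp

theorem comp_mono_one_coeff (a : Op V) (j k : ℤ) :
    (a.comp (Op.mono 1 j)).coeff k = a.coeff (k - j) := by
  obtain ⟨I, hI⟩ := a.exists_ordLE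
  rw [comp_coeff hI (OrdLE.mono 1 j) (lo := k - j) (hi := max I (k - j)) le_rfl (le_max_left _ _),
    Finset.sum_eq_single (k - j)]
  · rw [leftPow_mono_one, Op.coeff_mono, if_pos (by ring), mul_one]
  · intro i _ hi
    rw [leftPow_mono_one, Op.coeff_mono, if_neg (by omega), mul_zero]
  · intro h
    exact absurd (Finset.mem_Icc.2 ⟨le_rfl, le_max_right _ _⟩) h

theorem leftD_comp (a b : Op V) : (leftD a).comp b = leftD (a.comp b) := by
  obtain ⟨I, hI⟩ := a.exists_ordLE
  obtain ⟨J, hJ⟩ := b.exists_ordLE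
  have hDa : OrdLE (leftD a) (I + 1) := by
    rw [← leftPow_one]
    exact hI.leftPow 1
  ext1 k
  rw [leftD_coeff, comp_coeff hI hJ (lo := k - J - 1) (hi := I + 1) (by omega) (by omega),
    comp_coeff hI hJ (k := k - 1) (lo := k - J - 1) (hi := I) (by omega) (by omega),
    comp_coeff hDa hJ (lo := k - J - 1) (hi := I + 1) (by omega) le_rfl]
  -- the terms `ι(a_{i-1}) (D^i b)_k` and `ι(a_i) (D^{i+1} b)_k` agree after a shift of `i`
  have shift : ∑ i ∈ Finset.Icc (k - J - 1) (I + 1), invol (a.coeff (i - 1)) * (leftPow i b).coeff k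
      = ∑ i ∈ Finset.Icc (k - J - 1) (I + 1), invol (a.coeff i) * (leftPow (i + 1) b).coeff k := by
    have h1 : ∑ i ∈ Finset.Icc (k - J - 1) I, invol (a.coeff i) * (leftPow (i + 1) b).coeff k
        = ∑ i ∈ Finset.Icc (k - J) (I + 1), invol (a.coeff (i - 1)) * (leftPow i b).coeff k := by
      refine Finset.sum_nbij' (fun i => i + 1) (fun i => i - 1) ?_ ?_ ?_ ?_ ?_
      · intro i hi
        simp only [Finset.mem_Icc] at hi ⊢
        omega
      · intro i hi
        simp only [Finset.mem_Icc] at hi ⊢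
        omega
      · intro i _
        ring
      · intro i _
        ring
      · intro i _
        rw [add_sub_cancel_right]
    have h2 : ∑ i ∈ Finset.Icc (k - J - 1) I, invol (a.coeff i) * (leftPow (i + 1) b).coeff k
        = ∑ i ∈ Finset.Icc (k - J - 1) (I + 1), invol (a.coeff i) * (leftPow (i + 1) b).coeff k := by
      refine Finset.sum_subset (Finset.Icc_subset_Icc le_rfl (by omega)) fun i _ hi => ?_
      rw [Finset.mem_Icc] at hi
      by_cases h : I < i
      · rw [hI i h, map_zero, zero_mul]
      · rw [hJ.leftPow (i + 1) k (by omega), mul_zero]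
    have h3 : ∑ i ∈ Finset.Icc (k - J) (I + 1), invol (a.coeff (i - 1)) * (leftPow i b).coeff k
        = ∑ i ∈ Finset.Icc (k - J - 1) (I + 1),
          invol (a.coeff (i - 1)) * (leftPow i b).coeff k := by
      refine Finset.sum_subset (Finset.Icc_subset_Icc (by omega) le_rfl) fun i h' hi => ?_
      rw [Finset.mem_Icc] at hi h'
      rw [hJ.leftPow i k (by omega), mul_zero]
    rw [← h3, ← h1, h2]
  have last : ∑ i ∈ Finset.Icc (k - J - 1) I, a.coeff i * (leftPow i b).coeff (k - 1)
      = ∑ i ∈ Finset.Icc (k - J - 1) (I + 1), a.coeff i * (leftPow i b).coeff (k - 1) := by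
    refine Finset.sum_subset (Finset.Icc_subset_Icc le_rfl (by omega)) fun i h' hi => ?_
    rw [Finset.mem_Icc] at hi h'
    rw [hI i (by omega), zero_mul]
  rw [last]
  simp only [leftD_coeff, add_mul, Finset.sum_add_distrib, shift]
  simp only [← leftD_leftPow, leftD_coeff, map_sum, superD_mul, invol_mul, mul_add,
    Finset.sum_add_distrib]
  abel

theorem leftPow_comp (i : ℤ) (a b : Op V) : (leftPow i a).comp b = leftPow i (a.comp b) := by
  induction i using Int.induction_on with
  | zero => rw [leftPow_zero, leftPow_zero]
  | succ i ih => rw [← leftD_leftPow, ← leftD_leftPow, leftD_comp, ih]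
  | pred i ih =>
    apply leftD_injective
    rw [← leftD_comp, leftD_leftPow, leftD_leftPow, sub_add_cancel, ih]

theorem comp_assoc (a b c : Op V) : (a.comp b).comp c = a.comp (b.comp c) := by
  obtain ⟨I, hI⟩ := a.exists_ordLE
  obtain ⟨J, hJ⟩ := b.exists_ordLE
  obtain ⟨K, hK⟩ := c.exists_ordLE
  ext1 k
  rw [comp_coeff (hI.comp hJ) hK (lo := k - K) (hi := I + J) le_rfl le_rfl,
    comp_coeff hI (hJ.comp hK) (lo := k - K - J) (hi := I) (by omega) le_rfl]
  have h1 : ∀ p ∈ Finset.Icc (k - K) (I + J), (a.comp b).coeff p * (leftPow p c).coeff k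
      = ∑ i ∈ Finset.Icc (k - K - J) I,
        a.coeff i * ((leftPow i b).coeff p * (leftPow p c).coeff k) := by
    intro p hp
    rw [Finset.mem_Icc] at hp
    rw [comp_coeff hI hJ (lo := k - K - J) (hi := I) (by omega) le_rfl, Finset.sum_mul]
    simp only [mul_assoc]
  have h2 : ∀ i ∈ Finset.Icc (k - K - J) I, a.coeff i * (leftPow i (b.comp c)).coeff k
      = ∑ p ∈ Finset.Icc (k - K) (I + J),
        a.coeff i * ((leftPow i b).coeff p * (leftPow p c).coeff k) := by
    intro i hi
    rw [Finset.mem_Icc] at hi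
    rw [← leftPow_comp, comp_coeff (hJ.leftPow i) hK (lo := k - K) (hi := I + J) le_rfl (by omega),
      Finset.mul_sum]
  rw [Finset.sum_congr rfl h1, Finset.sum_congr rfl h2, Finset.sum_comm]

theorem add_comp (a b c : Op V) : (a + b).comp c = a.comp c + b.comp c := by
  obtain ⟨I, hI⟩ := a.exists_ordLE
  obtain ⟨J, hJ⟩ := b.exists_ordLE
  obtain ⟨K, hK⟩ := c.exists_ordLE
  have hI' := hI.of_le (le_max_left I J)
  have hJ' := hJ.of_le (le_max_right I J)
  ext1 k
  rw [Op.coeff_add, comp_coeff hI' hK le_rfl le_rfl, comp_coeff hJ' hK le_rfl le_rfl,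
    comp_coeff (hI'.add hJ') hK le_rfl le_rfl, ← Finset.sum_add_distrib]
  simp only [Op.coeff_add, add_mul]

theorem comp_add (a b c : Op V) : a.comp (b + c) = a.comp b + a.comp c := by
  obtain ⟨I, hI⟩ := a.exists_ordLE
  obtain ⟨J, hJ⟩ := b.exists_ordLE
  obtain ⟨K, hK⟩ := c.exists_ordLE
  have hJ' := hJ.of_le (le_max_left J K)
  have hK' := hK.of_le (le_max_right J K)
  ext1 k
  rw [Op.coeff_add, comp_coeff hI hJ' le_rfl le_rfl, comp_coeff hI hK' le_rfl le_rfl,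
    comp_coeff hI (hJ'.add hK') le_rfl le_rfl, ← Finset.sum_add_distrib]
  simp only [leftPow_add, Op.coeff_add, mul_add]

theorem smul_comp (z : ℂ) (a b : Op V) : (z • a).comp b = z • a.comp b := by
  obtain ⟨I, hI⟩ := a.exists_ordLE
  obtain ⟨J, hJ⟩ := b.exists_ordLE
  ext1 k
  rw [Op.coeff_smul, comp_coeff hI hJ le_rfl le_rfl, comp_coeff (hI.smul z) hJ le_rfl le_rfl,
    Finset.smul_sum]
  simp only [Op.coeff_smul, smul_mul_assoc]

theorem comp_smul (z : ℂ) (a b : Op V) : a.comp (z • b) = z • a.comp b := by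
  obtain ⟨I, hI⟩ := a.exists_ordLE
  obtain ⟨J, hJ⟩ := b.exists_ordLE
  ext1 k
  rw [Op.coeff_smul, comp_coeff hI hJ le_rfl le_rfl, comp_coeff hI (hJ.smul z) le_rfl le_rfl,
    Finset.smul_sum]
  simp only [leftPow_smul, Op.coeff_smul, mul_smul_comm]

theorem zero_comp (a : Op V) : (0 : Op V).comp a = 0 := by
  have h := smul_comp 0 (0 : Op V) a
  rwa [zero_smul, zero_smul] at h

theorem comp_zero (a : Op V) : a.comp (0 : Op V) = 0 := by
  have h := comp_smul 0 a (0 : Op V)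
  rwa [zero_smul, zero_smul] at h

/-- Super-integro-differential operators form a ring under `∘`. -/
scoped instance : Ring (Op V) :=
  { (inferInstance : AddCommGroup (Op V)) with
    mul := Op.comp
    one := Op.mono 1 0
    mul_assoc := comp_assoc
    one_mul := fun a => (mono_one_comp 0 a).trans (leftPow_zero a)
    mul_one := fun a => Op.ext fun k => (comp_mono_one_coeff a 0 k).trans (by rw [sub_zero])
    left_distrib := comp_add
    right_distrib := add_comp
    zero_mul := zero_comp
    mul_zero := comp_zero }

scoped instance : Algebra ℂ (Op V) := Algebra.ofModule smul_comp comp_smul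

theorem Op.comp_eq_mul (a b : Op V) : a.comp b = a * b := rfl

theorem Op.one_def : (1 : Op V) = Op.mono 1 0 := rfl

theorem Op.pow_eq_npow (P : Op V) (n : ℕ) : P.pow n = P ^ n := by
  induction n with
  | zero => exact (pow_zero P).symm
  | succ n ih => rw [pow_succ, ← ih]; rfl

theorem comm_eq (a b : Op V) : comm a b = a * b - b * a := rfl

theorem form_eq (a b : Op V) : form a b = trace (a * b) := rfl

theorem OrdLE.mul {a b : Op V} {I J : ℤ} (ha : OrdLE a I) (hb : OrdLE b J) :
    OrdLE (a * b) (I + J) := ha.comp hb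

/-! ### Homogeneous operators -/

/-- `P` is homogeneous of parity `p`, where `D_θ` is odd. -/
def Op.HasParity (p : ℤ) (P : Op V) : Prop := ∀ j, SuperLax.HasParity (j + p) (P.coeff j)

theorem Op.isEven_iff {P : Op V} : P.IsEven ↔ P.HasParity 0 := by
  simp only [Op.IsEven, Op.HasParity, add_zero]

theorem Op.HasParity.congr {p q : ℤ} {P : Op V} (h : P.HasParity p) (hpq : Even (p - q)) :
    P.HasParity q := fun j =>
  (hasParity_congr (by rwa [add_sub_add_left_eq_sub])).1 (h j)

theorem Op.HasParity.mono {k : ℤ} {a : SFun V} (ha : SuperLax.HasParity k a) (j : ℤ) :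
    (Op.mono a j).HasParity (k - j) := fun i => by
  rw [Op.coeff_mono]
  split_ifs with h
  · rw [h, add_sub_cancel]
    exact ha
  · exact HasParity.zero _

theorem Op.HasParity.leftPow {p : ℤ} {b : Op V} (hb : b.HasParity p) (i : ℤ) :
    (leftPow i b).HasParity (p + i) := fun k => by
  obtain ⟨J, hJ⟩ := b.exists_ordLE
  rw [leftPow_coeff hJ (n := (J + i - k).toNat + 1) (by omega)]
  refine HasParity.sum fun r _ => HasParity.zsmul _ ?_
  have h := hb (k - i + r)
  rw [h.twist]
  refine (hasParity_congr ?_).1 ((h.zsmul _).superD_pow r)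
  exact ⟨r - i, by ring⟩

theorem Op.HasParity.mul {p q : ℤ} {a b : Op V} (ha : a.HasParity p) (hb : b.HasParity q) :
    (a * b).HasParity (p + q) := fun k => by
  obtain ⟨I, hI⟩ := a.exists_ordLE
  obtain ⟨J, hJ⟩ := b.exists_ordLE
  rw [← Op.comp_eq_mul, comp_coeff hI hJ le_rfl le_rfl]
  refine HasParity.sum fun i _ => ?_
  refine (hasParity_congr ?_).1 ((ha i).mul (hb.leftPow i k))
  exact ⟨i, by ring⟩

theorem Op.IsEven.mul {a b : Op V} (ha : a.IsEven) (hb : b.IsEven) : (a * b).IsEven := by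
  rw [Op.isEven_iff] at *
  simpa using ha.mul hb

theorem Op.IsEven.add {a b : Op V} (ha : a.IsEven) (hb : b.IsEven) : (a + b).IsEven :=
  fun j => (ha j).add (hb j)

theorem Op.IsEven.sub {a b : Op V} (ha : a.IsEven) (hb : b.IsEven) : (a - b).IsEven :=
  fun j => (ha j).sub (hb j)

theorem Op.IsEven.neg {a : Op V} (ha : a.IsEven) : (-a).IsEven := fun j => (ha j).neg

theorem Op.IsEven.smul {a : Op V} (c : ℂ) (ha : a.IsEven) : (c • a).IsEven :=
  fun j => (ha j).smul c

theorem Op.IsEven.zero : (0 : Op V).IsEven := fun _ => HasParity.zero _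

theorem Op.IsEven.one : (1 : Op V).IsEven :=
  Op.isEven_iff.2 (Op.HasParity.mono HasParity.one 0)

theorem Op.IsEven.sum {ι : Type*} {s : Finset ι} {f : ι → Op V} (h : ∀ i ∈ s, (f i).IsEven) :
    (∑ i ∈ s, f i).IsEven := fun j => by
  rw [Op.coeff_sum]
  exact HasParity.sum fun i hi => h i hi j

theorem Op.IsEven.pow {a : Op V} (ha : a.IsEven) (n : ℕ) : (a ^ n).IsEven := by
  induction n with
  | zero => exact Op.IsEven.one
  | succ n ih => rw [pow_succ]; exact ih.mul ha

theorem Op.IsEven.comm {a b : Op V} (ha : a.IsEven) (hb : b.IsEven) : (comm a b).IsEven :=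
  (ha.mul hb).sub (hb.mul ha)

/-! ### Differential operators and the projections -/

/-- `P` is a differential operator. -/
def Op.IsDiff (P : Op V) : Prop := ∀ j < 0, P.coeff j = 0

theorem Op.plus_coeff (P : Op V) (j : ℤ) : P.plus.coeff j = if 0 ≤ j then P.coeff j else 0 := rfl

theorem Op.isDiff_plus (P : Op V) : P.plus.IsDiff := fun j hj => by
  rw [Op.plus_coeff, if_neg (not_le.2 hj)]

theorem Op.IsDiff.plus_eq {P : Op V} (h : P.IsDiff) : P.plus = P := by
  ext1 j
  rw [Op.plus_coeff]
  split_ifs with hj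
  · rfl
  · exact (h j (not_le.1 hj)).symm

theorem Op.plus_eq_zero {P : Op V} (h : OrdLE P (-1)) : P.plus = 0 := by
  ext1 j
  rw [Op.plus_coeff]
  split_ifs with hj
  · exact h j (by omega)
  · rfl

theorem Op.plus_add (P Q : Op V) : (P + Q).plus = P.plus + Q.plus := by
  ext1 j
  simp only [Op.plus_coeff, Op.coeff_add]
  split_ifs <;> simp

theorem Op.plus_neg (P : Op V) : (-P).plus = -P.plus := by
  ext1 j
  simp only [Op.plus_coeff, Op.coeff_neg]
  split_ifs <;> simp

theorem Op.plus_sub (P Q : Op V) : (P - Q).plus = P.plus - Q.plus := by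
  rw [sub_eq_add_neg, Op.plus_add, Op.plus_neg, ← sub_eq_add_neg]

theorem Op.plus_smul (c : ℂ) (P : Op V) : (c • P).plus = c • P.plus := by
  ext1 j
  simp only [Op.plus_coeff, Op.coeff_smul]
  split_ifs <;> simp

/-- The projection `P₋` onto operators of negative order. -/
def Op.minus (P : Op V) : Op V := P - P.plus

theorem Op.minus_add_plus (P : Op V) : P.minus + P.plus = P := sub_add_cancel _ _

theorem Op.plus_add_minus (P : Op V) : P.plus + P.minus = P := add_sub_cancel _ _

theorem Op.ordLE_minus (P : Op V) : OrdLE P.minus (-1) := fun j hj => by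
  rw [Op.minus, Op.coeff_sub, Op.plus_coeff, if_pos (by omega), sub_self]

theorem Op.IsDiff.add {P Q : Op V} (hP : P.IsDiff) (hQ : Q.IsDiff) : (P + Q).IsDiff :=
  fun j hj => by rw [Op.coeff_add, hP j hj, hQ j hj, add_zero]

theorem Op.IsDiff.sub {P Q : Op V} (hP : P.IsDiff) (hQ : Q.IsDiff) : (P - Q).IsDiff :=
  fun j hj => by rw [Op.coeff_sub, hP j hj, hQ j hj, sub_zero]

theorem Op.IsDiff.mono (a : SFun V) {j : ℤ} (hj : 0 ≤ j) : (Op.mono a j).IsDiff := fun i hi => by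
  rw [Op.coeff_mono, if_neg (by omega)]

theorem Op.IsDiff.sum {ι : Type*} {s : Finset ι} {f : ι → Op V} (h : ∀ i ∈ s, (f i).IsDiff) :
    (∑ i ∈ s, f i).IsDiff := fun j hj => by
  rw [Op.coeff_sum]
  exact Finset.sum_eq_zero fun i hi => h i hi j hj

theorem Op.IsDiff.leftPow {b : Op V} (hb : b.IsDiff) (n : ℕ) : (leftPow n b).IsDiff := by
  induction n with
  | zero => rw [Nat.cast_zero, leftPow_zero]; exact hb
  | succ n ih =>
    intro j hj
    rw [Nat.cast_succ, ← leftD_leftPow, leftD_coeff, ih j hj, ih (j - 1) (by omega), map_zero,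
      map_zero, add_zero]

theorem Op.IsDiff.mul {a b : Op V} (ha : a.IsDiff) (hb : b.IsDiff) : (a * b).IsDiff := by
  intro j hj
  obtain ⟨I, hI⟩ := a.exists_ordLE
  obtain ⟨J, hJ⟩ := b.exists_ordLE
  rw [← Op.comp_eq_mul, comp_coeff hI hJ le_rfl le_rfl]
  refine Finset.sum_eq_zero fun i _ => ?_
  rcases lt_or_ge i 0 with h | h
  · rw [ha i h, zero_mul]
  · lift i to ℕ using h
    rw [hb.leftPow i j hj, mul_zero]

theorem Op.IsEven.plus {P : Op V} (hP : P.IsEven) : P.plus.IsEven := fun j => by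
  rw [Op.plus_coeff]
  split_ifs
  · exact hP j
  · exact HasParity.zero _

theorem Op.IsEven.minus {P : Op V} (hP : P.IsEven) : P.minus.IsEven := hP.sub hP.plus

theorem OrdLE.plus {P : Op V} {J : ℤ} (hP : OrdLE P J) : OrdLE P.plus J := fun j hj => by
  rw [Op.plus_coeff, hP j hj, ite_self]

/-! ### The trace -/

/-- The functional `∫ res` as a linear map. -/
def traceL : Op V →ₗ[ℂ] Grassmann V := berezin ∘ₗ Op.coeffL (-1)

theorem trace_add (P Q : Op V) : trace (P + Q) = trace P + trace Q := map_add traceL P Q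
theorem trace_sub (P Q : Op V) : trace (P - Q) = trace P - trace Q := map_sub traceL P Q
theorem trace_neg (P : Op V) : trace (-P) = -trace P := map_neg traceL P
theorem trace_smul (c : ℂ) (P : Op V) : trace (c • P) = c • trace P := map_smul traceL c P
theorem trace_zero : trace (0 : Op V) = 0 := map_zero traceL
theorem trace_sum {ι : Type*} (s : Finset ι) (f : ι → Op V) :
    trace (∑ i ∈ s, f i) = ∑ i ∈ s, trace (f i) := map_sum traceL f s

theorem trace_eq_zero {P : Op V} {J : ℤ} (h : OrdLE P J) (hJ : J < -1) : trace P = 0 := by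
  rw [trace, h _ hJ, map_zero]

theorem Op.IsDiff.trace_eq_zero {P : Op V} (h : P.IsDiff) : trace P = 0 := by
  rw [trace, h _ (by norm_num), map_zero]

theorem mono_zero_mul_coeff (a : SFun V) (b : Op V) (k : ℤ) :
    (Op.mono a 0 * b).coeff k = a * b.coeff k := by
  rw [← Op.comp_eq_mul, mono_comp_coeff, leftPow_zero]

theorem mono_eq_mul (a : SFun V) (i : ℤ) : Op.mono a i = Op.mono a 0 * Op.mono 1 i := by
  ext1 k
  rw [mono_zero_mul_coeff, Op.coeff_mono, Op.coeff_mono]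
  split_ifs <;> simp

theorem mono_one_mul (i : ℤ) (b : Op V) : Op.mono 1 i * b = leftPow i b := mono_one_comp i b

theorem mono_one_mul_mono_one (i j : ℤ) :
    (Op.mono 1 i : Op V) * Op.mono 1 j = Op.mono 1 (i + j) := by
  rw [mono_one_mul, leftPow_mono_one]

theorem mul_mono_one_coeff (b : Op V) (i k : ℤ) : (b * Op.mono 1 i).coeff k = b.coeff (k - i) :=
  comp_mono_one_coeff b i k

theorem Op.HasParity.mono_one (i : ℤ) : (Op.mono (1 : SFun V) i).HasParity i :=
  (Op.HasParity.mono HasParity.one i).congr ⟨-i, by ring⟩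

/-- Moving powers of `D_θ` cyclically under the trace. -/
theorem trace_mono_one_mul (i : ℤ) {p : ℤ} {Y : Op V} (hY : Y.HasParity p) :
    trace (Op.mono 1 i * Y) = sgn (p * i) • trace (Y * Op.mono 1 i) := by
  have base : ∀ {p : ℤ} {Y : Op V}, Y.HasParity p →
      trace (Op.mono 1 1 * Y) = sgn p • trace (Y * Op.mono 1 1) := by
    intro p Y hY
    have h := hasParity_iff.1 (hY (-1 - 1))
    rw [trace, trace, mono_one_mul, leftPow_one, leftD_coeff, map_add, berezin_superD, zero_add, h,
      mul_mono_one_coeff, map_zsmul, sgn_add, sgn_even (by decide : Even (-1 - 1 : ℤ)), one_mul]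
  induction i using Int.induction_on generalizing p Y with
  | zero => rw [mul_zero, sgn_zero, one_smul, ← Op.one_def, one_mul, mul_one]
  | succ i ih =>
    have h1 := base ((Op.HasParity.mono_one i).mul hY)
    have h2 := ih (hY.mul (Op.HasParity.mono_one 1))
    rw [← mul_assoc, mono_one_mul_mono_one, add_comm] at h1
    rw [h1, mul_assoc, h2, mul_assoc, mono_one_mul_mono_one, smul_smul, ← sgn_add, add_comm 1 (i : ℤ)]
    congr 1
    rw [show (i : ℤ) + p + (p + 1) * i = p * (i + 1) + (i + i) by ring, sgn_add,
      sgn_even ⟨(i : ℤ), rfl⟩, mul_one]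
  | pred i ih =>
    set j : ℤ := -(i : ℤ) with hj
    have h1 := base (((Op.HasParity.mono_one (j - 1)).mul hY).mul (Op.HasParity.mono_one (-1)))
    have h2 := ih (hY.mul (Op.HasParity.mono_one (-1)))
    rw [mul_assoc _ _ (Op.mono 1 1), mono_one_mul_mono_one, neg_add_cancel, ← Op.one_def, mul_one,
      ← mul_assoc, ← mul_assoc, mono_one_mul_mono_one, add_sub_cancel, mul_assoc, h2, mul_assoc,
      mono_one_mul_mono_one, neg_add_eq_sub] at h1
    rw [← sgn_smul_sgn_smul (j - 1 + p + -1) (trace (Op.mono 1 (j - 1) * Y)), ← h1, smul_smul,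
      ← sgn_add]
    congr 1
    rw [show j - 1 + p + -1 + (p + -1) * j = p * (j - 1) + ((p - 1) + (p - 1)) by ring, sgn_add,
      sgn_even ⟨p - 1, rfl⟩, mul_one]

theorem trace_mul_mono_zero (Y : Op V) (a : SFun V) :
    trace (Y * Op.mono a 0) = berezin (Y.coeff (-1) * invol a) := by
  obtain ⟨I, hI⟩ := Y.exists_ordLE
  rw [trace, ← Op.comp_eq_mul, comp_coeff hI (OrdLE.mono a 0) (lo := -1) (hi := max I (-1))
    (by norm_num) (le_max_left _ _), Finset.sum_eq_single (-1)]
  · have h := leftPow_coeff_top (OrdLE.mono a 0) (-1)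
    rw [zero_add] at h
    rw [h, Op.coeff_mono, if_pos rfl, twist_of_odd (by decide)]
  · intro i hi h
    rw [Finset.mem_Icc] at hi
    lift i to ℕ using (by omega)
    rw [(Op.IsDiff.mono a le_rfl).leftPow i _ (by norm_num), mul_zero]
  · intro h
    exact absurd (Finset.mem_Icc.2 ⟨le_rfl, le_max_right _ _⟩) h

theorem trace_mono_mul {i : ℤ} {a : SFun V} (ha : HasParity i a) {Y : Op V} (hY : Y.IsEven) :
    trace (Op.mono a i * Y) = trace (Y * Op.mono a i) := by
  rw [Op.isEven_iff] at hY
  have hZ := hY.leftPow i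
  have h1 : trace (Op.mono a i * Y) = sgn i • trace (leftPow i Y * Op.mono a 0) := by
    have h2 := hZ (-1)
    rw [trace_mul_mono_zero, hasParity_iff.1 ha, mul_smul_comm, map_zsmul, sgn_smul_sgn_smul,
      trace,
      ← Op.comp_eq_mul, mono_comp_coeff, ha.mul_comm h2, sgn_even, one_smul]
    rw [zero_add]
    simp only [Int.even_mul, Int.even_add, even_neg, Int.not_even_one, false_iff,
      Int.not_even_iff_odd]
    exact Int.even_or_odd i
  have h3 : (Op.mono a 0 : Op V).HasParity i := by simpa using Op.HasParity.mono ha 0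
  have h4 := hY.mul h3
  rw [zero_add] at h4
  rw [h1, ← mono_one_mul, mul_assoc, trace_mono_one_mul i h4, mul_assoc, ← mono_eq_mul,
    smul_smul, ← sgn_add, sgn_even, one_smul]
  simp [parity_simps]

theorem ordLE_sub_sum_mono {X : Op V} {I : ℤ} (hX : OrdLE X I) (lo : ℤ) :
    OrdLE (X - ∑ i ∈ Finset.Icc lo I, Op.mono (X.coeff i) i) (lo - 1) := fun j hj => by
  rw [Op.coeff_sub, Op.coeff_sum]
  simp only [Op.coeff_mono, Finset.sum_ite_eq, Finset.mem_Icc]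
  split_ifs with h
  · exact sub_self _
  · rw [hX j (by omega), sub_zero]

/-- The trace is cyclic on even operators. -/
theorem trace_mul_comm {X Y : Op V} (hX : X.IsEven) (hY : Y.IsEven) :
    trace (X * Y) = trace (Y * X) := by
  obtain ⟨I, hI⟩ := X.exists_ordLE
  obtain ⟨J, hJ⟩ := Y.exists_ordLE
  have h := ordLE_sub_sum_mono hI (-J - 1)
  have h1 := trace_eq_zero (h.mul hJ) (by omega)
  have h2 := trace_eq_zero (hJ.mul h) (by omega)
  rw [sub_mul, trace_sub, sub_eq_zero, Finset.sum_mul, trace_sum] at h1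
  rw [mul_sub, trace_sub, sub_eq_zero, Finset.mul_sum, trace_sum] at h2
  rw [h1, h2]
  exact Finset.sum_congr rfl fun i _ => trace_mono_mul (hX i) hY

/-! ### Integral operators of rank one and the actions on superfunctions -/

theorem rankOne_eq (u v : SFun V) : rankOne u v = Op.mono u (-1) * Op.mono v 0 := rfl

theorem rankOne_eq' (u v : SFun V) :
    rankOne u v = Op.mono u 0 * (Op.mono 1 (-1) * Op.mono v 0) := by
  rw [rankOne_eq, mono_eq_mul u, mul_assoc]

theorem ordLE_rankOne (u v : SFun V) : OrdLE (rankOne u v) (-1) :=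
  (OrdLE.mono u (-1)).mul (OrdLE.mono v 0)

theorem pair_eq (u v : SFun V) : pair u v = berezin (u * invol v) := by
  rw [pair, rankOne_eq, trace_mul_mono_zero, Op.coeff_mono, if_pos rfl]

theorem Op.mono_add (a b : SFun V) (j : ℤ) : Op.mono (a + b) j = Op.mono a j + Op.mono b j := by
  ext1 k
  simp only [Op.coeff_mono, Op.coeff_add]
  split_ifs <;> simp

theorem Op.mono_smul (c : ℂ) (a : SFun V) (j : ℤ) : Op.mono (c • a) j = c • Op.mono a j := by
  ext1 k
  simp only [Op.coeff_mono, Op.coeff_smul]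
  split_ifs <;> simp

/-- The operator `a D_θ^j` as a linear map of `a`. -/
def Op.monoL (j : ℤ) : SFun V →ₗ[ℂ] Op V where
  toFun a := Op.mono a j
  map_add' a b := Op.mono_add a b j
  map_smul' c a := Op.mono_smul c a j

/-- `u D_θ⁻¹ v` as a bilinear map. -/
def rankOneL : SFun V →ₗ[ℂ] SFun V →ₗ[ℂ] Op V :=
  (LinearMap.mul ℂ (Op V)).compl₁₂ (Op.monoL (-1)) (Op.monoL 0)

theorem rankOne_eq_rankOneL (u v : SFun V) : rankOne u v = rankOneL u v := rfl

/-- The pairing `⟨u, v⟩` as a bilinear map. -/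
def pairL : SFun V →ₗ[ℂ] SFun V →ₗ[ℂ] Grassmann V := rankOneL.compr₂ traceL

theorem pair_eq_pairL (u v : SFun V) : pair u v = pairL u v := rfl

/-- The form `(a, b)` as a bilinear map. -/
def formL : Op V →ₗ[ℂ] Op V →ₗ[ℂ] Grassmann V := (LinearMap.mul ℂ (Op V)).compr₂ traceL

theorem act_eq_sum {P : Op V} {J : ℤ} (hP : OrdLE P J) {n : ℕ} (hn : J < n) (f : SFun V) :
    act P f = ∑ j ∈ Finset.range n, P.coeff j * (superD ^ j) f := by
  refine finsum_eq_sum_of_support_subset _ fun j hj => ?_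
  rw [Finset.coe_range, Set.mem_Iio]
  by_contra h
  refine hj ?_
  change P.coeff j * (superD ^ j) f = 0
  rw [hP _ (by omega), zero_mul]

theorem adjAct_eq_sum {P : Op V} {J : ℤ} (hP : OrdLE P J) {n : ℕ} (hn : J < n) (f : SFun V) :
    adjAct P f = ∑ j ∈ Finset.range n,
      ((-1 : ℤ) ^ (j * (j + 1) / 2)) • (superD ^ j) (twist j (P.coeff j) * f) := by
  refine finsum_eq_sum_of_support_subset _ fun j hj => ?_
  rw [Finset.coe_range, Set.mem_Iio]
  by_contra h
  refine hj ?_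
  change ((-1 : ℤ) ^ (j * (j + 1) / 2)) • (superD ^ j) (twist j (P.coeff j) * f) = 0
  rw [hP _ (by omega), map_zero, zero_mul, map_zero, smul_zero]

theorem Op.exists_common_ordLE (P Q : Op V) : ∃ (J : ℤ) (n : ℕ), J < n ∧ OrdLE P J ∧ OrdLE Q J := by
  obtain ⟨J, hJ⟩ := P.exists_ordLE
  obtain ⟨K, hK⟩ := Q.exists_ordLE
  exact ⟨max J K, (max J K).toNat + 1, by omega, hJ.of_le (le_max_left _ _),
    hK.of_le (le_max_right _ _)⟩

/-- The action of differential operators on superfunctions as a bilinear map. -/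
def actL : Op V →ₗ[ℂ] SFun V →ₗ[ℂ] SFun V :=
  LinearMap.mk₂ ℂ act
    (fun P Q f => by
      obtain ⟨J, n, hn, hP, hQ⟩ := Op.exists_common_ordLE P Q
      rw [act_eq_sum hP hn, act_eq_sum hQ hn, act_eq_sum (hP.add hQ) hn, ← Finset.sum_add_distrib]
      simp only [Op.coeff_add, add_mul])
    (fun c P f => by
      obtain ⟨J, n, hn, hP, -⟩ := Op.exists_common_ordLE P P
      rw [act_eq_sum hP hn, act_eq_sum (hP.smul c) hn, Finset.smul_sum]
      simp only [Op.coeff_smul, smul_mul_assoc])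
    (fun P f g => by
      obtain ⟨J, n, hn, hP, -⟩ := Op.exists_common_ordLE P P
      rw [act_eq_sum hP hn, act_eq_sum hP hn, act_eq_sum hP hn, ← Finset.sum_add_distrib]
      simp only [map_add, mul_add])
    (fun c P f => by
      obtain ⟨J, n, hn, hP, -⟩ := Op.exists_common_ordLE P P
      rw [act_eq_sum hP hn, act_eq_sum hP hn, Finset.smul_sum]
      simp only [map_smul, mul_smul_comm])

theorem act_eq_actL (P : Op V) (f : SFun V) : act P f = actL P f := rfl

/-- The adjoint action as a bilinear map. -/
def adjActL : Op V →ₗ[ℂ] SFun V →ₗ[ℂ] SFun V :=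
  LinearMap.mk₂ ℂ adjAct
    (fun P Q f => by
      obtain ⟨J, n, hn, hP, hQ⟩ := Op.exists_common_ordLE P Q
      rw [adjAct_eq_sum hP hn, adjAct_eq_sum hQ hn, adjAct_eq_sum (hP.add hQ) hn,
        ← Finset.sum_add_distrib]
      simp only [Op.coeff_add, map_add, add_mul, smul_add])
    (fun c P f => by
      obtain ⟨J, n, hn, hP, -⟩ := Op.exists_common_ordLE P P
      rw [adjAct_eq_sum hP hn, adjAct_eq_sum (hP.smul c) hn, Finset.smul_sum]
      simp only [Op.coeff_smul, map_smul, smul_mul_assoc]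
      exact Finset.sum_congr rfl fun _ _ => smul_comm _ _ _)
    (fun P f g => by
      obtain ⟨J, n, hn, hP, -⟩ := Op.exists_common_ordLE P P
      rw [adjAct_eq_sum hP hn, adjAct_eq_sum hP hn, adjAct_eq_sum hP hn, ← Finset.sum_add_distrib]
      simp only [map_add, mul_add, smul_add])
    (fun c P f => by
      obtain ⟨J, n, hn, hP, -⟩ := Op.exists_common_ordLE P P
      rw [adjAct_eq_sum hP hn, adjAct_eq_sum hP hn, Finset.smul_sum]
      simp only [map_smul, mul_smul_comm]
      exact Finset.sum_congr rfl fun _ _ => smul_comm _ _ _)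

theorem adjAct_eq_adjActL (P : Op V) (f : SFun V) : adjAct P f = adjActL P f := rfl

theorem act_plus (P : Op V) (f : SFun V) : act P.plus f = act P f :=
  finsum_congr fun j => by rw [Op.plus_coeff, if_pos (Int.natCast_nonneg j)]

theorem adjAct_plus (P : Op V) (f : SFun V) : adjAct P.plus f = adjAct P f :=
  finsum_congr fun j => by rw [Op.plus_coeff, if_pos (Int.natCast_nonneg j)]

theorem act_eq_zero {P : Op V} (hP : OrdLE P (-1)) (f : SFun V) : act P f = 0 := by
  rw [act_eq_sum hP (n := 0) (by norm_num), Finset.sum_range_zero]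

theorem adjAct_eq_zero {P : Op V} (hP : OrdLE P (-1)) (f : SFun V) : adjAct P f = 0 := by
  rw [adjAct_eq_sum hP (n := 0) (by norm_num), Finset.sum_range_zero]

theorem Op.IsEven.hasParity_act {P : Op V} (hP : P.IsEven) {k : ℤ} {f : SFun V}
    (hf : SuperLax.HasParity k f) : SuperLax.HasParity k (act P f) := by
  obtain ⟨J, n, hn, hJ, -⟩ := Op.exists_common_ordLE P P
  rw [act_eq_sum hJ hn]
  refine HasParity.sum fun j _ => (hasParity_congr ?_).1 ((hP j).mul (hf.superD_pow j))
  exact ⟨j, by ring⟩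

theorem Op.IsEven.hasParity_adjAct {P : Op V} (hP : P.IsEven) {k : ℤ} {f : SFun V}
    (hf : SuperLax.HasParity k f) : SuperLax.HasParity k (adjAct P f) := by
  obtain ⟨J, n, hn, hJ, -⟩ := Op.exists_common_ordLE P P
  rw [adjAct_eq_sum hJ hn]
  refine HasParity.sum fun j _ => HasParity.zsmul _ ?_
  have h := hP j
  rw [h.twist]
  refine (hasParity_congr ?_).1 (((h.zsmul _).mul hf).superD_pow j)
  exact ⟨j, by ring⟩

theorem leftPow_mono_zero_coeff_zero (n : ℕ) (f : SFun V) :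
    (leftPow n (Op.mono f 0)).coeff 0 = (superD ^ n) f := by
  induction n with
  | zero => rw [Nat.cast_zero, leftPow_zero, Op.coeff_mono, if_pos rfl, pow_zero]; rfl
  | succ n ih =>
    rw [Nat.cast_succ, ← leftD_leftPow, leftD_coeff, ih,
      (Op.IsDiff.mono f le_rfl).leftPow n (0 - 1) (by norm_num), map_zero, add_zero, pow_succ',
      Module.End.mul_apply]

/-- `P₊ f` is the free term of `P₊ ∘ f`. -/
theorem coeff_zero_plus_mul_mono (P : Op V) (f : SFun V) :
    (P.plus * Op.mono f 0).coeff 0 = act P f := by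
  obtain ⟨J, n, hn, hJ, -⟩ := Op.exists_common_ordLE P P
  rw [← act_plus, act_eq_sum hJ.plus hn, ← Op.comp_eq_mul,
    comp_coeff (hJ.plus.of_le hn.le) (OrdLE.mono f 0) (lo := min 0 n) (hi := n) (by omega) le_rfl]
  rw [min_eq_left (Int.natCast_nonneg n)]
  have h1 : ∑ j ∈ Finset.range n, P.plus.coeff j * (superD ^ j) f
      = ∑ j ∈ Finset.range (n + 1), P.plus.coeff j * (superD ^ j) f := by
    rw [Finset.sum_range_succ, hJ.plus n hn, zero_mul, add_zero]
  rw [h1]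
  refine Finset.sum_nbij' Int.toNat (fun j => (j : ℤ)) ?_ ?_ ?_ ?_ ?_
  · intro i hi
    simp only [Finset.mem_Icc, Finset.mem_range] at hi ⊢
    omega
  · intro i hi
    simp only [Finset.mem_Icc, Finset.mem_range] at hi ⊢
    omega
  · intro i hi
    simp only [Finset.mem_Icc] at hi
    omega
  · intro i _
    exact Int.toNat_natCast i
  · intro i hi
    simp only [Finset.mem_Icc] at hi
    obtain ⟨j, rfl⟩ := Int.eq_ofNat_of_zero_le hi.1
    rw [leftPow_mono_zero_coeff_zero]
    rfl

/-- `(P₊ ∘ u D_θ⁻¹ v)₋ = (P₊ u) D_θ⁻¹ v`. -/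
theorem isDiff_plus_mul_rankOne_sub (P : Op V) (u v : SFun V) :
    (P.plus * rankOne u v - rankOne (act P u) v).IsDiff := by
  set X := P.plus * Op.mono u 0 with hX
  have hXd : X.IsDiff := (Op.isDiff_plus P).mul (Op.IsDiff.mono u le_rfl)
  have h : P.plus * rankOne u v - rankOne (act P u) v
      = ((X - Op.mono (act P u) 0) * Op.mono 1 (-1)) * Op.mono v 0 := by
    rw [rankOne_eq', rankOne_eq', sub_mul, sub_mul, hX]
    simp only [mul_assoc]
  rw [h]
  refine Op.IsDiff.mul (fun j hj => ?_) (Op.IsDiff.mono v le_rfl)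
  rw [mul_mono_one_coeff, Op.coeff_sub, Op.coeff_mono]
  rcases eq_or_lt_of_le (show j - -1 ≤ 0 by omega) with h0 | h0
  · rw [if_pos h0, h0, hX, coeff_zero_plus_mul_mono, sub_self]
  · rw [if_neg h0.ne, hXd _ h0, sub_self]

theorem mono_succ (w : SFun V) (j : ℤ) :
    Op.mono w (j + 1) = Op.mono 1 1 * Op.mono (invol w) j + Op.mono (invol (superD w)) j := by
  ext1 k
  rw [mono_one_mul, leftPow_one, Op.coeff_add, leftD_coeff]
  simp only [Op.coeff_mono, sub_eq_iff_eq_add]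
  rcases eq_or_ne k j with h | h
  · have h' : k ≠ j + 1 := by omega
    rw [if_neg h', if_pos h, if_neg h', if_pos h, superD_invol, map_zero, add_zero, neg_add_cancel]
  · rw [if_neg h, if_neg h, map_zero, zero_add, add_zero]
    split_ifs
    · rw [invol_invol]
    · rw [map_zero]

/-- Division with remainder on the left by `D_θ`: modulo `D_θ ∘ (differential operators)`, the
operator `w D_θ^j` is the multiplication by `(-1)^{j(j+1)/2} D_θ^j ι^j(w)`. -/
theorem mono_eq_superD_mul_add (j : ℕ) (w : SFun V) :
    ∃ Q : Op V, Q.IsDiff ∧ Op.mono w j = Op.mono 1 1 * Q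
      + Op.mono (((-1 : ℤ) ^ (j * (j + 1) / 2)) • (superD ^ j) (twist j w)) 0 := by
  induction j generalizing w with
  | zero =>
    refine ⟨0, fun _ _ => rfl, ?_⟩
    simp
  | succ j ih =>
    obtain ⟨Q, hQ, h⟩ := ih (invol (superD w))
    refine ⟨Op.mono (invol w) j + Q, (Op.IsDiff.mono _ (Int.natCast_nonneg j)).add hQ, ?_⟩
    rw [Nat.cast_succ, mono_succ, h, mul_add (Op.mono 1 1), ← add_assoc]
    congr 2
    have e1 : (j + 1) * (j + 1 + 1) / 2 = j * (j + 1) / 2 + (j + 1) := by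
      rw [show (j + 1) * (j + 1 + 1) = j * (j + 1) + (j + 1) * 2 by ring,
        Nat.add_mul_div_right _ _ (by norm_num)]
    rw [e1, twist_add_one, pow_add _ (j * (j + 1) / 2), mul_smul, pow_succ superD,
      Module.End.mul_apply, invol_twist]
    congr 1
    rcases Nat.even_or_odd j with hj | hj
    · have hj' : Even (j : ℤ) := by exact_mod_cast hj
      rw [twist_of_even hj', twist_of_even hj', hj.add_one.neg_one_pow, superD_invol, map_neg,
        smul_neg, neg_smul, one_smul, neg_neg]
    · have hj' : Odd (j : ℤ) := by exact_mod_cast hj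
      rw [twist_of_odd hj', twist_of_odd hj', hj.add_one.neg_one_pow, one_smul, invol_invol,
        invol_invol]

/-- `(u D_θ⁻¹ v ∘ P₊)₋ = u D_θ⁻¹ (P₊^* v)`. -/
theorem isDiff_rankOne_mul_plus_sub {P : Op V} (hP : P.IsEven) {k : ℤ} (u : SFun V) {v : SFun V}
    (hv : HasParity k v) : (rankOne u v * P.plus - rankOne u (adjAct P v)).IsDiff := by
  obtain ⟨J, n, hn, hJ, -⟩ := Op.exists_common_ordLE P P
  choose Q hQ h using fun j : ℕ => mono_eq_superD_mul_add j (v * P.coeff j)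
  have h1 : Op.mono v 0 * P.plus = ∑ j ∈ Finset.range n, Op.mono (v * P.coeff j) j := by
    ext1 i
    rw [mono_zero_mul_coeff, Op.coeff_sum, Op.plus_coeff]
    simp only [Op.coeff_mono]
    rcases lt_or_ge i 0 with hi | hi
    · rw [if_neg (by omega), mul_zero]
      exact (Finset.sum_eq_zero fun j _ => if_neg (by omega)).symm
    · obtain ⟨i, rfl⟩ := Int.eq_ofNat_of_zero_le hi
      simp only [if_pos hi, Nat.cast_inj, Finset.sum_ite_eq, Finset.mem_range]
      split_ifs with hin
      · rfl
      · rw [hJ _ (by omega), mul_zero]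
  have h2 : Op.mono v 0 * P.plus
      = Op.mono 1 1 * (∑ j ∈ Finset.range n, Q j) + Op.mono (adjAct P v) 0 := by
    rw [h1, adjAct_eq_sum hJ hn, Finset.mul_sum]
    change _ = _ + Op.monoL 0 _
    rw [map_sum, ← Finset.sum_add_distrib]
    refine Finset.sum_congr rfl fun j _ => ?_
    rw [h j]
    have e : twist j (v * P.coeff j) = twist j (P.coeff j) * v := by
      rw [hv.mul_comm (hP j), map_zsmul, twist_mul, hv.twist, mul_smul_comm, mul_comm k,
        sgn_smul_sgn_smul]
    rw [e]
    rfl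
  have h3 : rankOne u v * P.plus - rankOne u (adjAct P v)
      = Op.mono u 0 * (∑ j ∈ Finset.range n, Q j) := by
    rw [rankOne_eq', rankOne_eq', mul_assoc, mul_assoc, h2, mul_add, ← mul_assoc (Op.mono 1 (-1)),
      mono_one_mul_mono_one, neg_add_cancel, ← Op.one_def, one_mul, mul_add, add_sub_cancel_right]
  rw [h3]
  exact (Op.IsDiff.mono u le_rfl).mul (Op.IsDiff.sum fun j _ => hQ j)

theorem isEven_rankOne {k : ℤ} {u v : SFun V} (hu : HasParity k u) (hv : HasParity (k + 1) v) :
    (rankOne u v).IsEven := by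
  rw [Op.isEven_iff]
  exact ((Op.HasParity.mono hu (-1)).mul (Op.HasParity.mono hv 0)).congr ⟨k + 1, by ring⟩

theorem trace_mul_rankOne (P : Op V) (u v : SFun V) : trace (P * rankOne u v) = pair (act P u) v := by
  have h1 := trace_eq_zero ((P.ordLE_minus).mul (ordLE_rankOne u v)) (by norm_num)
  have h2 := (isDiff_plus_mul_rankOne_sub P u v).trace_eq_zero
  rw [trace_sub, sub_eq_zero] at h2
  rw [← P.minus_add_plus, add_mul, trace_add, h1, zero_add, h2, P.minus_add_plus]
  rfl

theorem trace_rankOne_mul {P : Op V} (hP : P.IsEven) {k : ℤ} (u : SFun V) {v : SFun V}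
    (hv : HasParity k v) : trace (rankOne u v * P) = pair u (adjAct P v) := by
  have h1 := trace_eq_zero ((ordLE_rankOne u v).mul P.ordLE_minus) (by norm_num)
  have h2 := (isDiff_rankOne_mul_plus_sub hP u hv).trace_eq_zero
  rw [trace_sub, sub_eq_zero] at h2
  have h3 : rankOne u v * P = rankOne u v * P.minus + rankOne u v * P.plus := by
    rw [← mul_add, P.minus_add_plus]
  rw [h3, trace_add, h1, zero_add, h2]
  rfl

/-- `P₊` and `P₊^*` are adjoint to each other. -/
theorem pair_act {P : Op V} (hP : P.IsEven) {k : ℤ} {u v : SFun V} (hu : HasParity k u)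
    (hv : HasParity (k + 1) v) : pair (act P u) v = pair u (adjAct P v) := by
  rw [← trace_mul_rankOne, trace_mul_comm hP (isEven_rankOne hu hv), trace_rankOne_mul hP u hv]

theorem theta_eq (l P : Op V) :
    theta l P = (l * P.plus - P.plus * l) - (l * P - P * l).plus := rfl

/-- `Θ̃` at an operator of rank one. -/
theorem theta_rankOne {P : Op V} (hP : P.IsEven) {k : ℤ} (u : SFun V) {v : SFun V}
    (hv : HasParity k v) :
    theta (rankOne u v) P = rankOne u (adjAct P v) - rankOne (act P u) v := by
  set R := rankOne u v with hR
  have hRo : OrdLE R (-1) := ordLE_rankOne u v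
  have h1 : (R * P - P * R).plus = (R * P.plus - P.plus * R).plus := by
    have e : R * P - P * R = (R * P.plus - P.plus * R) + (R * P.minus - P.minus * R) := by
      conv_lhs => rw [← P.plus_add_minus]
      noncomm_ring
    have hz : (R * P.minus - P.minus * R).plus = 0 :=
      Op.plus_eq_zero (((hRo.mul P.ordLE_minus).sub (P.ordLE_minus.mul hRo)).of_le (by norm_num))
    rw [e, Op.plus_add, hz, add_zero]
  have hd1 := isDiff_rankOne_mul_plus_sub hP u hv
  have hd2 := isDiff_plus_mul_rankOne_sub P u v
  rw [← hR] at hd1 hd2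
  have e : R * P.plus - P.plus * R = ((R * P.plus - rankOne u (adjAct P v))
      - (P.plus * R - rankOne (act P u) v)) + (rankOne u (adjAct P v) - rankOne (act P u) v) := by
    abel
  have h2 : (R * P.plus - P.plus * R).plus = (R * P.plus - rankOne u (adjAct P v))
      - (P.plus * R - rankOne (act P u) v) := by
    conv_lhs => rw [e]
    rw [Op.plus_add, (hd1.sub hd2).plus_eq,
      Op.plus_eq_zero ((ordLE_rankOne _ _).sub (ordLE_rankOne _ _)), add_zero]
  rw [theta_eq, h1, h2]
  abel

/-! ### Polynomial curves and their first-order jets -/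

section Jets

variable {X Y Z : Type*} [AddCommGroup X] [Module ℂ X] [AddCommGroup Y] [Module ℂ Y]
  [AddCommGroup Z] [Module ℂ Z]

/-- Curves `t ↦ ∑_k t^k y_k` (finite sums) in a complex vector space. -/
def polyCurves (Y : Type*) [AddCommGroup Y] [Module ℂ Y] : Submodule ℂ (ℝ → Y) :=
  Submodule.span ℂ {c | ∃ (k : ℕ) (y : Y), c = fun t : ℝ => ((t : ℂ) ^ k) • y}

theorem monomial_mem_polyCurves (k : ℕ) (y : Y) :
    (fun t : ℝ => ((t : ℂ) ^ k) • y) ∈ polyCurves Y :=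
  Submodule.subset_span ⟨k, y, rfl⟩

theorem const_mem_polyCurves (y : Y) : (fun _ : ℝ => y) ∈ polyCurves Y := by
  simpa using monomial_mem_polyCurves 0 y

theorem polyCurves_map (L : Y →ₗ[ℂ] Z) {c : ℝ → Y} (hc : c ∈ polyCurves Y) :
    (fun t => L (c t)) ∈ polyCurves Z := by
  induction hc using Submodule.span_induction with
  | mem c hc =>
    obtain ⟨k, y, rfl⟩ := hc
    simp only [map_smul]
    exact monomial_mem_polyCurves k _
  | zero =>
    simp only [Pi.zero_apply, map_zero]
    exact const_mem_polyCurves 0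
  | add c d _ _ hc hd =>
    simp only [Pi.add_apply, map_add]
    exact Submodule.add_mem _ hc hd
  | smul a c _ hc =>
    simp only [Pi.smul_apply, map_smul]
    exact Submodule.smul_mem _ a hc

theorem polyCurves_pow_smul (k : ℕ) {c : ℝ → Y} (hc : c ∈ polyCurves Y) :
    (fun t : ℝ => ((t : ℂ) ^ k) • c t) ∈ polyCurves Y := by
  induction hc using Submodule.span_induction with
  | mem c hc =>
    obtain ⟨j, y, rfl⟩ := hc
    simp only [smul_smul, ← pow_add]
    exact monomial_mem_polyCurves _ _
  | zero =>
    simp only [Pi.zero_apply, smul_zero]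
    exact const_mem_polyCurves 0
  | add c d _ _ hc hd =>
    simp only [Pi.add_apply, smul_add]
    exact Submodule.add_mem _ hc hd
  | smul a c _ hc =>
    simp only [Pi.smul_apply, smul_comm _ a]
    exact Submodule.smul_mem _ a hc

theorem polyCurves_map₂ (M : X →ₗ[ℂ] Y →ₗ[ℂ] Z) {c : ℝ → X} {d : ℝ → Y} (hc : c ∈ polyCurves X)
    (hd : d ∈ polyCurves Y) : (fun t => M (c t) (d t)) ∈ polyCurves Z := by
  induction hc using Submodule.span_induction with
  | mem c hc =>
    obtain ⟨k, y, rfl⟩ := hc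
    simp only [map_smul, LinearMap.smul_apply]
    exact polyCurves_pow_smul k (polyCurves_map (M y) hd)
  | zero =>
    simp only [Pi.zero_apply, map_zero, LinearMap.zero_apply]
    exact const_mem_polyCurves 0
  | add c d _ _ hc hd =>
    simp only [Pi.add_apply, map_add, LinearMap.add_apply]
    exact Submodule.add_mem _ hc hd
  | smul a c _ hc =>
    simp only [Pi.smul_apply, map_smul, LinearMap.smul_apply]
    exact Submodule.smul_mem _ a hc

theorem polyCurves_continuous (φ : Y →ₗ[ℂ] ℂ) {c : ℝ → Y} (hc : c ∈ polyCurves Y) :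
    Continuous fun t => φ (c t) := by
  induction hc using Submodule.span_induction with
  | mem c hc =>
    obtain ⟨k, y, rfl⟩ := hc
    simp only [map_smul, smul_eq_mul]
    fun_prop
  | zero =>
    simp only [Pi.zero_apply, map_zero]
    fun_prop
  | add c d _ _ hc hd =>
    simp only [Pi.add_apply, map_add]
    exact hc.add hd
  | smul a c _ hc =>
    simp only [Pi.smul_apply, map_smul, smul_eq_mul]
    exact continuous_const.mul hc

/-- The curve `c` is `t ↦ y₀ + t y₁ + O(t²)` with a polynomial remainder. -/
def HasJet (c : ℝ → Y) (y₀ y₁ : Y) : Prop :=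
  ∃ z ∈ polyCurves Y, ∀ t : ℝ, c t = y₀ + (t : ℂ) • y₁ + ((t : ℂ) ^ 2) • z t

theorem HasJet.mem_polyCurves {c : ℝ → Y} {y₀ y₁ : Y} (h : HasJet c y₀ y₁) : c ∈ polyCurves Y := by
  obtain ⟨z, hz, h⟩ := h
  have h1 : c = (fun _ => y₀) + (fun t : ℝ => ((t : ℂ) ^ 1) • y₁)
      + fun t : ℝ => ((t : ℂ) ^ 2) • z t := by
    funext t
    simp only [h t, Pi.add_apply, pow_one]
  rw [h1]
  exact Submodule.add_mem _ (Submodule.add_mem _ (const_mem_polyCurves _)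
    (monomial_mem_polyCurves 1 _)) (polyCurves_pow_smul 2 hz)

theorem HasJet.affine (y₀ y₁ : Y) : HasJet (fun t : ℝ => y₀ + (t : ℂ) • y₁) y₀ y₁ :=
  ⟨0, Submodule.zero_mem _, fun t => by simp⟩

theorem HasJet.const (y : Y) : HasJet (fun _ => y) y 0 :=
  ⟨0, Submodule.zero_mem _, fun t => by simp⟩

theorem HasJet.add {c d : ℝ → Y} {y₀ y₁ x₀ x₁ : Y} (hc : HasJet c y₀ y₁) (hd : HasJet d x₀ x₁) :
    HasJet (fun t => c t + d t) (y₀ + x₀) (y₁ + x₁) := by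
  obtain ⟨z, hz, hc⟩ := hc
  obtain ⟨w, hw, hd⟩ := hd
  refine ⟨z + w, Submodule.add_mem _ hz hw, fun t => ?_⟩
  beta_reduce
  rw [hc t, hd t, Pi.add_apply]
  module

theorem HasJet.map (L : Y →ₗ[ℂ] Z) {c : ℝ → Y} {y₀ y₁ : Y} (hc : HasJet c y₀ y₁) :
    HasJet (fun t => L (c t)) (L y₀) (L y₁) := by
  obtain ⟨z, hz, hc⟩ := hc
  refine ⟨fun t => L (z t), polyCurves_map L hz, fun t => ?_⟩
  beta_reduce
  rw [hc t, map_add, map_add, map_smul, map_smul]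

theorem HasJet.map₂ (M : X →ₗ[ℂ] Y →ₗ[ℂ] Z) {c : ℝ → X} {d : ℝ → Y} {x₀ x₁ : X} {y₀ y₁ : Y}
    (hc : HasJet c x₀ x₁) (hd : HasJet d y₀ y₁) :
    HasJet (fun t => M (c t) (d t)) (M x₀ y₀) (M x₁ y₀ + M x₀ y₁) := by
  obtain ⟨z, hz, hc⟩ := hc
  obtain ⟨w, hw, hd⟩ := hd
  have h1 := const_mem_polyCurves (M x₁ y₁)
  have h2 := polyCurves_map (M x₀) hw
  have h3 := polyCurves_map (M.flip y₀) hz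
  have h4 := polyCurves_pow_smul 1 (polyCurves_map (M x₁) hw)
  have h5 := polyCurves_pow_smul 1 (polyCurves_map (M.flip y₁) hz)
  have h6 := polyCurves_pow_smul 2 (polyCurves_map₂ M hz hw)
  refine ⟨_, Submodule.add_mem _ (Submodule.add_mem _ (Submodule.add_mem _ h1 h2)
    (Submodule.add_mem _ h3 h4)) (Submodule.add_mem _ h5 h6), fun t => ?_⟩
  beta_reduce
  rw [hc t, hd t]
  simp only [map_add, map_smul, LinearMap.add_apply, LinearMap.smul_apply, Pi.add_apply,
    LinearMap.flip_apply]
  module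

theorem HasJet.neg {c : ℝ → Y} {y₀ y₁ : Y} (hc : HasJet c y₀ y₁) :
    HasJet (fun t => -c t) (-y₀) (-y₁) := hc.map (-LinearMap.id)

theorem HasJet.sub {c d : ℝ → Y} {y₀ y₁ x₀ x₁ : Y} (hc : HasJet c y₀ y₁) (hd : HasJet d x₀ x₁) :
    HasJet (fun t => c t - d t) (y₀ - x₀) (y₁ - x₁) := by
  simp only [sub_eq_add_neg]
  exact hc.add hd.neg

theorem HasJet.smul (a : ℂ) {c : ℝ → Y} {y₀ y₁ : Y} (hc : HasJet c y₀ y₁) :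
    HasJet (fun t => a • c t) (a • y₀) (a • y₁) := hc.map (a • LinearMap.id)

theorem HasJet.sum {ι : Type*} (s : Finset ι) {c : ι → ℝ → Y} {y₀ y₁ : ι → Y}
    (hc : ∀ i ∈ s, HasJet (c i) (y₀ i) (y₁ i)) :
    HasJet (fun t => ∑ i ∈ s, c i t) (∑ i ∈ s, y₀ i) (∑ i ∈ s, y₁ i) := by
  classical
  induction s using Finset.induction_on with
  | empty => simpa using HasJet.const (0 : Y)
  | insert a s ha ih =>
    simp only [Finset.sum_insert ha]
    exact (hc a (Finset.mem_insert_self _ _)).add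
      (ih fun i hi => hc i (Finset.mem_insert_of_mem hi))

theorem HasJet.prodMk {c : ℝ → Y} {d : ℝ → Z} {y₀ y₁ : Y} {z₀ z₁ : Z} (hc : HasJet c y₀ y₁)
    (hd : HasJet d z₀ z₁) : HasJet (fun t => (c t, d t)) (y₀, z₀) (y₁, z₁) := by
  simpa using (hc.map (LinearMap.inl ℂ Y Z)).add (hd.map (LinearMap.inr ℂ Y Z))

theorem HasJet.hasDerivAt (φ : Y →ₗ[ℂ] ℂ) {c : ℝ → Y} {y₀ y₁ : Y} (h : HasJet c y₀ y₁) :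
    HasDerivAt (fun t => φ (c t)) (φ y₁) 0 := by
  obtain ⟨z, hz, h⟩ := h
  have hcont := polyCurves_continuous φ hz
  have h1 : (fun t => φ (c t)) = fun t : ℝ => (φ y₀ + (t : ℂ) * φ y₁)
      + (t : ℂ) * ((t : ℂ) * φ (z t)) := by
    funext t
    rw [h t, map_add, map_add, map_smul, map_smul, smul_eq_mul, smul_eq_mul, pow_two, mul_assoc]
  rw [h1, hasDerivAt_iff_tendsto_slope]
  have h2 : Filter.Tendsto (fun t : ℝ => φ y₁ + (t : ℂ) * φ (z t)) (nhdsWithin 0 {0}ᶜ)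
      (nhds (φ y₁)) := by
    have hc : Continuous fun t : ℝ => φ y₁ + (t : ℂ) * φ (z t) :=
      continuous_const.add (Complex.continuous_ofReal.mul hcont)
    have := (hc.tendsto 0).mono_left (nhdsWithin_le_nhds (s := {0}ᶜ))
    simpa using this
  refine h2.congr' ?_
  filter_upwards [self_mem_nhdsWithin] with t ht
  have ht' : (t : ℂ) ≠ 0 := Complex.ofReal_ne_zero.2 ht
  simp only [slope, vsub_eq_sub, sub_zero, Complex.real_smul, Complex.ofReal_inv,
    Complex.ofReal_zero, zero_mul, add_zero]
  field_simp
  ring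

theorem HasJet.hasVariation {F : X → Y} {u v : X} {y₀ d : Y}
    (h : HasJet (fun t : ℝ => F (u + (t : ℂ) • v)) y₀ d) : HasVariation F u v d :=
  fun φ => h.hasDerivAt φ

theorem eq_of_forall_dual {y z : Y} (h : ∀ φ : Y →ₗ[ℂ] ℂ, φ y = φ z) : y = z := by
  rw [← sub_eq_zero, ← Module.forall_dual_apply_eq_zero_iff ℂ]
  intro φ
  rw [map_sub, h, sub_self]

theorem HasVariation.unique {F : X → Y} {u v : X} {d e : Y} (hd : HasVariation F u v d)
    (he : HasVariation F u v e) : d = e :=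
  eq_of_forall_dual fun φ => (hd φ).unique (he φ)

theorem HasJet.unique {c : ℝ → Y} {y₀ y₁ x₀ x₁ : Y} (h : HasJet c y₀ y₁) (h' : HasJet c x₀ x₁) :
    y₁ = x₁ :=
  eq_of_forall_dual fun φ => (h.hasDerivAt φ).unique (h'.hasDerivAt φ)

theorem HasJet.apply_zero {c : ℝ → Y} {y₀ y₁ : Y} (h : HasJet c y₀ y₁) : c 0 = y₀ := by
  obtain ⟨z, -, h⟩ := h
  simpa using h 0

theorem exists_hasJet {c : ℝ → Y} (hc : c ∈ polyCurves Y) : ∃ y₁, HasJet c (c 0) y₁ := by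
  have key : ∃ y₀ y₁, HasJet c y₀ y₁ := by
    induction hc using Submodule.span_induction with
    | mem c hc =>
      obtain ⟨k, y, rfl⟩ := hc
      match k with
      | 0 => exact ⟨y, 0, by simpa using HasJet.const y⟩
      | 1 => exact ⟨0, y, by simpa using HasJet.affine 0 y⟩
      | k + 2 =>
        refine ⟨0, 0, _, monomial_mem_polyCurves k y, fun t => ?_⟩
        rw [smul_zero, zero_add, zero_add, smul_smul, ← pow_add, add_comm]
    | zero => exact ⟨0, 0, HasJet.const 0⟩
    | add c d _ _ hc hd =>
      obtain ⟨y₀, y₁, hc⟩ := hc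
      obtain ⟨x₀, x₁, hd⟩ := hd
      exact ⟨_, _, hc.add hd⟩
    | smul a c _ hc =>
      obtain ⟨y₀, y₁, hc⟩ := hc
      exact ⟨_, _, hc.smul a⟩
  obtain ⟨y₀, y₁, h⟩ := key
  refine ⟨y₁, ?_⟩
  rw [h.apply_zero]
  exact h

end Jets

/-! ### The R-matrix bracket -/

/-- The R-matrix bracket `[a₊, b₊] - [a₋, b₋]`. -/
def rBracket (a b : Op V) : Op V :=
  (a.plus * b.plus - b.plus * a.plus) - (a.minus * b.minus - b.minus * a.minus)

theorem trace_plus_mul_plus (a b : Op V) : trace (a.plus * b.plus) = 0 :=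
  (a.isDiff_plus.mul b.isDiff_plus).trace_eq_zero

theorem trace_minus_mul_minus (a b : Op V) : trace (a.minus * b.minus) = 0 :=
  trace_eq_zero (a.ordLE_minus.mul b.ordLE_minus) (by norm_num)

theorem Op.IsEven.rBracket {a b : Op V} (ha : a.IsEven) (hb : b.IsEven) :
    (rBracket a b).IsEven :=
  ((ha.plus.mul hb.plus).sub (hb.plus.mul ha.plus)).sub
    ((ha.minus.mul hb.minus).sub (hb.minus.mul ha.minus))

theorem rBracket_plus (a b : Op V) :
    (rBracket a b).plus = a.plus * b.plus - b.plus * a.plus := by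
  rw [rBracket, Op.plus_sub,
    ((a.isDiff_plus.mul b.isDiff_plus).sub (b.isDiff_plus.mul a.isDiff_plus)).plus_eq,
    Op.plus_eq_zero (((a.ordLE_minus.mul b.ordLE_minus).sub
      (b.ordLE_minus.mul a.ordLE_minus)).of_le (by norm_num)), sub_zero]

theorem rBracket_minus (a b : Op V) :
    (rBracket a b).minus = -(a.minus * b.minus - b.minus * a.minus) := by
  rw [Op.minus, rBracket_plus, rBracket]
  abel

theorem rBracket_swap (a b : Op V) : rBracket b a = -rBracket a b := by
  unfold rBracket
  abel

/-- `Θ̃` is the Lie–Poisson structure of the R-matrix bracket. -/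
theorem form_theta {l a b : Op V} (hl : l.IsEven) (ha : a.IsEven) (hb : b.IsEven) :
    form a (theta l b) = trace (l * rBracket b a) := by
  set X := l * b - b * l with hX
  have h1 : trace (a * X.plus) = trace (a.minus * X) := by
    have e1 : a * X.plus = a.plus * X.plus + a.minus * X.plus := by
      rw [← add_mul, a.plus_add_minus]
    have e2 : a.minus * X = a.minus * X.plus + a.minus * X.minus := by
      rw [← mul_add, X.plus_add_minus]
    rw [e1, e2, trace_add, trace_add, trace_plus_mul_plus, trace_minus_mul_minus, zero_add,
      add_zero]
  have c1 : trace (a * (l * b.plus)) = trace (l * (b.plus * a)) := by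
    rw [trace_mul_comm ha (hl.mul hb.plus), mul_assoc]
  have c2 : trace (a * (b.plus * l)) = trace (l * (a * b.plus)) := by
    rw [← mul_assoc, trace_mul_comm (ha.mul hb.plus) hl]
  have c3 : trace (a.minus * (l * b)) = trace (l * (b * a.minus)) := by
    rw [trace_mul_comm ha.minus (hl.mul hb), mul_assoc]
  have c4 : trace (a.minus * (b * l)) = trace (l * (a.minus * b)) := by
    rw [← mul_assoc, trace_mul_comm (ha.minus.mul hb) hl]
  rw [form_eq, theta_eq, mul_sub, trace_sub, h1, mul_sub, trace_sub, c1, c2, hX, mul_sub,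
    trace_sub, c3, c4, ← trace_sub, ← trace_sub, ← trace_sub]
  congr 1
  have ea := a.plus_add_minus
  have eb := b.plus_add_minus
  rw [rBracket]
  generalize a.plus = ap, a.minus = am, b.plus = bp, b.minus = bm at *
  rw [← ea, ← eb]
  noncomm_ring

theorem form_theta_swap {l a b : Op V} (hl : l.IsEven) (ha : a.IsEven) (hb : b.IsEven) :
    form a (theta l b) = -form b (theta l a) := by
  rw [form_theta hl ha hb, form_theta hl hb ha, rBracket_swap, mul_neg, trace_neg]

theorem Op.IsEven.theta {l P : Op V} (hl : l.IsEven) (hP : P.IsEven) : (theta l P).IsEven :=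
  (hl.comm hP.plus).sub (hl.comm hP).plus

/-- The Jacobi identity of `Θ̃`. -/
theorem form_theta_jacobi {l a b c : Op V} (hl : l.IsEven) (ha : a.IsEven) (hb : b.IsEven)
    (hc : c.IsEven) :
    form a (theta (theta l c) b) + form b (theta (theta l a) c) + form c (theta (theta l b) a)
      = 0 := by
  have key : ∀ {a b c : Op V}, a.IsEven → b.IsEven → c.IsEven →
      form a (theta (theta l c) b) = trace (l * rBracket c (rBracket b a)) := by
    intro a b c ha hb hc
    rw [form_theta (hl.theta hc) ha hb, trace_mul_comm (hl.theta hc) (hb.rBracket ha), ← form_eq,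
      form_theta hl (hb.rBracket ha) hc]
  rw [key ha hb hc, key hb hc ha, key hc ha hb, ← trace_add, ← trace_add, ← mul_add, ← mul_add]
  have e : rBracket c (rBracket b a) + rBracket a (rBracket c b) + rBracket b (rBracket a c)
      = 0 := by
    rw [rBracket, rBracket_plus, rBracket_minus, rBracket, rBracket_plus, rBracket_minus,
      rBracket, rBracket_plus, rBracket_minus]
    noncomm_ring
  rw [e, mul_zero, trace_zero]

/-- `Θ̃` as a bilinear map. -/
def thetaL : Op V →ₗ[ℂ] Op V →ₗ[ℂ] Op V :=
  LinearMap.mk₂ ℂ theta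
    (fun l l' P => by
      simp only [theta_eq, add_mul, mul_add, Op.plus_add, Op.plus_sub]
      abel)
    (fun c l P => by
      simp only [theta_eq, smul_mul_assoc, mul_smul_comm, ← smul_sub, Op.plus_smul])
    (fun l P Q => by
      simp only [theta_eq, add_mul, mul_add, Op.plus_add, Op.plus_sub]
      abel)
    (fun c l P => by
      simp only [theta_eq, smul_mul_assoc, mul_smul_comm, ← smul_sub, Op.plus_smul])

theorem theta_eq_thetaL (l P : Op V) : theta l P = thetaL l P := rfl

theorem OrdLE.theta {l : Op V} {J : ℤ} (hl : OrdLE l J) (hJ : 0 ≤ J) (P : Op V) :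
    OrdLE (theta l P) (J - 1) := by
  have e : SuperLax.theta l P = (l * P.plus - P.plus * l).minus
      - (l * P.minus - P.minus * l).plus := by
    have h : l * P - P * l = (l * P.plus - P.plus * l) + (l * P.minus - P.minus * l) := by
      conv_lhs => rw [← P.plus_add_minus]
      noncomm_ring
    have h' : (l * P.plus - P.plus * l).minus
      = (l * P.plus - P.plus * l) - (l * P.plus - P.plus * l).plus := rfl
    rw [theta_eq, h, h', Op.plus_add]
    abel
  rw [e]
  exact ((Op.ordLE_minus _).of_le (by omega)).sub (((hl.mul P.ordLE_minus).of_le (by omega)).sub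
    ((P.ordLE_minus.mul hl).of_le (by omega))).plus

/-! ### Points, tangent vectors and covectors -/

theorem isLaxVar_iff {m : ℕ} {v : Op V} : IsLaxVar m v ↔ v.IsEven ∧ OrdLE v (2 * m - 1) := by
  refine and_congr_right fun _ => ?_
  exact forall_congr' fun j => by rw [Int.sub_one_lt_iff]

theorem IsLax.add {m : ℕ} {l v : Op V} (hl : IsLax m l) (hv : IsLaxVar m v) : IsLax m (l + v) := by
  refine ⟨hl.1.add hv.1, ?_, fun j hj => ?_⟩
  · rw [Op.coeff_add, hl.2.1, hv.2 _ le_rfl, add_zero]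
  · rw [Op.coeff_add, hl.2.2 j hj, hv.2 j hj.le, add_zero]

theorem IsLaxVar.smul {m : ℕ} {v : Op V} (c : ℂ) (hv : IsLaxVar m v) : IsLaxVar m (c • v) :=
  ⟨hv.1.smul c, fun j hj => by rw [Op.coeff_smul, hv.2 j hj, smul_zero]⟩

theorem IsLaxVar.neg {m : ℕ} {v : Op V} (hv : IsLaxVar m v) : IsLaxVar m (-v) :=
  ⟨hv.1.neg, fun j hj => by rw [Op.coeff_neg, hv.2 j hj, neg_zero]⟩

theorem IsPoint.add_smul {m : ℕ} {u v : Phase V N} (hu : IsPoint m u) (hv : IsTangent m v) (c : ℂ) :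
    IsPoint m (u + c • v) :=
  ⟨hu.1.add (hv.1.smul c), fun i => ⟨(hu.2 i).1.add ((hv.2 i).1.smul c),
    (hu.2 i).2.1.add ((hv.2 i).2.1.smul c), (hu.2 i).2.2.1.add ((hv.2 i).2.2.1.smul c),
    (hu.2 i).2.2.2.add ((hv.2 i).2.2.2.smul c)⟩⟩

theorem isEven_dressing {u : Phase V N} (hu : IsEvenOddTuple u) : (dressing u).IsEven :=
  Op.IsEven.sum fun i _ => (isEven_rankOne (k := 0) (hu i).1 (hu i).2.2.1).add
    (isEven_rankOne (k := 1) (hu i).2.2.2 ((hasParity_congr (by decide)).1 (hu i).2.1))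

theorem ordLE_dressing (u : Phase V N) : OrdLE (dressing u) (-1) :=
  OrdLE.sum fun _ _ => (ordLE_rankOne _ _).add (ordLE_rankOne _ _)

theorem isLaxVar_dressing (m : ℕ) {u : Phase V N} (hu : IsEvenOddTuple u) :
    IsLaxVar m (dressing u) :=
  isLaxVar_iff.2 ⟨isEven_dressing hu, (ordLE_dressing u).of_le (by omega)⟩

/-! ### The Bäcklund transformation -/

theorem IsPoint.backlund {m : ℕ} {w : Phase V N} (hw : IsPoint m w) : IsPoint m (backlund w) :=
  ⟨hw.1.add (isLaxVar_dressing m hw.2), hw.2⟩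

theorem IsPoint.backlundInv {m : ℕ} {u : Phase V N} (hu : IsPoint m u) :
    IsPoint m (backlundInv u) := by
  refine ⟨?_, hu.2⟩
  have h := hu.1.add (isLaxVar_dressing m hu.2).neg
  rwa [← sub_eq_add_neg] at h

theorem backlund_backlundInv (u : Phase V N) : backlund (backlundInv u) = u :=
  Prod.ext (sub_add_cancel _ _) rfl

theorem backlundInv_backlund (w : Phase V N) : backlundInv (backlund w) = w :=
  Prod.ext (add_sub_cancel_right _ _) rfl

theorem bijOn_backlund (m : ℕ) :
    Set.BijOn (backlund (V := V) (N := N)) {w | IsPoint m w} {u | IsPoint m u} :=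
  ⟨fun _ hw => IsPoint.backlund hw, (Function.LeftInverse.injective backlundInv_backlund).injOn,
    fun u hu => ⟨backlundInv u, IsPoint.backlundInv hu, backlund_backlundInv u⟩⟩

/-- The derivative of the dressing term at `u` in the direction `v`. -/
def dressingDeriv (u v : Phase V N) : Op V :=
  ∑ i, (rankOne (v.f i) (u.fs i) + rankOne (u.f i) (v.fs i)
      + rankOne (v.Φ i) (u.Φs i) + rankOne (u.Φ i) (v.Φs i))

theorem hasJet_dressing (u v : Phase V N) :
    HasJet (fun t : ℝ => dressing (u + (t : ℂ) • v)) (dressing u) (dressingDeriv u v) := by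
  unfold dressing dressingDeriv
  refine HasJet.sum _ fun i _ => ?_
  rw [add_assoc (rankOne (v.f i) (u.fs i) + _)]
  exact ((HasJet.affine (u.f i) (v.f i)).map₂ rankOneL (HasJet.affine (u.fs i) (v.fs i))).add
    ((HasJet.affine (u.Φ i) (v.Φ i)).map₂ rankOneL (HasJet.affine (u.Φs i) (v.Φs i)))

theorem hasVariation_backlund (w v : Phase V N) :
    HasVariation backlund w v (backlundDeriv w v) := by
  refine HasJet.hasVariation (y₀ := backlund w) ?_
  exact ((HasJet.affine w.l v.l).add (hasJet_dressing w v)).prodMk (HasJet.affine w.2 v.2)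

theorem isCovector_backlundAdj {m : ℕ} {w g : Phase V N} (hw : IsPoint m w) (hg : IsCovector g) :
    IsCovector (backlundAdj w g) :=
  ⟨hg.1, fun i => ⟨(hg.2 i).1.add (hg.1.hasParity_adjAct (hw.2 i).2.2.1),
    (hg.2 i).2.1.add (hg.1.hasParity_act (hw.2 i).2.2.2),
    (hg.2 i).2.2.1.add (hg.1.hasParity_act (hw.2 i).1),
    (hg.2 i).2.2.2.add (hg.1.hasParity_adjAct (hw.2 i).2.1)⟩⟩

theorem pair_add_left (u v w : SFun V) : pair (u + v) w = pair u w + pair v w := by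
  simp only [pair_eq_pairL, map_add, LinearMap.add_apply]

theorem pair_add_right (u v w : SFun V) : pair u (v + w) = pair u v + pair u w :=
  map_add (pairL u) v w

theorem pair_neg_left (u v : SFun V) : pair (-u) v = -pair u v := by
  simp only [pair_eq_pairL, map_neg, LinearMap.neg_apply]

theorem pairing_backlundAdj {m : ℕ} {w v g : Phase V N} (hw : IsPoint m w) (hv : IsTangent m v)
    (hg : IsCovector g) : pairing (backlundAdj w g) v = pairing g (backlundDeriv w v) := by
  have h : form g.l (dressingDeriv w v) = ∑ i, (pair (v.f i) (adjAct g.l (w.fs i))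
      + pair (act g.l (w.f i)) (v.fs i) + pair (v.Φ i) (adjAct g.l (w.Φs i))
      + pair (act g.l (w.Φ i)) (v.Φs i)) := by
    rw [form_eq, dressingDeriv, Finset.mul_sum, trace_sum]
    refine Finset.sum_congr rfl fun i _ => ?_
    rw [mul_add, mul_add, mul_add, trace_add, trace_add, trace_add, trace_mul_rankOne,
      trace_mul_rankOne, trace_mul_rankOne, trace_mul_rankOne,
      pair_act hg.1 (k := 0) (hv.2 i).1 (hw.2 i).2.2.1,
      pair_act hg.1 (k := 1) (hv.2 i).2.2.2 ((hasParity_congr (by decide)).1 (hw.2 i).2.1)]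
  have e : form g.l (v.l + dressingDeriv w v) = form g.l v.l + form g.l (dressingDeriv w v) :=
    map_add (formL g.l) _ _
  change form g.l v.l + ∑ i, (pair (v.f i) (g.f i + adjAct g.l (w.fs i))
      + pair (g.Φs i + act g.l (w.Φ i)) (v.Φs i) + pair (g.fs i + act g.l (w.f i)) (v.fs i)
      + pair (v.Φ i) (g.Φ i + adjAct g.l (w.Φs i)))
    = form g.l (v.l + dressingDeriv w v) + ∑ i, (pair (v.f i) (g.f i) + pair (g.Φs i) (v.Φs i)
      + pair (g.fs i) (v.fs i) + pair (v.Φ i) (g.Φ i))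
  rw [e, h, add_assoc, ← Finset.sum_add_distrib]
  congr 1
  refine Finset.sum_congr rfl fun i _ => ?_
  simp only [pair_add_left, pair_add_right]
  abel

/-! ### Explicit forms of the Poisson structure -/

theorem rankOne_neg_left (u v : SFun V) : rankOne (-u) v = -rankOne u v := by
  simp only [rankOne_eq_rankOneL, map_neg, LinearMap.neg_apply]

theorem rankOne_add_left (u v w : SFun V) : rankOne (u + v) w = rankOne u w + rankOne v w := by
  simp only [rankOne_eq_rankOneL, map_add, LinearMap.add_apply]

theorem rankOne_add_right (u v w : SFun V) : rankOne u (v + w) = rankOne u v + rankOne u w :=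
  map_add (rankOneL u) v w

theorem extendedL_eq_explicitL (u g : Phase V N) : extendedL u g = explicitL u g := by
  refine Prod.ext ?_ (Prod.ext ?_ (Prod.ext rfl (Prod.ext rfl ?_)))
  · refine congrArg (theta (backlundInv u).l g.l + ·) (Finset.sum_congr rfl fun i _ => ?_)
    set h := backlundAdj (backlundInv u) g
    change rankOne (-(h.fs i)) (u.fs i) + rankOne (u.f i) (h.f i) + rankOne (-(h.Φs i)) (u.Φs i)
      + rankOne (u.Φ i) (h.Φ i) = _
    rw [rankOne_neg_left, rankOne_neg_left]
    abel
  · funext i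
    exact neg_add' _ _
  · funext i
    exact neg_add' _ _

theorem extendedL_l {m : ℕ} {u g : Phase V N} (hu : IsPoint m u) (hg : IsCovector g) :
    (extendedL u g).l = explicitFirstRow u g := by
  rw [extendedL_eq_explicitL]
  have h1 : theta (backlundInv u).l g.l = theta u.l g.l - theta (dressing u) g.l :=
    LinearMap.map_sub₂ thetaL u.l (dressing u) g.l
  have h2 : theta (dressing u) g.l
      = ∑ i, (theta (rankOne (u.f i) (u.fs i)) g.l + theta (rankOne (u.Φ i) (u.Φs i)) g.l) := by
    simp only [theta_eq_thetaL, dressing, map_sum, LinearMap.sum_apply, map_add,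
      LinearMap.add_apply]
  change theta (backlundInv u).l g.l
      + ∑ i, (rankOne (u.f i) (g.f i + adjAct g.l (u.fs i))
        - rankOne (g.fs i + act g.l (u.f i)) (u.fs i)
        + rankOne (u.Φ i) (g.Φ i + adjAct g.l (u.Φs i))
        - rankOne (g.Φs i + act g.l (u.Φ i)) (u.Φs i))
    = theta u.l g.l + ∑ i, (rankOne (u.f i) (g.f i) - rankOne (g.fs i) (u.fs i)
      + rankOne (u.Φ i) (g.Φ i) - rankOne (g.Φs i) (u.Φs i))
  rw [h1, h2, sub_add_eq_add_sub, add_sub_assoc, ← Finset.sum_sub_distrib]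
  congr 1
  refine Finset.sum_congr rfl fun i _ => ?_
  rw [theta_rankOne hg.1 _ (hu.2 i).2.2.1, theta_rankOne hg.1 _ (hu.2 i).2.1]
  simp only [rankOne_add_left, rankOne_add_right]
  abel

/-! ### The Poisson property -/

theorem isTangent_extendedL {m : ℕ} {u a : Phase V N} (hu : IsPoint m u) (ha : IsCovector a) :
    IsTangent m (extendedL u a) := by
  have hh := isCovector_backlundAdj hu.backlundInv ha
  have hw := hu.backlundInv
  refine ⟨isLaxVar_iff.2 ⟨?_, ?_⟩, fun i => ⟨(hh.2 i).2.2.1.neg, (hh.2 i).2.2.2, (hh.2 i).1,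
    (hh.2 i).2.1.neg⟩⟩
  · refine (hw.1.1.theta ha.1).add (Op.IsEven.sum fun i _ => ?_)
    exact (((isEven_rankOne (k := 0) (hh.2 i).2.2.1.neg (hu.2 i).2.2.1).add
      (isEven_rankOne (k := 0) (hu.2 i).1 (hh.2 i).1)).add
      (isEven_rankOne (k := 1) (hh.2 i).2.1.neg ((hasParity_congr (by decide)).1 (hu.2 i).2.1))).add
      (isEven_rankOne (k := 1) (hu.2 i).2.2.2 ((hasParity_congr (by decide)).1 (hh.2 i).2.2.2))
  · refine (OrdLE.theta hw.1.2.2 (by omega) _).add (OrdLE.sum fun i _ => ?_)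
    exact ((((ordLE_rankOne _ _).add (ordLE_rankOne _ _)).add (ordLE_rankOne _ _)).add
      (ordLE_rankOne _ _)).of_le (by omega)

theorem extendedL_add_smul (u a b : Phase V N) (c : ℂ) :
    extendedL u (a + c • b) = extendedL u a + c • extendedL u b := by
  have hact : ∀ f, act (a.l + c • b.l) f = act a.l f + c • act b.l f := fun f => by
    simp only [act_eq_actL, map_add, map_smul, LinearMap.add_apply, LinearMap.smul_apply]
  have hadj : ∀ f, adjAct (a.l + c • b.l) f = adjAct a.l f + c • adjAct b.l f := fun f => by
    simp only [adjAct_eq_adjActL, map_add, map_smul, LinearMap.add_apply, LinearMap.smul_apply]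
  have hadjoint : backlundAdj (backlundInv u) (a + c • b)
      = backlundAdj (backlundInv u) a + c • backlundAdj (backlundInv u) b := by
    refine Prod.ext rfl (Prod.ext ?_ (Prod.ext ?_ (Prod.ext ?_ ?_))) <;> funext i
    · change a.f i + c • b.f i + adjAct (a.l + c • b.l) _
        = a.f i + adjAct a.l _ + c • (b.f i + adjAct b.l _)
      rw [hadj]
      module
    · change a.Φs i + c • b.Φs i + act (a.l + c • b.l) _
        = a.Φs i + act a.l _ + c • (b.Φs i + act b.l _)
      rw [hact]
      module
    · change a.fs i + c • b.fs i + act (a.l + c • b.l) _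
        = a.fs i + act a.l _ + c • (b.fs i + act b.l _)
      rw [hact]
      module
    · change a.Φ i + c • b.Φ i + adjAct (a.l + c • b.l) _
        = a.Φ i + adjAct a.l _ + c • (b.Φ i + adjAct b.l _)
      rw [hadj]
      module
  unfold extendedL
  rw [hadjoint]
  set w := backlundInv u
  set p := backlundAdj w a
  set q := backlundAdj w b
  have htensor : tensorL w (p + c • q) = tensorL w p + c • tensorL w q := by
    refine Prod.ext ?_ (Prod.ext ?_ (Prod.ext rfl (Prod.ext rfl ?_)))
    · exact (map_add (thetaL w.l) _ _).trans (congrArg _ (map_smul (thetaL w.l) _ _))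
    · change -(p.fs + c • q.fs) = -p.fs + c • -q.fs
      module
    · change -(p.Φs + c • q.Φs) = -p.Φs + c • -q.Φs
      module
  rw [htensor]
  set x := tensorL w p
  set y := tensorL w q
  refine Prod.ext ?_ rfl
  change x.l + c • y.l + ∑ i, (rankOne (x.f i + c • y.f i) (w.fs i)
      + rankOne (w.f i) (x.fs i + c • y.fs i) + rankOne (x.Φ i + c • y.Φ i) (w.Φs i)
      + rankOne (w.Φ i) (x.Φs i + c • y.Φs i))
    = x.l + dressingDeriv w x + c • (y.l + dressingDeriv w y)
  rw [smul_add, add_add_add_comm, dressingDeriv, dressingDeriv, Finset.smul_sum,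
    ← Finset.sum_add_distrib]
  congr 1
  refine Finset.sum_congr rfl fun i _ => ?_
  simp only [rankOne_eq_rankOneL, map_add, map_smul, LinearMap.add_apply, LinearMap.smul_apply]
  module

/-- The value `⟨a, L_u b⟩`, computed in the variables of the tensor product structure. -/
theorem pairing_extendedL {m : ℕ} {u a b : Phase V N} (hu : IsPoint m u) (ha : IsCovector a)
    (hb : IsCovector b) :
    pairing a (extendedL u b) = form a.l (theta (u.l - dressing u) b.l)
      + ∑ i, (pair (a.fs i + act a.l (u.f i)) (b.f i + adjAct b.l (u.fs i))
        - pair (b.fs i + act b.l (u.f i)) (a.f i + adjAct a.l (u.fs i))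
        + (pair (a.Φs i + act a.l (u.Φ i)) (b.Φ i + adjAct b.l (u.Φs i))
        - pair (b.Φs i + act b.l (u.Φ i)) (a.Φ i + adjAct a.l (u.Φs i)))) := by
  have hw := hu.backlundInv
  have hb' := isCovector_backlundAdj hw hb
  have hT : IsTangent m (tensorL (backlundInv u) (backlundAdj (backlundInv u) b)) :=
    ⟨isLaxVar_iff.2 ⟨hw.1.1.theta hb.1, OrdLE.theta hw.1.2.2 (by omega) _⟩,
      fun i => ⟨(hb'.2 i).2.2.1.neg, (hb'.2 i).2.2.2, (hb'.2 i).1, (hb'.2 i).2.1.neg⟩⟩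
  rw [extendedL, ← pairing_backlundAdj hw hT ha]
  refine congrArg (form a.l (theta (u.l - dressing u) b.l) + ·)
    (Finset.sum_congr rfl fun i _ => ?_)
  change pair (-(b.fs i + act b.l (u.f i))) (a.f i + adjAct a.l (u.fs i))
    + pair (a.Φs i + act a.l (u.Φ i)) (b.Φ i + adjAct b.l (u.Φs i))
    + pair (a.fs i + act a.l (u.f i)) (b.f i + adjAct b.l (u.fs i))
    + pair (-(b.Φs i + act b.l (u.Φ i))) (a.Φ i + adjAct a.l (u.Φs i)) = _
  rw [pair_neg_left, pair_neg_left]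
  abel

theorem pairing_extendedL_swap {m : ℕ} {u a b : Phase V N} (hu : IsPoint m u) (ha : IsCovector a)
    (hb : IsCovector b) : pairing a (extendedL u b) = -pairing b (extendedL u a) := by
  have hw : (u.l - dressing u).IsEven := hu.backlundInv.1.1
  rw [pairing_extendedL hu ha hb, pairing_extendedL hu hb ha, form_theta_swap hw ha.1 hb.1, neg_add,
    ← Finset.sum_neg_distrib]
  congr 1
  exact Finset.sum_congr rfl fun i _ => by abel

/-- The part of the derivative of `⟨a, L b⟩` along `v` that comes from the functions. -/
def functionVariation (u a b v : Phase V N) : Grassmann V :=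
  ∑ i, (pair (act a.l (v.f i)) (b.f i + adjAct b.l (u.fs i))
      + pair (a.fs i + act a.l (u.f i)) (adjAct b.l (v.fs i))
      - (pair (act b.l (v.f i)) (a.f i + adjAct a.l (u.fs i))
        + pair (b.fs i + act b.l (u.f i)) (adjAct a.l (v.fs i)))
      + (pair (act a.l (v.Φ i)) (b.Φ i + adjAct b.l (u.Φs i))
        + pair (a.Φs i + act a.l (u.Φ i)) (adjAct b.l (v.Φs i))
      - (pair (act b.l (v.Φ i)) (a.Φ i + adjAct a.l (u.Φs i))
        + pair (b.Φs i + act b.l (u.Φ i)) (adjAct a.l (v.Φs i)))))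

theorem hasVariation_pairing_extendedL {m : ℕ} {u a b v : Phase V N} (hu : IsPoint m u)
    (hv : IsTangent m v) (ha : IsCovector a) (hb : IsCovector b) :
    HasVariation (fun w => pairing a (extendedL w b)) u v
      (form a.l (theta (v.l - dressingDeriv u v) b.l) + functionVariation u a b v) := by
  refine HasJet.hasVariation (y₀ := pairing a (extendedL u b)) ?_
  simp only [fun t : ℝ => pairing_extendedL (hu.add_smul hv (t : ℂ)) ha hb,
    pairing_extendedL hu ha hb]
  have hact : ∀ (g : SFun V) (P : Op V) (x y : SFun V),
      HasJet (fun t : ℝ => g + act P (x + (t : ℂ) • y)) (g + act P x) (act P y) := by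
    intro g P x y
    have h := (HasJet.const g).add ((HasJet.affine x y).map (actL P))
    rw [zero_add] at h
    exact h
  have hadj : ∀ (g : SFun V) (P : Op V) (x y : SFun V),
      HasJet (fun t : ℝ => g + adjAct P (x + (t : ℂ) • y)) (g + adjAct P x) (adjAct P y) := by
    intro g P x y
    have h := (HasJet.const g).add ((HasJet.affine x y).map (adjActL P))
    rw [zero_add] at h
    exact h
  refine HasJet.add ?_ (HasJet.sum _ fun i _ => ?_)
  · exact (((HasJet.affine u.l v.l).sub (hasJet_dressing u v)).map (thetaL.flip b.l)).map
      (formL a.l)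
  · refine HasJet.add (HasJet.sub ?_ ?_) (HasJet.sub ?_ ?_)
    · exact (hact _ _ (u.f i) (v.f i)).map₂ pairL (hadj _ _ (u.fs i) (v.fs i))
    · exact (hact _ _ (u.f i) (v.f i)).map₂ pairL (hadj _ _ (u.fs i) (v.fs i))
    · exact (hact _ _ (u.Φ i) (v.Φ i)).map₂ pairL (hadj _ _ (u.Φs i) (v.Φs i))
    · exact (hact _ _ (u.Φ i) (v.Φ i)).map₂ pairL (hadj _ _ (u.Φs i) (v.Φs i))

theorem functionVariation_jacobi {m : ℕ} {u a b c : Phase V N} (hu : IsPoint m u)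
    (ha : IsCovector a) (hb : IsCovector b) (hc : IsCovector c) :
    functionVariation u a b (extendedL u c) + functionVariation u b c (extendedL u a)
      + functionVariation u c a (extendedL u b) = 0 := by
  -- in terms of `S_P(x, y) = ∫ res P (x_{f^*} D⁻¹ y_f + y_{f^*} D⁻¹ x_f + …)`, which is symmetric
  -- in `x` and `y`, the variation is `S_b(c, a) - S_a(b, c)`
  have key : ∀ {a b c : Phase V N}, IsCovector a → IsCovector b → IsCovector c →
      functionVariation u a b (extendedL u c) = ∑ i,
        ((pair (act b.l (a.fs i + act a.l (u.f i))) (c.f i + adjAct c.l (u.fs i))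
          + pair (act b.l (c.fs i + act c.l (u.f i))) (a.f i + adjAct a.l (u.fs i))
          + pair (act b.l (a.Φs i + act a.l (u.Φ i))) (c.Φ i + adjAct c.l (u.Φs i))
          + pair (act b.l (c.Φs i + act c.l (u.Φ i))) (a.Φ i + adjAct a.l (u.Φs i)))
        - (pair (act a.l (b.fs i + act b.l (u.f i))) (c.f i + adjAct c.l (u.fs i))
          + pair (act a.l (c.fs i + act c.l (u.f i))) (b.f i + adjAct b.l (u.fs i))
          + pair (act a.l (b.Φs i + act b.l (u.Φ i))) (c.Φ i + adjAct c.l (u.Φs i))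
          + pair (act a.l (c.Φs i + act c.l (u.Φ i))) (b.Φ i + adjAct b.l (u.Φs i)))) := by
    intro a b c ha hb hc
    have ha' := isCovector_backlundAdj hu.backlundInv ha
    have hb' := isCovector_backlundAdj hu.backlundInv hb
    have hc' := isCovector_backlundAdj hu.backlundInv hc
    refine Finset.sum_congr rfl fun i _ => ?_
    have p1 := pair_act hb.1 (k := 0) (ha'.2 i).2.2.1 (hc'.2 i).1
    have p2 := pair_act ha.1 (k := 0) (hb'.2 i).2.2.1 (hc'.2 i).1
    have p3 := pair_act hb.1 (k := 1) (ha'.2 i).2.1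
      ((hasParity_congr (by decide)).1 (hc'.2 i).2.2.2)
    have p4 := pair_act ha.1 (k := 1) (hb'.2 i).2.1
      ((hasParity_congr (by decide)).1 (hc'.2 i).2.2.2)
    have hneg : ∀ (P : Op V) (f : SFun V), act P (-f) = -act P f := fun P f => map_neg (actL P) f
    change pair (act a.l (-(c.fs i + act c.l (u.f i)))) (b.f i + adjAct b.l (u.fs i))
      + pair (a.fs i + act a.l (u.f i)) (adjAct b.l (c.f i + adjAct c.l (u.fs i)))
      - (pair (act b.l (-(c.fs i + act c.l (u.f i)))) (a.f i + adjAct a.l (u.fs i))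
        + pair (b.fs i + act b.l (u.f i)) (adjAct a.l (c.f i + adjAct c.l (u.fs i))))
      + (pair (act a.l (-(c.Φs i + act c.l (u.Φ i)))) (b.Φ i + adjAct b.l (u.Φs i))
        + pair (a.Φs i + act a.l (u.Φ i)) (adjAct b.l (c.Φ i + adjAct c.l (u.Φs i)))
      - (pair (act b.l (-(c.Φs i + act c.l (u.Φ i)))) (a.Φ i + adjAct a.l (u.Φs i))
        + pair (b.Φs i + act b.l (u.Φ i)) (adjAct a.l (c.Φ i + adjAct c.l (u.Φs i))))) = _
    rw [hneg, hneg, hneg, hneg, pair_neg_left, pair_neg_left, pair_neg_left, pair_neg_left]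
    refine Eq.trans ?_ (congrArg₂ (· - ·) (congrArg₂ (· + ·) (congrArg₂ (· + ·)
      (congrArg₂ (· + ·) p1.symm rfl) p3.symm) rfl) (congrArg₂ (· + ·) (congrArg₂ (· + ·)
      (congrArg₂ (· + ·) p2.symm rfl) p4.symm) rfl))
    change _ = pair (a.fs i + act a.l (u.f i)) (adjAct b.l (c.f i + adjAct c.l (u.fs i)))
        + pair (act b.l (c.fs i + act c.l (u.f i))) (a.f i + adjAct a.l (u.fs i))
        + pair (a.Φs i + act a.l (u.Φ i)) (adjAct b.l (c.Φ i + adjAct c.l (u.Φs i)))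
        + pair (act b.l (c.Φs i + act c.l (u.Φ i))) (a.Φ i + adjAct a.l (u.Φs i))
      - (pair (b.fs i + act b.l (u.f i)) (adjAct a.l (c.f i + adjAct c.l (u.fs i)))
        + pair (act a.l (c.fs i + act c.l (u.f i))) (b.f i + adjAct b.l (u.fs i))
        + pair (b.Φs i + act b.l (u.Φ i)) (adjAct a.l (c.Φ i + adjAct c.l (u.Φs i)))
        + pair (act a.l (c.Φs i + act c.l (u.Φ i))) (b.Φ i + adjAct b.l (u.Φs i)))
    abel
  rw [key ha hb hc, key hb hc ha, key hc ha hb, ← Finset.sum_add_distrib, ← Finset.sum_add_distrib]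
  exact Finset.sum_eq_zero fun i _ => by abel

theorem extendedL_l_sub_dressingDeriv (u c : Phase V N) :
    (extendedL u c).l - dressingDeriv u (extendedL u c) = theta (u.l - dressing u) c.l :=
  add_sub_cancel_right _ _

theorem isPoisson_extendedL (m : ℕ) : IsPoisson m (extendedL (V := V) (N := N)) := by
  intro u hu
  refine ⟨fun a ha => isTangent_extendedL hu ha, fun a b _ _ c => extendedL_add_smul u a b c,
    fun a b ha hb => pairing_extendedL_swap hu ha hb, fun a b c ha hb hc => ⟨_, _, _,
      hasVariation_pairing_extendedL hu (isTangent_extendedL hu hc) ha hb,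
      hasVariation_pairing_extendedL hu (isTangent_extendedL hu ha) hb hc,
      hasVariation_pairing_extendedL hu (isTangent_extendedL hu hb) hc ha, ?_⟩⟩
  rw [extendedL_l_sub_dressingDeriv, extendedL_l_sub_dressingDeriv, extendedL_l_sub_dressingDeriv]
  have h := congrArg₂ (· + ·) (form_theta_jacobi hu.backlundInv.1.1 ha.1 hb.1 hc.1)
    (functionVariation_jacobi hu ha hb hc)
  rw [add_zero] at h
  refine Eq.trans ?_ h
  change _ = (form a.l (theta (theta (u.l - dressing u) c.l) b.l)
    + form b.l (theta (theta (u.l - dressing u) a.l) c.l)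
    + form c.l (theta (theta (u.l - dressing u) b.l) a.l)) + _
  abel

/-! ### Fixed points of contractions of formal operators -/

theorem ordLE_sub_one {P : Op V} {J : ℤ} (h : OrdLE P J) (h0 : P.coeff J = 0) : OrdLE P (J - 1) :=
  fun j hj => by
    rcases eq_or_lt_of_le (Int.sub_one_lt_iff.1 hj) with h1 | h1
    · rw [← h1, h0]
    · exact h j h1

/-- A map that lowers the order of differences has a fixed point, whose coefficients are those of
the iterates. -/
theorem exists_fixedPoint (F : Op V → Op V) (x₀ : Op V) (K : ℤ) (h0 : OrdLE (F x₀ - x₀) K)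
    (hF : ∀ a b J, OrdLE (a - x₀) K → OrdLE (b - x₀) K → OrdLE (a - b) J →
      OrdLE (F a - F b) (J - 1)) :
    ∃ x, OrdLE (x - x₀) K ∧ F x = x ∧
      ∀ j, x.coeff j = (F^[(K - j).toNat + 1] x₀).coeff j := by
  have hball : ∀ n, OrdLE (F^[n] x₀ - x₀) K := by
    intro n
    induction n with
    | zero => rw [Function.iterate_zero_apply, sub_self]; exact OrdLE.zero _
    | succ n ih =>
      have h1 := hF (F^[n] x₀) x₀ K ih (by rw [sub_self]; exact OrdLE.zero _) ih
      rw [← Function.iterate_succ_apply' F] at h1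
      have h2 := (h1.of_le (by omega)).add h0
      rwa [sub_add_sub_cancel] at h2
  have hstep : ∀ n : ℕ, OrdLE (F^[n + 1] x₀ - F^[n] x₀) (K - n) := by
    intro n
    induction n with
    | zero => simpa using h0
    | succ n ih =>
      have h1 := hF _ _ _ (hball (n + 1)) (hball n) ih
      rw [← Function.iterate_succ_apply' F, ← Function.iterate_succ_apply' F] at h1
      exact h1.of_le (by push_cast; omega)
  have hstable : ∀ n k : ℕ, OrdLE (F^[n + k] x₀ - F^[n] x₀) (K - n) := by
    intro n k
    induction k with
    | zero => rw [add_zero, sub_self]; exact OrdLE.zero _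
    | succ k ih =>
      have h1 := ((hstep (n + k)).of_le (show K - ((n + k : ℕ) : ℤ) ≤ K - n by
        push_cast; omega)).add ih
      rwa [sub_add_sub_cancel] at h1
  obtain ⟨J, hJ⟩ := x₀.exists_ordLE
  have hord : ∀ n, OrdLE (F^[n] x₀) (max J K) := fun n => by
    have h1 := ((hball n).of_le (le_max_right J K)).add (hJ.of_le (le_max_left J K))
    rwa [sub_add_cancel] at h1
  let x : Op V := ⟨fun j => (F^[(K - j).toNat + 1] x₀).coeff j, max J K, fun j hj => hord _ j hj⟩
  have hx : ∀ j, x.coeff j = (F^[(K - j).toNat + 1] x₀).coeff j := fun _ => rfl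
  have hlim : ∀ n : ℕ, OrdLE (x - F^[n] x₀) (K - n) := by
    intro n j hj
    rw [Op.coeff_sub, hx]
    have hle : (K - j).toNat + 1 ≤ n ∨ n ≤ (K - j).toNat + 1 := le_total _ _
    rcases hle with h | h
    · obtain ⟨k, rfl⟩ := Nat.exists_eq_add_of_le h
      have h1 := hstable ((K - j).toNat + 1) k j (by push_cast; omega)
      rw [Op.coeff_sub, sub_eq_zero] at h1
      rw [h1, sub_self]
    · obtain ⟨k, hk⟩ := Nat.exists_eq_add_of_le h
      rw [hk]
      exact hstable n k j hj
  have hx0 : OrdLE (x - x₀) K := by simpa using hlim 0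
  refine ⟨x, hx0, ?_, hx⟩
  rw [← sub_eq_zero]
  refine Op.eq_zero_of_ordLE fun J' => ?_
  have h1 : ∀ n : ℕ, OrdLE (F x - x) (K - n) := fun n => by
    have h2 := (hF _ _ _ hx0 (hball n) (hlim n)).of_le (show K - n - 1 ≤ K - n by omega)
    have h3 := hlim (n + 1)
    rw [Function.iterate_succ_apply'] at h3
    have h4 := h2.sub (h3.of_le (show K - ((n + 1 : ℕ) : ℤ) ≤ K - n by push_cast; omega))
    rwa [sub_sub_sub_cancel_right] at h4
  exact (h1 (K - J').toNat).of_le (by omega)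

theorem fixedPoint_unique (F : Op V → Op V) (x₀ : Op V) (K : ℤ)
    (hF : ∀ a b J, OrdLE (a - x₀) K → OrdLE (b - x₀) K → OrdLE (a - b) J →
      OrdLE (F a - F b) (J - 1)) {x y : Op V} (hx : OrdLE (x - x₀) K) (hy : OrdLE (y - x₀) K)
    (hFx : F x = x) (hFy : F y = y) : x = y := by
  have h : ∀ n : ℕ, OrdLE (x - y) (K - n) := by
    intro n
    induction n with
    | zero =>
      have h1 := hx.sub hy
      rw [sub_sub_sub_cancel_right] at h1
      simpa using h1
    | succ n ih =>
      have h1 := hF x y _ hx hy ih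
      rw [hFx, hFy] at h1
      exact h1.of_le (by push_cast; omega)
  rw [← sub_eq_zero]
  exact Op.eq_zero_of_ordLE fun J => (h (K - J).toNat).of_le (by omega)

/-! ### Inverses of monic operators -/

/-- `P = D_θ^d + (terms of lower order)`. -/
def Op.Monic (d : ℤ) (P : Op V) : Prop := OrdLE P d ∧ P.coeff d = 1

theorem Op.monic_iff {d : ℤ} {P : Op V} : P.Monic d ↔ OrdLE (P - Op.mono 1 d) (d - 1) := by
  constructor
  · rintro ⟨h1, h2⟩
    refine ordLE_sub_one (h1.sub (OrdLE.mono 1 d)) ?_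
    rw [Op.coeff_sub, h2, Op.coeff_mono, if_pos rfl, sub_self]
  · intro h
    have h1 := (h.of_le (show d - 1 ≤ d by omega)).add (OrdLE.mono 1 d)
    rw [sub_add_cancel] at h1
    refine ⟨h1, ?_⟩
    have h2 := h d (by omega)
    rwa [Op.coeff_sub, sub_eq_zero, Op.coeff_mono, if_pos rfl] at h2

theorem IsLax.monic {m : ℕ} {l : Op V} (hl : IsLax m l) : l.Monic (2 * m) := ⟨hl.2.2, hl.2.1⟩

theorem Op.Monic.mono (d : ℤ) : (Op.mono (1 : SFun V) d).Monic d :=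
  ⟨OrdLE.mono 1 d, if_pos rfl⟩

theorem Op.Monic.mul {d e : ℤ} {P Q : Op V} (hP : P.Monic d) (hQ : Q.Monic e) :
    (P * Q).Monic (d + e) :=
  ⟨hP.1.mul hQ.1, (coeff_comp_top hP.1 hQ.1).trans (by rw [hP.2, hQ.2, twist_one, one_mul])⟩

theorem Op.Monic.pow {d : ℤ} {P : Op V} (hP : P.Monic d) (n : ℕ) : (P ^ n).Monic (n * d) := by
  induction n with
  | zero =>
    rw [pow_zero, Nat.cast_zero, zero_mul]
    exact Op.Monic.mono 0
  | succ n ih =>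
    rw [pow_succ, Nat.cast_succ, add_mul, one_mul]
    exact ih.mul hP

theorem Op.Monic.ordLE_sub {d : ℤ} {P Q : Op V} (hP : P.Monic d) (hQ : Q.Monic d) :
    OrdLE (P - Q) (d - 1) := by
  have h := (Op.monic_iff.1 hP).sub (Op.monic_iff.1 hQ)
  rwa [sub_sub_sub_cancel_right] at h

theorem isEven_mono_one {d : ℤ} (hd : Even d) : (Op.mono (1 : SFun V) d).IsEven :=
  Op.isEven_iff.2 ((Op.HasParity.mono_one d).congr (by rwa [sub_zero]))

theorem Op.IsEven.iterate {F : Op V → Op V} (hF : ∀ x, x.IsEven → (F x).IsEven) {x₀ : Op V}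
    (h0 : x₀.IsEven) (n : ℕ) : (F^[n] x₀).IsEven := by
  induction n with
  | zero => exact h0
  | succ n ih => rw [Function.iterate_succ_apply']; exact hF _ ih

theorem mul_mono_one_cancel {P : Op V} {d : ℤ} (h : P * Op.mono 1 d = 0) : P = 0 := by
  have h1 : P * Op.mono 1 d * Op.mono 1 (-d) = 0 := by rw [h, zero_mul]
  rwa [mul_assoc, mono_one_mul_mono_one, add_neg_cancel, ← Op.one_def, mul_one] at h1

theorem mono_one_mul_cancel {P : Op V} {d : ℤ} (h : Op.mono 1 d * P = 0) : P = 0 := by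
  have h1 : Op.mono 1 (-d) * (Op.mono 1 d * P) = 0 := by rw [h, mul_zero]
  rwa [← mul_assoc, mono_one_mul_mono_one, neg_add_cancel, ← Op.one_def, one_mul] at h1

theorem Op.Monic.exists_right_inverse {d : ℤ} {l : Op V} (hl : l.Monic d) :
    ∃ s : Op V, l * s = 1 ∧ s.Monic (-d) ∧ (Even d → l.IsEven → s.IsEven) := by
  let D : Op V := Op.mono 1 (-d)
  have hDl : OrdLE (1 - D * l) (-1) := by
    have h := (Op.Monic.mono 0).ordLE_sub (neg_add_cancel d ▸ (Op.Monic.mono (-d)).mul hl)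
    rw [zero_sub] at h
    exact h
  have hlD : OrdLE (1 - l * D) (-1) := by
    have h := (Op.Monic.mono 0).ordLE_sub (add_neg_cancel d ▸ hl.mul (Op.Monic.mono (-d)))
    rw [zero_sub] at h
    exact h
  have hD : OrdLE D (-d) := OrdLE.mono 1 (-d)
  obtain ⟨s, hs1, hs2, hs3⟩ := exists_fixedPoint (fun s => s + D * (1 - l * s)) D (-d - 1)
    (by
      rw [add_sub_cancel_left]
      exact (hD.mul hlD).of_le (by omega))
    (fun a b J _ _ hab => by
      have e : a + D * (1 - l * a) - (b + D * (1 - l * b)) = (1 - D * l) * (a - b) := by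
        noncomm_ring
      rw [e]
      exact (hDl.mul hab).of_le (by omega))
  refine ⟨s, ?_, Op.monic_iff.2 hs1, fun hd hle => ?_⟩
  · have h := mono_one_mul_cancel (add_eq_left.1 hs2)
    exact (sub_eq_zero.1 h).symm
  · have hDe : D.IsEven := isEven_mono_one hd.neg
    intro j
    rw [hs3 j]
    refine Op.IsEven.iterate (fun x hx => ?_) hDe _ j
    exact hx.add (hDe.mul (Op.IsEven.one.sub (hle.mul hx)))

/-- Monic operators are invertible. -/
theorem Op.Monic.exists_inverse {d : ℤ} {l : Op V} (hl : l.Monic d) :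
    ∃ s : Op V, l * s = 1 ∧ s * l = 1 ∧ (Even d → l.IsEven → s.IsEven) := by
  obtain ⟨s, h1, h2, h3⟩ := hl.exists_right_inverse
  obtain ⟨t, h4, -, -⟩ := h2.exists_right_inverse
  refine ⟨s, h1, ?_, h3⟩
  rw [left_inv_eq_right_inv h1 h4, h4]

/-! ### Roots -/

/-- The leading term of `a^n - b^n` for operators `a`, `b` of the form `∂ + …`. -/
theorem pow_sub_pow_top {a b : Op V} (ha : a.Monic 2) (hb : b.Monic 2) {K : ℤ}
    (h : OrdLE (a - b) K) (n : ℕ) : OrdLE (a ^ n - b ^ n) (K + (n * 2 - 2)) ∧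
      (a ^ n - b ^ n).coeff (K + (n * 2 - 2)) = (n : ℂ) • (a - b).coeff K := by
  induction n with
  | zero =>
    rw [pow_zero, pow_zero, sub_self, Nat.cast_zero, Nat.cast_zero, zero_smul]
    exact ⟨OrdLE.zero _, rfl⟩
  | succ n ih =>
    have e : a ^ (n + 1) - b ^ (n + 1) = a ^ n * (a - b) + (a ^ n - b ^ n) * b := by
      rw [pow_succ, pow_succ]
      noncomm_ring
    have e1 : K + ((n + 1 : ℕ) * 2 - 2) = n * 2 + K := by push_cast; ring
    have e2 : (n : ℤ) * 2 + K = K + (n * 2 - 2) + 2 := by ring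
    have han := ha.pow n
    rw [e, e1]
    refine ⟨(han.1.mul h).add ?_, ?_⟩
    · rw [e2]
      exact ih.1.mul hb.1
    · have h1 : (a ^ n * (a - b)).coeff (n * 2 + K) = (a - b).coeff K := by
        rw [← Op.comp_eq_mul, coeff_comp_top han.1 h, han.2, one_mul,
          twist_of_even (even_two.mul_left _)]
      have h2 : ((a ^ n - b ^ n) * b).coeff (n * 2 + K) = (n : ℂ) • (a - b).coeff K := by
        rw [e2, ← Op.comp_eq_mul, coeff_comp_top ih.1 hb.1, hb.2, twist_one, mul_one, ih.2]
      rw [Op.coeff_add, h1, h2, Nat.cast_succ, add_smul, one_smul, add_comm]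

/-- The step `x ↦ x + (l - x^m) D_θ^{2-2m} / m` of the approximation of `l^{1/m}`. -/
def rootStep (m : ℕ) (l x : Op V) : Op V :=
  x + (m : ℂ)⁻¹ • ((l - x ^ m) * Op.mono 1 (2 - m * 2))

theorem rootStep_contraction {m : ℕ} (hm : 1 ≤ m) (l : Op V) (a b : Op V) (J : ℤ)
    (ha : OrdLE (a - Op.mono 1 2) 1) (hb : OrdLE (b - Op.mono 1 2) 1) (hab : OrdLE (a - b) J) :
    OrdLE (rootStep m l a - rootStep m l b) (J - 1) := by
  have hm' : (m : ℂ) ≠ 0 := Nat.cast_ne_zero.2 (by omega)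
  have h := pow_sub_pow_top (Op.monic_iff.2 ha) (Op.monic_iff.2 hb) hab m
  have e : rootStep m l a - rootStep m l b
      = (a - b) - (m : ℂ)⁻¹ • ((a ^ m - b ^ m) * Op.mono 1 (2 - m * 2)) := by
    have e1 : (a ^ m - b ^ m) * Op.mono 1 (2 - m * 2)
        = (l - b ^ m) * Op.mono 1 (2 - m * 2) - (l - a ^ m) * Op.mono 1 (2 - m * 2) := by
      noncomm_ring
    rw [rootStep, rootStep, e1, smul_sub]
    abel
  rw [e]
  refine ordLE_sub_one (hab.sub (OrdLE.smul _ ?_)) ?_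
  · exact (h.1.mul (OrdLE.mono 1 _)).of_le (by omega)
  · rw [Op.coeff_sub, Op.coeff_smul, mul_mono_one_coeff,
      show J - (2 - (m : ℤ) * 2) = J + (m * 2 - 2) by ring, h.2, smul_smul, inv_mul_cancel₀ hm',
      one_smul, sub_self]

theorem rootStep_eq_self_iff {m : ℕ} (hm : 1 ≤ m) (l x : Op V) :
    rootStep m l x = x ↔ x ^ m = l := by
  have hm' : (m : ℂ) ≠ 0 := Nat.cast_ne_zero.2 (by omega)
  constructor
  · intro h
    have h1 := add_eq_left.1 h
    rw [smul_eq_zero_iff_right (inv_ne_zero hm')] at h1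
    exact (sub_eq_zero.1 (mul_mono_one_cancel h1)).symm
  · intro h
    rw [rootStep, h, sub_self, zero_mul, smul_zero, add_zero]

theorem Op.IsEven.rootStep {m : ℕ} {l x : Op V} (hl : l.IsEven) (hx : x.IsEven) :
    (rootStep m l x).IsEven :=
  hx.add (((hl.sub (hx.pow m)).mul (isEven_mono_one (even_two.sub (even_two.mul_left _)))).smul _)

theorem IsRoot.pow_eq {m : ℕ} {l r : Op V} (h : IsRoot m l r) : r ^ m = l := by
  rw [← Op.pow_eq_npow]
  exact h.2

theorem isRoot_unique {m : ℕ} (hm : 1 ≤ m) {l r r' : Op V} (hr : IsRoot m l r)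
    (hr' : IsRoot m l r') : r = r' :=
  fixedPoint_unique (rootStep m l) (Op.mono 1 2) 1 (rootStep_contraction hm l)
    (Op.monic_iff.1 hr.1.monic) (Op.monic_iff.1 hr'.1.monic)
    ((rootStep_eq_self_iff hm l r).2 hr.pow_eq) ((rootStep_eq_self_iff hm l r').2 hr'.pow_eq)

theorem exists_isRoot {m : ℕ} (hm : 1 ≤ m) {l : Op V} (hl : IsLax m l) :
    ∃ r, IsRoot m l r ∧
      ∀ j, r.coeff j = ((rootStep m l)^[(1 - j).toNat + 1] (Op.mono 1 2)).coeff j := by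
  have h0 : OrdLE (rootStep m l (Op.mono 1 2) - Op.mono 1 2) 1 := by
    rw [rootStep, add_sub_cancel_left]
    have h1 := hl.monic
    rw [mul_comm] at h1
    exact (((h1.ordLE_sub ((Op.Monic.mono 2).pow m)).mul (OrdLE.mono 1 _)).smul _).of_le (by omega)
  obtain ⟨r, h1, h2, h3⟩ := exists_fixedPoint (rootStep m l) (Op.mono 1 2) 1 h0
    (rootStep_contraction hm l)
  have hr : r.IsEven := fun j => by
    rw [h3 j]
    exact Op.IsEven.iterate (fun x hx => hl.1.rootStep hx) (isEven_mono_one even_two) _ j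
  have hm2 : r.Monic 2 := Op.monic_iff.2 h1
  refine ⟨r, ⟨⟨hr, ?_, ?_⟩, ?_⟩, h3⟩
  · simpa using hm2.2
  · exact fun j hj => hm2.1 j (by simpa using hj)
  · rw [Op.pow_eq_npow]
    exact (rootStep_eq_self_iff hm l r).1 h2

theorem existsUnique_isRoot {m : ℕ} (hm : 1 ≤ m) {l : Op V} (hl : IsLax m l) :
    ∃! r, IsRoot m l r := by
  obtain ⟨r, hr, -⟩ := exists_isRoot hm hl
  exact ⟨r, hr, fun r' hr' => isRoot_unique hm hr' hr⟩

theorem isRoot_root {m : ℕ} (hm : 1 ≤ m) {l : Op V} (hl : IsLax m l) : IsRoot m l (root m l) := by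
  have h := (existsUnique_isRoot hm hl).exists
  rw [root, dif_pos h]
  exact h.choose_spec

theorem root_coeff {m : ℕ} (hm : 1 ≤ m) {l : Op V} (hl : IsLax m l) (j : ℤ) :
    (root m l).coeff j = ((rootStep m l)^[(1 - j).toNat + 1] (Op.mono 1 2)).coeff j := by
  obtain ⟨r, hr, h⟩ := exists_isRoot hm hl
  rw [isRoot_unique hm (isRoot_root hm hl) hr, h]

/-! ### Jets of curves of operators -/

/-- The curve `c` of operators of bounded order has, coefficient by coefficient, the first-order
jet `a + t b`. The degrees of the coefficients as polynomials in `t` need not be bounded. -/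
def OpJet (c : ℝ → Op V) (a b : Op V) : Prop :=
  ∃ J, (∀ t, OrdLE (c t) J) ∧ OrdLE a J ∧ OrdLE b J ∧
    ∀ k, HasJet (fun t => (c t).coeff k) (a.coeff k) (b.coeff k)

theorem OpJet.affine (l v : Op V) : OpJet (fun t : ℝ => l + (t : ℂ) • v) l v := by
  obtain ⟨J, n, -, hl, hv⟩ := Op.exists_common_ordLE l v
  exact ⟨J, fun t => hl.add (hv.smul _), hl, hv, fun k => HasJet.affine _ _⟩

theorem OpJet.const (a : Op V) : OpJet (fun _ => a) a 0 := by
  obtain ⟨J, hJ⟩ := a.exists_ordLE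
  exact ⟨J, fun _ => hJ, hJ, OrdLE.zero _, fun k => HasJet.const _⟩

theorem OpJet.add {c d : ℝ → Op V} {a b a' b' : Op V} (h : OpJet c a b) (h' : OpJet d a' b') :
    OpJet (fun t => c t + d t) (a + a') (b + b') := by
  obtain ⟨J, h1, h2, h3, h4⟩ := h
  obtain ⟨K, k1, k2, k3, k4⟩ := h'
  have hJ := le_max_left J K
  have hK := le_max_right J K
  exact ⟨max J K, fun t => ((h1 t).of_le hJ).add ((k1 t).of_le hK),
    (h2.of_le hJ).add (k2.of_le hK), (h3.of_le hJ).add (k3.of_le hK), fun k => (h4 k).add (k4 k)⟩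

theorem OpJet.smul (z : ℂ) {c : ℝ → Op V} {a b : Op V} (h : OpJet c a b) :
    OpJet (fun t => z • c t) (z • a) (z • b) := by
  obtain ⟨J, h1, h2, h3, h4⟩ := h
  exact ⟨J, fun t => (h1 t).smul z, h2.smul z, h3.smul z, fun k => (h4 k).smul z⟩

theorem OpJet.sub {c d : ℝ → Op V} {a b a' b' : Op V} (h : OpJet c a b) (h' : OpJet d a' b') :
    OpJet (fun t => c t - d t) (a - a') (b - b') := by
  simpa only [neg_smul, one_smul, ← sub_eq_add_neg] using h.add (h'.smul (-1))

theorem hasJet_leftPow_coeff {c : ℝ → Op V} {a b : Op V} (h : OpJet c a b) (i k : ℤ) :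
    HasJet (fun t => (leftPow i (c t)).coeff k) ((leftPow i a).coeff k)
      ((leftPow i b).coeff k) := by
  obtain ⟨J, h1, h2, h3, h4⟩ := h
  obtain ⟨n, hn⟩ : ∃ n : ℕ, J + i - k < n := ⟨(J + i - k).toNat + 1, by omega⟩
  simp only [fun t => leftPow_coeff (h1 t) hn, leftPow_coeff h2 hn, leftPow_coeff h3 hn]
  exact HasJet.sum _ fun r _ =>
    (h4 (k - i + r)).map (superChoose i r • ((superD ^ r : Module.End ℂ (SFun V)) ∘ₗ twist (i - r)))

/-- The Leibniz rule. -/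
theorem OpJet.mul {c d : ℝ → Op V} {a b a' b' : Op V} (h : OpJet c a b) (h' : OpJet d a' b') :
    OpJet (fun t => c t * d t) (a * a') (b * a' + a * b') := by
  have hd := hasJet_leftPow_coeff h'
  obtain ⟨J, h1, h2, h3, h4⟩ := h
  obtain ⟨K, k1, k2, k3, k4⟩ := h'
  refine ⟨J + K, fun t => (h1 t).mul (k1 t), h2.mul k2, (h3.mul k2).add (h2.mul k3), fun k => ?_⟩
  have e : ∀ {x y : Op V}, OrdLE x J → OrdLE y K → (x * y).coeff k
      = ∑ i ∈ Finset.Icc (k - K) J, x.coeff i * (leftPow i y).coeff k :=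
    fun hx hy => comp_coeff hx hy le_rfl le_rfl
  rw [Op.coeff_add]
  simp only [fun t => e (h1 t) (k1 t), e h2 k2, e h3 k2, e h2 k3]
  rw [← Finset.sum_add_distrib]
  exact HasJet.sum _ fun i _ => (h4 i).map₂ (LinearMap.mul ℂ (SFun V)) (hd i k)

theorem OpJet.pow {c : ℝ → Op V} {a b : Op V} (h : OpJet c a b) (n : ℕ) :
    OpJet (fun t => c t ^ n) (a ^ n) (∑ i ∈ Finset.range n, a ^ i * b * a ^ (n - 1 - i)) := by
  induction n with
  | zero => simpa using OpJet.const (1 : Op V)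
  | succ n ih =>
    have h1 := ih.mul h
    simp only [← pow_succ] at h1
    convert h1 using 1
    rw [Finset.sum_range_succ, Finset.sum_mul]
    congr 1
    · refine Finset.sum_congr rfl fun i hi => ?_
      rw [Finset.mem_range] at hi
      rw [mul_assoc _ _ a, ← pow_succ]
      congr 2
      omega
    · rw [Nat.add_sub_cancel, Nat.sub_self, pow_zero, mul_one]

theorem OpJet.unique {c : ℝ → Op V} {a b a' b' : Op V} (h : OpJet c a b) (h' : OpJet c a' b') :
    b = b' := by
  obtain ⟨J, -, -, -, h⟩ := h
  obtain ⟨J', -, -, -, h'⟩ := h'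
  exact Op.ext fun k => (h k).unique (h' k)

theorem OpJet.isEven {c : ℝ → Op V} {a b : Op V} (h : OpJet c a b) (hc : ∀ t, (c t).IsEven) :
    b.IsEven := by
  obtain ⟨J, -, -, -, h⟩ := h
  intro k
  rw [hasParity_iff]
  have h1 := (h k).map invol
  simp only [fun t => hasParity_iff.1 (hc t k)] at h1
  exact h1.unique ((h k).map (sgn k • LinearMap.id))

theorem OpJet.hasJet_trace {c : ℝ → Op V} {a b : Op V} (h : OpJet c a b) :
    HasJet (fun t => trace (c t)) (trace a) (trace b) := by
  obtain ⟨J, -, -, -, h⟩ := h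
  exact (h (-1)).map berezin

theorem exists_opJet_iterate_rootStep (m : ℕ) {l : ℝ → Op V} {l₀ v : Op V} (hl : OpJet l l₀ v)
    (n : ℕ) : ∃ a b, OpJet (fun t => (rootStep m (l t))^[n] (Op.mono 1 2)) a b := by
  induction n with
  | zero => exact ⟨_, _, OpJet.const _⟩
  | succ n ih =>
    obtain ⟨a, b, h⟩ := ih
    simp only [Function.iterate_succ_apply']
    exact ⟨_, _, h.add (((hl.sub (h.pow m)).mul (OpJet.const _)).smul _)⟩

/-- The coefficients of the root of `l + t v` are polynomials in `t`, since each of them is a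
coefficient of an approximation of the root. -/
theorem exists_opJet_root {m : ℕ} (hm : 1 ≤ m) {l : ℝ → Op V} {l₀ v : Op V} (hl : OpJet l l₀ v)
    (hlax : ∀ t, IsLax m (l t)) : ∃ b, OpJet (fun t => root m (l t)) (root m (l 0)) b := by
  have h1 : ∀ j, ∃ y, HasJet (fun t => (root m (l t)).coeff j) ((root m (l 0)).coeff j) y := by
    intro j
    simp only [fun t => root_coeff hm (hlax t) j]
    obtain ⟨a, b, J, -, -, -, h⟩ := exists_opJet_iterate_rootStep m hl ((1 - j).toNat + 1)
    exact exists_hasJet (h j).mem_polyCurves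
  choose y hy using h1
  have hord : ∀ t, OrdLE (root m (l t)) 2 := fun t =>
    (isRoot_root hm (hlax t)).1.2.2
  have hb : ∀ j, 2 < j → y j = 0 := by
    intro j hj
    have h2 := hy j
    simp only [fun t => hord t j hj] at h2
    exact h2.unique (HasJet.const 0)
  exact ⟨⟨y, 2, hb⟩, 2, hord, hord 0, hb, hy⟩

/-! ### The Casimir functionals -/

theorem trace_sum_pow_mul {x a b : Op V} (hx : x.IsEven) (ha : a.IsEven) (hb : b.IsEven)
    (hxa : Commute x a) (n : ℕ) :
    trace (x * ∑ i ∈ Finset.range n, a ^ i * b * a ^ (n - 1 - i))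
      = (n : ℂ) • trace (x * a ^ (n - 1) * b) := by
  have h : ∀ i ∈ Finset.range n, trace (x * (a ^ i * b * a ^ (n - 1 - i)))
      = trace (x * a ^ (n - 1) * b) := by
    intro i hi
    rw [Finset.mem_range] at hi
    rw [← mul_assoc, ← mul_assoc, trace_mul_comm ((hx.mul (ha.pow i)).mul hb) (ha.pow _),
      ← mul_assoc, ← mul_assoc, (hxa.pow_right _).symm.eq, mul_assoc x, ← pow_add,
      Nat.sub_add_cancel (by omega)]
  rw [Finset.mul_sum, trace_sum, Finset.sum_congr rfl h, Finset.sum_const, Finset.card_range,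
    Nat.cast_smul_eq_nsmul]

/-- The gradient of `γ_n` is `l^{(n+1)/m} l^{-1} / m = l^{(n + 1 - m)/m} / m`. -/
theorem exists_gradient_casimir {m : ℕ} (hm : 1 ≤ m) (n : ℕ) {l : Op V} (hl : IsLax m l) :
    ∃ P : Op V, P.IsEven ∧ l * P = P * l ∧ ∀ v, IsLaxVar m v →
      HasJet (fun t : ℝ => casimir m n (l + (t : ℂ) • v)) (casimir m n l) (form P v) := by
  obtain ⟨s, hls, hsl, hs⟩ := hl.monic.exists_inverse
  have hse : s.IsEven := hs (even_two_mul _) hl.1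
  have hr := isRoot_root hm hl
  set r := root m l with hrdef
  have hre : r.IsEven := hr.1.1
  have hrl : Commute r l := by
    rw [← hr.pow_eq]
    exact Commute.self_pow r m
  have hrs : Commute r s := by
    have h1 : s * (r * l) * s = s * (l * r) * s := by rw [hrl.eq]
    rw [mul_assoc, mul_assoc r, hls, mul_one, ← mul_assoc s l, hsl, one_mul] at h1
    exact h1.symm
  have hsc : Commute l s := by rw [Commute, SemiconjBy, hls, hsl]
  have hQ : (r ^ (n + 1) * s).IsEven := (hre.pow _).mul hse
  refine ⟨(m : ℂ)⁻¹ • (r ^ (n + 1) * s), hQ.smul _, ?_, fun v hv => ?_⟩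
  · rw [mul_smul_comm, smul_mul_assoc]
    congr 1
    exact ((hrl.symm.pow_right _).mul_right hsc).eq
  · have hlax : ∀ t : ℝ, IsLax m (l + (t : ℂ) • v) := fun t => hl.add (hv.smul _)
    have hm' : (m : ℂ) ≠ 0 := Nat.cast_ne_zero.2 (by omega)
    have hn' : (n : ℂ) + 1 ≠ 0 := by exact_mod_cast Nat.succ_ne_zero n
    have hjl := OpJet.affine l v
    obtain ⟨b, hb⟩ := exists_opJet_root hm hjl hlax
    rw [Complex.ofReal_zero, zero_smul, add_zero, ← hrdef] at hb
    have hbe : b.IsEven := hb.isEven fun t => (isRoot_root hm (hlax t)).1.1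
    -- differentiating `r^m = l`
    have hv' : ∑ i ∈ Finset.range m, r ^ i * b * r ^ (m - 1 - i) = v := by
      have h1 := hb.pow m
      simp only [fun t => (isRoot_root hm (hlax t)).pow_eq] at h1
      exact h1.unique hjl
    have h2 : form ((m : ℂ)⁻¹ • (r ^ (n + 1) * s)) v = trace (r ^ n * b) := by
      have e : r ^ (n + 1) * s * r ^ (m - 1) = r ^ n := by
        rw [mul_assoc, ← (hrs.pow_left _).eq, ← mul_assoc, ← pow_add,
          show n + 1 + (m - 1) = n + m by omega, pow_add, mul_assoc, hr.pow_eq, hls, mul_one]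
      rw [form_eq, smul_mul_assoc, trace_smul, ← hv', trace_sum_pow_mul hQ hre hbe
        ((Commute.pow_self r _).mul_left hrs.symm), smul_smul, inv_mul_cancel₀ hm', one_smul, e]
    have h3 := trace_sum_pow_mul Op.IsEven.one hre hbe (Commute.one_left r) (n + 1)
    rw [one_mul, one_mul, Nat.add_sub_cancel] at h3
    have h4 := ((hb.pow (n + 1)).hasJet_trace).smul ((n : ℂ) + 1)⁻¹
    rw [Nat.add_sub_cancel, h3, smul_smul, Nat.cast_succ, inv_mul_cancel₀ hn', one_smul,
      ← h2] at h4
    have e : ∀ l : Op V, casimir m n l = ((n : ℂ) + 1)⁻¹ • trace (root m l ^ (n + 1)) := by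
      intro l
      rw [casimir, form_eq, Op.pow_eq_npow, pow_succ']
    simp only [e]
    exact h4

/-! ### Non-degeneracy of the pairings -/

/-- The complex conjugate of a smooth function on the circle. -/
def circleConj (f : CircleFun) : CircleFun :=
  ⟨fun x => (starRingEnd ℂ) (f.1 x), Complex.conjCLE.contDiff.comp f.2.1,
    fun x => congrArg (starRingEnd ℂ) (f.2.2 x)⟩

theorem circleFun_eq_zero {g : CircleFun} (h : ∀ f, circleInt (f * g) = 0) : g = 0 := by
  have hcont : Continuous fun x => Complex.normSq (g.1 x) :=
    Complex.continuous_normSq.comp g.2.1.continuous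
  have h1 : ∫ x in (0 : ℝ)..(2 * Real.pi), Complex.normSq (g.1 x) = 0 := by
    have h2 : ∫ x in (0 : ℝ)..(2 * Real.pi), (starRingEnd ℂ) (g.1 x) * g.1 x = 0 :=
      h (circleConj g)
    simp only [← Complex.normSq_eq_conj_mul_self] at h2
    rw [intervalIntegral.integral_ofReal] at h2
    exact_mod_cast h2
  have h0 : ∀ x ∈ Set.Icc 0 (2 * Real.pi), g.1 x = 0 := by
    intro x hx
    by_contra hne
    exact h1.not_gt (intervalIntegral.integral_pos Real.two_pi_pos hcont.continuousOn
      (fun y _ => Complex.normSq_nonneg _) ⟨x, hx, Complex.normSq_pos.2 hne⟩)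
  refine Subtype.ext (funext fun x => ?_)
  obtain ⟨y, hy, hxy⟩ := g.2.2.exists_mem_Ico₀ Real.two_pi_pos x
  exact hxy.trans (h0 y (Set.Ico_subset_Icc_self hy))

/-- Integration against scalar functions separates `Λ`-valued functions. -/
theorem grFun_eq_zero {a : GrFun V} (h : ∀ f, grInt (GrFun.tmul f 1 * a) = 0) : a = 0 := by
  classical
  let e := Module.Basis.ofVectorSpace ℂ (Grassmann V)
  have hc : ∀ (f : CircleFun) (a : GrFun V) i, e.repr (grInt (GrFun.tmul f 1 * a)) i
      = circleInt (f * TensorProduct.equivFinsuppOfBasisRight (M := CircleFun) e a i) := by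
    intro f a i
    induction a using GrFun.induction with
    | h0 =>
      rw [mul_zero, map_zero, map_zero]
      refine Eq.symm ((congrArg (fun z => circleInt (f * z)) ?_).trans
        ((congrArg circleInt (mul_zero f)).trans (map_zero circleInt)))
      exact DFunLike.congr_fun (map_zero (TensorProduct.equivFinsuppOfBasisRight
        (M := CircleFun) e)) i
    | ht g x =>
      rw [GrFun.tmul_mul_tmul, one_mul, grInt_tmul]
      refine Eq.trans ?_ (congrArg (fun z => circleInt (f * z))
        (TensorProduct.equivFinsuppOfBasisRight_apply_tmul_apply e g x i).symm)
      rw [mul_smul_comm, map_smul, map_smul, Finsupp.smul_apply, smul_eq_mul, smul_eq_mul, mul_comm]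
    | ha a b ha hb =>
      rw [mul_add, map_add, map_add, Finsupp.add_apply, ha, hb, ← map_add, ← mul_add]
      exact congrArg (fun z => circleInt (f * z)) (DFunLike.congr_fun (map_add
        (TensorProduct.equivFinsuppOfBasisRight (M := CircleFun) e) a b) i).symm
  refine (TensorProduct.equivFinsuppOfBasisRight (M := CircleFun) e).injective ?_
  refine Eq.trans ?_ (map_zero (TensorProduct.equivFinsuppOfBasisRight (M := CircleFun) e)).symm
  ext1 i
  refine circleFun_eq_zero fun f => ?_
  rw [← hc, h f, map_zero]
  rfl

/-- Contraction of `Λ`-valued functions with a linear functional on `V`. -/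
def grContract (d : V →ₗ[ℂ] ℂ) : GrFun V →ₗ[ℂ] GrFun V :=
  LinearMap.lTensor CircleFun (CliffordAlgebra.contractLeft (Q := (0 : QuadraticForm ℂ V)) d)

theorem grContract_tmul (d : V →ₗ[ℂ] ℂ) (f : CircleFun) (x : Grassmann V) :
    grContract d (GrFun.tmul f x)
      = GrFun.tmul f (CliffordAlgebra.contractLeft (Q := (0 : QuadraticForm ℂ V)) d x) :=
  LinearMap.lTensor_tmul _ _ f x

theorem grContract_ι_mul (d : V →ₗ[ℂ] ℂ) (v : V) (a : GrFun V) :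
    grContract d (GrFun.tmul 1 (ExteriorAlgebra.ι ℂ v) * a)
      = d v • a - GrFun.tmul 1 (ExteriorAlgebra.ι ℂ v) * grContract d a := by
  induction a using GrFun.induction with
  | h0 => simp only [mul_zero, map_zero, smul_zero, sub_zero]
  | ht f x =>
    have h := CliffordAlgebra.contractLeft_ι_mul (Q := (0 : QuadraticForm ℂ V)) (d := d) v x
    rw [GrFun.tmul_mul_tmul, one_mul, grContract_tmul, grContract_tmul, GrFun.tmul_mul_tmul,
      one_mul, ← GrFun.tmul_smul, ← GrFun.tmul_sub]
    exact congrArg _ h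
  | ha a b ha hb =>
    rw [mul_add, map_add, ha, hb, map_add, mul_add, smul_add]
    abel

/-- An element of the Grassmann algebra involves finitely many directions of `V` only. -/
theorem grassmann_exists_fg (x : Grassmann V) : ∃ W : Submodule ℂ V, W.FG ∧
    ∀ d : V →ₗ[ℂ] ℂ, W ≤ LinearMap.ker d →
      CliffordAlgebra.contractLeft (Q := (0 : QuadraticForm ℂ V)) d x = 0 := by
  induction x using CliffordAlgebra.left_induction with
  | algebraMap r =>
    exact ⟨⊥, Submodule.fg_bot, fun d _ => CliffordAlgebra.contractLeft_algebraMap 0 d r⟩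
  | add x y hx hy =>
    obtain ⟨W, hW, h⟩ := hx
    obtain ⟨W', hW', h'⟩ := hy
    refine ⟨W ⊔ W', hW.sup hW', fun d hd => ?_⟩
    rw [map_add, h d (le_sup_left.trans hd), h' d (le_sup_right.trans hd), add_zero]
  | ι_mul x v hx =>
    obtain ⟨W, hW, h⟩ := hx
    refine ⟨W ⊔ Submodule.span ℂ {v}, hW.sup (Submodule.fg_span_singleton v), fun d hd => ?_⟩
    have hv : d v = 0 := hd (Submodule.mem_sup_right (Submodule.mem_span_singleton_self v))
    rw [CliffordAlgebra.contractLeft_ι_mul, h d (le_sup_left.trans hd), hv, zero_smul, mul_zero,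
      sub_zero]

theorem grFun_exists_fg (a : GrFun V) : ∃ W : Submodule ℂ V, W.FG ∧
    ∀ d : V →ₗ[ℂ] ℂ, W ≤ LinearMap.ker d → grContract d a = 0 := by
  induction a using GrFun.induction with
  | h0 => exact ⟨⊥, Submodule.fg_bot, fun d _ => map_zero _⟩
  | ht f x =>
    obtain ⟨W, hW, h⟩ := grassmann_exists_fg x
    refine ⟨W, hW, fun d hd => ?_⟩
    rw [grContract_tmul, h d hd]
    exact TensorProduct.tmul_zero _ f
  | ha a b ha hb =>
    obtain ⟨W, hW, h⟩ := ha
    obtain ⟨W', hW', h'⟩ := hb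
    refine ⟨W ⊔ W', hW.sup hW', fun d hd => ?_⟩
    rw [map_add, h d (le_sup_left.trans hd), h' d (le_sup_right.trans hd), add_zero]

/-- In infinitely many odd variables an element annihilated by all of them vanishes. -/
theorem grFun_eq_zero_of_ι_mul (hV : ¬ Module.Finite ℂ V) {a : GrFun V}
    (h : ∀ v, GrFun.tmul 1 (ExteriorAlgebra.ι ℂ v) * a = 0) : a = 0 := by
  obtain ⟨W, hW, hWa⟩ := grFun_exists_fg a
  have hlt : W < ⊤ := lt_top_iff_ne_top.2 fun hT => hV ⟨hT ▸ hW⟩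
  obtain ⟨v, -, hv⟩ := SetLike.exists_of_lt hlt
  obtain ⟨d, hdv, hd⟩ := Submodule.exists_le_ker_of_notMem hv
  have h1 := grContract_ι_mul d v a
  rw [h v, map_zero, hWa d hd, mul_zero, sub_zero] at h1
  exact (smul_eq_zero.1 h1.symm).resolve_left hdv

/-- Integration against functions of a fixed parity separates `Λ`-valued functions. -/
theorem grFun_eq_zero_of_parity (hV : ¬ Module.Finite ℂ V) (k : ℤ) {a : GrFun V}
    (h : ∀ b : GrFun V, grInvol b = sgn k • b → grInt (b * a) = 0) : a = 0 := by
  rcases Int.even_or_odd k with hk | hk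
  · refine grFun_eq_zero fun f => h _ ?_
    rw [grInvol_tmul, map_one, sgn_even hk, one_smul]
  · refine grFun_eq_zero_of_ι_mul hV fun v => grFun_eq_zero fun f => ?_
    rw [← mul_assoc, GrFun.tmul_mul_tmul, mul_one, one_mul]
    refine h _ ?_
    have h1 : (CliffordAlgebra.involute (ExteriorAlgebra.ι ℂ v) : Grassmann V)
        = -ExteriorAlgebra.ι ℂ v := CliffordAlgebra.involute_ι v
    rw [grInvol_tmul, h1, sgn_odd hk, neg_one_smul]
    exact TensorProduct.tmul_neg _ _

theorem sfun_eq_zero_of_parity (hV : ¬ Module.Finite ℂ V) (k : ℤ) {a : SFun V}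
    (h : ∀ b : SFun V, HasParity k b → berezin (b * a) = 0) : a = 0 := by
  have hz0 : ∀ b : SFun V, (sgn k • b).c0 = sgn k • b.c0 := by
    intro b
    unfold sgn
    split_ifs
    · rw [one_smul, one_smul]
    · rw [neg_one_smul, neg_one_smul]; rfl
  have hz1 : ∀ b : SFun V, (sgn k • b).c1 = sgn k • b.c1 := by
    intro b
    unfold sgn
    split_ifs
    · rw [one_smul, one_smul]
    · rw [neg_one_smul, neg_one_smul]; rfl
  ext1
  · refine grFun_eq_zero_of_parity hV (k + 1) fun b hb => ?_
    have h1 := h ⟨0, b⟩ (by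
      rw [hasParity_iff]
      ext1
      · rw [hz0, invol_c0, map_zero, smul_zero]
      · rw [hz1, invol_c1, hb, sgn_add, sgn_one, mul_neg_one, neg_smul, neg_neg])
    have h2 : ((⟨0, b⟩ : SFun V) * a).c1 = b * a.c0 := by
      rw [SFun.mul_c1, map_zero, zero_mul, add_zero]
    exact (congrArg grInt h2).symm.trans h1
  · refine grFun_eq_zero_of_parity hV k fun b hb => ?_
    have h1 := h ⟨b, 0⟩ (by
      rw [hasParity_iff]
      ext1
      · rw [hz0, invol_c0, hb]
      · rw [hz1, invol_c1, map_zero, neg_zero, smul_zero])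
    have h2 : ((⟨b, 0⟩ : SFun V) * a).c1 = sgn k • (b * a.c1) := by
      rw [SFun.mul_c1, zero_mul, zero_add, hb, smul_mul_assoc]
    have h3 : sgn k • grInt (b * a.c1) = 0 := by
      rw [← map_zsmul]
      exact (congrArg grInt h2).symm.trans h1
    rw [← sgn_smul_sgn_smul k (grInt (b * a.c1)), h3, smul_zero]

theorem eq_zero_of_pair_left (hV : ¬ Module.Finite ℂ V) (k : ℤ) {a : SFun V}
    (h : ∀ b, HasParity k b → pair b a = 0) : a = 0 := by
  have h1 := sfun_eq_zero_of_parity hV k (a := invol a) fun b hb => by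
    rw [← pair_eq, h b hb]
  rw [← invol_invol a, h1, map_zero]

theorem eq_zero_of_pair_right (hV : ¬ Module.Finite ℂ V) (j k : ℤ) {a : SFun V}
    (ha : HasParity j a) (h : ∀ b, HasParity k b → pair a b = 0) : a = 0 := by
  refine sfun_eq_zero_of_parity hV k fun b hb => ?_
  have h1 := h b hb
  rw [pair_eq, hasParity_iff.1 hb, mul_smul_comm, ha.mul_comm hb, smul_smul, map_zsmul,
    ← sgn_add] at h1
  rw [← sgn_smul_sgn_smul (k + j * k) (berezin (b * a)), h1, smul_zero]

/-- The form `(Q, v)` on variations of Lax operators determines `Q` up to terms of order less than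
`-2m`. -/
theorem ordLE_of_form_eq_zero (hV : ¬ Module.Finite ℂ V) {m : ℕ} {Q : Op V} (hQ : Q.IsEven)
    (h : ∀ v, IsLaxVar m v → form Q v = 0) : OrdLE Q (-(2 * m) - 1) := by
  have key : ∀ n : ℕ, OrdLE Q (-(2 * m) - 1 + n) → OrdLE Q (-(2 * m) - 1) := by
    intro n
    induction n with
    | zero => intro h; simpa using h
    | succ n ih =>
      intro hn
      have hJ : -(2 * (m : ℤ)) - 1 + ((n + 1 : ℕ) : ℤ) = -(2 * m) + n := by push_cast; ring
      rw [hJ] at hn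
      refine ih ((ordLE_sub_one hn ?_).of_le (by omega))
      set J : ℤ := -(2 * m) + n with hJ'
      have h1 : twist (-1 - J) (Q.coeff J) = 0 := by
        refine sfun_eq_zero_of_parity hV (-1 - J) fun b hb => ?_
        have hv : IsLaxVar m (Op.mono b (-1 - J)) := by
          refine isLaxVar_iff.2 ⟨?_, (OrdLE.mono b _).of_le (by omega)⟩
          have := Op.HasParity.mono hb (-1 - J)
          rwa [sub_self, ← Op.isEven_iff] at this
        have h2 := h _ hv
        rw [form_eq, trace_mul_comm hQ hv.1, trace, ← Op.comp_eq_mul, mono_comp_coeff] at h2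
        have h3 := leftPow_coeff_top hn (-1 - J)
        rw [add_sub_cancel] at h3
        rwa [h3] at h2
      rw [← twist_twist (-1 - J) (Q.coeff J), h1, map_zero]
  obtain ⟨J, hJ⟩ := Q.exists_ordLE
  exact key (J + (2 * m) + 1).toNat (hJ.of_le (by omega))

/-! ### The Hamiltonian form of the Lax flows -/

theorem casimir_hamiltonian {m : ℕ} {u : Phase V N} {P : Op V} (hu : IsPoint m u) (hP : P.IsEven)
    (hPu : comm u.l P = 0) : laxField P u = -extendedL u (P, 0, 0, 0, 0) := by
  have hg : IsCovector ((P, 0, 0, 0, 0) : Phase V N) :=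
    ⟨hP, fun _ => ⟨HasParity.zero _, HasParity.zero _, HasParity.zero _, HasParity.zero _⟩⟩
  have h1 := extendedL_l hu hg
  have hr0 : ∀ x : SFun V, rankOne x 0 = 0 := fun x => map_zero (rankOneL x)
  have h0r : ∀ x : SFun V, rankOne 0 x = 0 := fun x => LinearMap.map_zero₂ rankOneL x
  have h2 : explicitFirstRow u (P, 0, 0, 0, 0) = comm u.l P.plus := by
    change comm u.l P.plus - (comm u.l P).plus + ∑ i, (rankOne (u.f i) 0 - rankOne 0 (u.fs i)
      + rankOne (u.Φ i) 0 - rankOne 0 (u.Φs i)) = _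
    rw [hPu, Op.plus_eq_zero (OrdLE.zero _), sub_zero]
    simp only [hr0, h0r, sub_zero, add_zero, Finset.sum_const_zero]
  refine Prod.ext ?_ ?_
  · change comm P.plus u.l = -(extendedL u (P, 0, 0, 0, 0)).l
    rw [h1, h2, comm_eq, comm_eq, neg_sub]
  · rw [extendedL_eq_explicitL]
    refine Prod.ext ?_ (Prod.ext ?_ (Prod.ext ?_ ?_)) <;> funext i
    · change act P (u.f i) = -(-0 - act P (u.f i))
      rw [neg_zero, zero_sub, neg_neg]
    · change -adjAct P (u.Φs i) = -(0 + adjAct P (u.Φs i))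
      rw [zero_add]
    · change -adjAct P (u.fs i) = -(0 + adjAct P (u.fs i))
      rw [zero_add]
    · change act P (u.Φ i) = -(-0 - act P (u.Φ i))
      rw [neg_zero, zero_sub, neg_neg]

theorem laxField_congr {P Q : Op V} (h : P.plus = Q.plus) (u : Phase V N) :
    laxField P u = laxField Q u := by
  have h1 : ∀ f, act P f = act Q f := fun f => by rw [← act_plus, h, act_plus]
  have h2 : ∀ f, adjAct P f = adjAct Q f := fun f => by rw [← adjAct_plus, h, adjAct_plus]
  simp only [laxField, h, h1, h2]

/-- Operators of order less than `-2m` lie in the kernel of `L` at every point. -/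
theorem extendedL_eq_zero {m : ℕ} {u : Phase V N} (hu : IsPoint m u) {Q : Op V}
    (hQ : OrdLE Q (-(2 * m) - 1)) : extendedL u (Q, 0, 0, 0, 0) = 0 := by
  have hQ' : OrdLE Q (-1) := hQ.of_le (by omega)
  have hl := hu.backlundInv.1.2.2
  rw [extendedL_eq_explicitL]
  have hr0 : ∀ x : SFun V, rankOne x 0 = 0 := fun x => map_zero (rankOneL x)
  have h0r : ∀ x : SFun V, rankOne 0 x = 0 := fun x => LinearMap.map_zero₂ rankOneL x
  refine Prod.ext ?_ (Prod.ext ?_ (Prod.ext ?_ (Prod.ext ?_ ?_)))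
  · change theta (backlundInv u).l Q + ∑ i, (rankOne (u.f i) (0 + adjAct Q (u.fs i))
        - rankOne (0 + act Q (u.f i)) (u.fs i) + rankOne (u.Φ i) (0 + adjAct Q (u.Φs i))
        - rankOne (0 + act Q (u.Φ i)) (u.Φs i)) = 0
    simp only [act_eq_zero hQ', adjAct_eq_zero hQ', add_zero, hr0, h0r, sub_zero,
      Finset.sum_const_zero]
    rw [theta_eq, Op.plus_eq_zero hQ', mul_zero, zero_mul, sub_zero, Op.plus_eq_zero, sub_zero]
    exact ((OrdLE.mul hl hQ).of_le (by omega)).sub ((hQ.mul hl).of_le (by omega))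
  all_goals
    funext i
  · change -0 - act Q (u.f i) = 0
    rw [act_eq_zero hQ', neg_zero, sub_zero]
  · change 0 + adjAct Q (u.Φs i) = 0
    rw [adjAct_eq_zero hQ', add_zero]
  · change 0 + adjAct Q (u.fs i) = 0
    rw [adjAct_eq_zero hQ', add_zero]
  · change -0 - act Q (u.Φ i) = 0
    rw [act_eq_zero hQ', neg_zero, sub_zero]

theorem pair_zero_left (u : SFun V) : pair 0 u = 0 := LinearMap.map_zero₂ pairL u

theorem pair_zero_right (u : SFun V) : pair u 0 = 0 := map_zero (pairL u)

theorem form_zero_right (P : Op V) : form P 0 = 0 := map_zero (formL P)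

theorem form_sub_left (P Q v : Op V) : form (P - Q) v = form P v - form Q v :=
  LinearMap.map_sub₂ formL P Q v

theorem pairing_op (P : Op V) (v : Phase V N) : pairing (P, 0, 0, 0, 0) v = form P v.l := by
  change form P v.l + ∑ i, (pair (v.f i) 0 + pair 0 (v.Φs i) + pair 0 (v.fs i)
    + pair (v.Φ i) 0) = _
  simp only [pair_zero_left, pair_zero_right, add_zero, Finset.sum_const_zero]

theorem IsLaxVar.zero (m : ℕ) : IsLaxVar m (0 : Op V) := ⟨Op.IsEven.zero, fun _ _ => rfl⟩

/-- For infinite-dimensional `V`, a covector that pairs with tangent vectors as `(P, 0, 0, 0, 0)`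
does is of the form `(P + Q, 0, 0, 0, 0)`, with `Q` of order less than `-2m`. -/
theorem covector_eq_of_pairing (hV : ¬ Module.Finite ℂ V) {m : ℕ} {P : Op V} {g : Phase V N}
    (hP : P.IsEven) (hg : IsCovector g) (h : ∀ v, IsTangent m v → pairing g v = form P v.l) :
    OrdLE (g.l - P) (-(2 * m) - 1) ∧ g = (g.l, 0, 0, 0, 0) := by
  classical
  have z := HasParity.zero (V := V)
  have hs : ∀ {k : ℤ} (i : Fin N) {b : SFun V}, HasParity k b →
      ∀ j, HasParity k ((Pi.single i b : Fin N → SFun V) j) := by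
    intro k i b hb j
    rw [Pi.single_apply]
    split_ifs
    · exact hb
    · exact z k
  have hsl : ∀ (i : Fin N) (b : SFun V) (x : Fin N → SFun V),
      ∑ j, pair ((Pi.single i b : Fin N → SFun V) j) (x j) = pair b (x i) := by
    intro i b x
    rw [Finset.sum_eq_single i]
    · rw [Pi.single_eq_same]
    · intro j _ hj
      rw [Pi.single_eq_of_ne hj, pair_zero_left]
    · exact fun hi => absurd (Finset.mem_univ i) hi
  have hsr : ∀ (i : Fin N) (b : SFun V) (x : Fin N → SFun V),
      ∑ j, pair (x j) ((Pi.single i b : Fin N → SFun V) j) = pair (x i) b := by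
    intro i b x
    rw [Finset.sum_eq_single i]
    · rw [Pi.single_eq_same]
    · intro j _ hj
      rw [Pi.single_eq_of_ne hj, pair_zero_right]
    · exact fun hi => absurd (Finset.mem_univ i) hi
  refine ⟨ordLE_of_form_eq_zero hV (hg.1.sub hP) fun v hv => ?_, Prod.ext rfl (Prod.ext ?_
    (Prod.ext ?_ (Prod.ext ?_ ?_)))⟩
  · have h1 := h (v, 0, 0, 0, 0) ⟨hv, fun _ => ⟨z _, z _, z _, z _⟩⟩
    change form g.l v + ∑ i, (pair 0 (g.f i) + pair (g.Φs i) 0 + pair (g.fs i) 0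
      + pair 0 (g.Φ i)) = form P v at h1
    simp only [pair_zero_left, pair_zero_right, add_zero, Finset.sum_const_zero] at h1
    rw [form_sub_left, h1, sub_self]
  all_goals
    funext i
  · refine eq_zero_of_pair_left hV 0 fun b hb => ?_
    have h1 := h (0, Pi.single i b, 0, 0, 0) ⟨IsLaxVar.zero m, fun j => ⟨hs i hb j, z _, z _, z _⟩⟩
    change form g.l 0 + ∑ j, (pair ((Pi.single i b : Fin N → SFun V) j) (g.f j) + pair (g.Φs j) 0
      + pair (g.fs j) 0 + pair 0 (g.Φ j)) = form P 0 at h1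
    simp only [pair_zero_left, pair_zero_right, add_zero, form_zero_right, zero_add, hsl] at h1
    exact h1
  · refine eq_zero_of_pair_right hV 1 0 (hg.2 i).2.1 fun b hb => ?_
    have h1 := h (0, 0, Pi.single i b, 0, 0) ⟨IsLaxVar.zero m, fun j => ⟨z _, hs i hb j, z _, z _⟩⟩
    change form g.l 0 + ∑ j, (pair 0 (g.f j) + pair (g.Φs j) ((Pi.single i b : Fin N → SFun V) j)
      + pair (g.fs j) 0 + pair 0 (g.Φ j)) = form P 0 at h1
    simp only [pair_zero_left, pair_zero_right, add_zero, form_zero_right, zero_add, hsr] at h1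
    exact h1
  · refine eq_zero_of_pair_right hV 0 1 (hg.2 i).2.2.1 fun b hb => ?_
    have h1 := h (0, 0, 0, Pi.single i b, 0) ⟨IsLaxVar.zero m, fun j => ⟨z _, z _, hs i hb j, z _⟩⟩
    change form g.l 0 + ∑ j, (pair 0 (g.f j) + pair (g.Φs j) 0
      + pair (g.fs j) ((Pi.single i b : Fin N → SFun V) j) + pair 0 (g.Φ j)) = form P 0 at h1
    simp only [pair_zero_left, pair_zero_right, add_zero, form_zero_right, zero_add, hsr] at h1
    exact h1
  · refine eq_zero_of_pair_left hV 1 fun b hb => ?_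
    have h1 := h (0, 0, 0, 0, Pi.single i b) ⟨IsLaxVar.zero m, fun j => ⟨z _, z _, z _, hs i hb j⟩⟩
    change form g.l 0 + ∑ j, (pair 0 (g.f j) + pair (g.Φs j) 0
      + pair (g.fs j) 0 + pair ((Pi.single i b : Fin N → SFun V) j) (g.Φ j)) = form P 0 at h1
    simp only [pair_zero_left, pair_zero_right, add_zero, form_zero_right, zero_add, hsl] at h1
    exact h1

theorem comm_R_eq {l P : Op V} (h : comm l P = 0) : comm P.R l = comm P.plus l := by
  have hc : l * P = P * l := sub_eq_zero.1 h
  have e : P.R = P.plus - (2⁻¹ : ℂ) • P := by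
    rw [Op.R]
    module
  rw [comm_eq, comm_eq, e, sub_mul, mul_sub, smul_mul_assoc, mul_smul_comm, hc]
  abel

theorem casimir_flow_hamiltonian {m : ℕ} (hm : 1 ≤ m) (n : ℕ) {u : Phase V N} (hu : IsPoint m u) :
    (∃ P : Op V, IsLaxGradient m (casimir m n) u.l P ∧ comm u.l P = 0 ∧
      comm P.R u.l = comm P.plus u.l ∧
      IsGradient m (fun w => casimir m n w.l) u (P, 0, 0, 0, 0) ∧
      laxField P u = -extendedL u (P, 0, 0, 0, 0)) ∧
    (¬ Module.Finite ℂ V → ∀ (P : Op V) (g : Phase V N),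
      IsLaxGradient m (casimir m n) u.l P → IsGradient m (fun w => casimir m n w.l) u g →
      laxField P u = -extendedL u g) := by
  obtain ⟨P, hP, hc, hjet⟩ := exists_gradient_casimir hm n hu.1
  have hcomm : comm u.l P = 0 := sub_eq_zero.2 hc
  have hvar : ∀ v : Phase V N, IsTangent m v →
      HasVariation (fun w : Phase V N => casimir m n w.l) u v (form P v.l) :=
    fun v hv => HasJet.hasVariation (hjet v.l hv.1)
  have hham := casimir_hamiltonian hu hP hcomm
  refine ⟨⟨P, ⟨hP, fun v hv => (hjet v hv).hasVariation⟩, hcomm, comm_R_eq hcomm,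
    ⟨⟨hP, fun _ => ⟨HasParity.zero _, HasParity.zero _, HasParity.zero _, HasParity.zero _⟩⟩,
      fun v hv => ?_⟩, hham⟩, fun hV Q g hQ hg => ?_⟩
  · rw [pairing_op]
    exact hvar v hv
  · have h1 : OrdLE (Q - P) (-(2 * m) - 1) :=
      ordLE_of_form_eq_zero hV (hQ.1.sub hP) fun v hv => by
        rw [form_sub_left, (hQ.2 v hv).unique (hjet v hv).hasVariation, sub_self]
    obtain ⟨h2, h3⟩ := covector_eq_of_pairing hV hP hg.1
      fun v hv => (hg.2 v hv).unique (hvar v hv)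
    have h4 : Q.plus = P.plus := by
      have h := Op.plus_eq_zero (h1.of_le (show -(2 * (m : ℤ)) - 1 ≤ -1 by omega))
      rwa [Op.plus_sub, sub_eq_zero] at h
    have h5 : g = ((P, 0, 0, 0, 0) : Phase V N) + (1 : ℂ) • (g.l - P, 0, 0, 0, 0) := by
      rw [one_smul]
      refine h3.trans (Prod.ext (add_sub_cancel P g.l).symm ?_)
      exact (add_zero _).symm
    rw [laxField_congr h4, hham]
    conv_rhs => rw [h5]
    rw [extendedL_add_smul, extendedL_eq_zero hu h2, smul_zero, add_zero]

end SuperLax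

end

theorem theorem2 {V : Type*} [AddCommGroup V] [Module ℂ V] (N m : ℕ) (hm : 1 ≤ m) (n : ℕ) :
    (∀ l : SuperLax.Op V, SuperLax.IsLax m l → ∃! r, SuperLax.IsRoot m l r) ∧
    Set.BijOn (SuperLax.backlund (V := V) (N := N))
      {w | SuperLax.IsPoint m w} {u | SuperLax.IsPoint m u} ∧
    (∀ u : SuperLax.Phase V N, SuperLax.backlund (SuperLax.backlundInv u) = u) ∧
    (∀ w v : SuperLax.Phase V N, SuperLax.IsPoint m w → SuperLax.IsTangent m v →
      SuperLax.HasVariation SuperLax.backlund w v (SuperLax.backlundDeriv w v)) ∧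
    (∀ w v g : SuperLax.Phase V N,
      SuperLax.IsPoint m w → SuperLax.IsTangent m v → SuperLax.IsCovector g →
      SuperLax.IsCovector (SuperLax.backlundAdj w g) ∧
      SuperLax.pairing (SuperLax.backlundAdj w g) v =
        SuperLax.pairing g (SuperLax.backlundDeriv w v)) ∧
    (∀ u g : SuperLax.Phase V N, SuperLax.IsPoint m u → SuperLax.IsCovector g →
      SuperLax.extendedL u g = SuperLax.explicitL u g ∧
      (SuperLax.extendedL u g).l = SuperLax.explicitFirstRow u g) ∧
    SuperLax.IsPoisson m (SuperLax.extendedL (V := V) (N := N)) ∧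
    ∀ u : SuperLax.Phase V N, SuperLax.IsPoint m u →
      (∃ P : SuperLax.Op V,
        SuperLax.IsLaxGradient m (SuperLax.casimir m n) u.l P ∧
        SuperLax.comm u.l P = 0 ∧
        SuperLax.comm P.R u.l = SuperLax.comm P.plus u.l ∧
        SuperLax.IsGradient m (fun w => SuperLax.casimir m n w.l) u (P, 0, 0, 0, 0) ∧
        SuperLax.laxField P u = -SuperLax.extendedL u (P, 0, 0, 0, 0)) ∧
      (¬ Module.Finite ℂ V → ∀ (P : SuperLax.Op V) (g : SuperLax.Phase V N),
        SuperLax.IsLaxGradient m (SuperLax.casimir m n) u.l P →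
        SuperLax.IsGradient m (fun w => SuperLax.casimir m n w.l) u g →
        SuperLax.laxField P u = -SuperLax.extendedL u g) :=
  ⟨fun _ hl => SuperLax.existsUnique_isRoot hm hl, SuperLax.bijOn_backlund m,
    SuperLax.backlund_backlundInv, fun w v _ _ => SuperLax.hasVariation_backlund w v,
    fun _ _ _ hw hv hg =>
      ⟨SuperLax.isCovector_backlundAdj hw hg, SuperLax.pairing_backlundAdj hw hv hg⟩,
    fun u g hu hg => ⟨SuperLax.extendedL_eq_explicitL u g, SuperLax.extendedL_l hu hg⟩,
    SuperLax.isPoisson_extendedL m, fun _ hu => SuperLax.casimir_flow_hamiltonian hm n hu⟩
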